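/- Let $n\ge 1$, $Q=2n+2$, and let $S^{2n+1}$ be the unit sphere of $\mathbb C^{n+1}$ with its Euclidean surface measure $d\zeta$. Let $\mathcal H_{jk}\subset L^2(S^{2n+1})$ (complex-valued functions) be the space of restrictions to the sphere of the harmonic polynomials in $\zeta,\bar\zeta$ that are homogeneous of degree $j$ in $\zeta$ and of degree $k$ in $\bar\zeta$, and let $F_{jk}$ be the orthogonal projection of $F\in L^2$ on $\mathcal H_{jk}$. Let $\mathcal P$ be the closed linear span in $L^2$ of all $\mathcal H_{j0}$ and $\mathcal H_{0j}$, $j\ge 0$ (the $L^2$ CR-pluriharmonic functions), and let $\mathbb R\mathcal P$ be the real vector space of the real-valued functions in $\mathcal P$. Let $W^{Q/2,2}$ be the space of all $F\in L^2$ with $$\|F\|_{W^{Q/2,2}}^2=\sum_{j,k\ge 0}\Big(\big(j+\tfrac n2\big)\big(k+\tfrac n2\big)\Big)^{Q/2}\|F_{jk}\|_2^2<\infty .$$ Let $\mathrm{Aut}(S^{2n+1})$ be the group of conformal transformations (CR automorphisms) of the sphere, i.e. of the linear fractional maps $\tau(\zeta)=(a\zeta+b)/(c\cdot\zeta+d)$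 given by the matrices $\begin{pmatrix}a&b\\c&d\end{pmatrix}\in SU(n+1,1)$; let $|J_\tau|$ be the Jacobian determinant of $\tau:S^{2n+1}\to S^{2n+1}$ (in absolute value, with respect to $d\zeta$), and let $F^\tau=F\circ\tau+\log|J_\tau|$ (the conformal action). A set $M$ of functions is called invariant if $F^\tau\in M$ for all $F\in M$ and $\tau\in\mathrm{Aut}(S^{2n+1})$. **Proposition 3.2.** 1. $\mathbb R\mathcal P$ is a closed real-linear subspace of $L^2(S^{2n+1})$ that is invariant under the conformal action, and it is the minimal one: every closed real-linear subspace of $L^2(S^{2n+1})$ that is invariant under the conformal action contains $\mathbb R\mathcal P$. 2. $W^{Q/2,2}\cap\mathbb R\mathcal P$ is a closed real-linear subspace of $W^{Q/2,2}$ (with respect to the norm of $W^{Q/2,2}$) that is invariant under the conformal action, and it is the minimal one: every real-linear subspace of $W^{Q/2,2}$ that is closed in $W^{Q/2,2}$ and invariant under the conformal action contains $W^{Q/2,2}\cap\mathbb R\mathcal P$. 3. For $F\in W^{Q/2,2}\cap\mathbb R\mathcal P$ the function $e^F$ is integrable, and the Beckner–Onofri functional $$\mathcal J[F]=\frac1{2(n+1)!}\langle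 F\mathcal A_Q'F\rangle+\langle F\rangle-\log\,\langle e^F\rangle ,$$ satisfies $\mathcal J[F^\tau]=\mathcal J[F]$ for all $F\in W^{Q/2,2}\cap\mathbb R\mathcal P$ and all $\tau\in\mathrm{Aut}(S^{2n+1})$. Here $\langle G\rangle=\frac1{\omega_{2n+1}}\int_{S^{2n+1}} G\,d\zeta$ is the average of $G$ over the sphere ($\omega_{2n+1}=\int_{S^{2n+1}}d\zeta$), and $\mathcal A'_Q$ is the operator on $\mathcal P$ that acts on $\mathcal H_{j0}$ and $\mathcal H_{0j}$ as multiplication by $j(j+1)\cdots(j+n)$, extended to $W^{Q/2,2}\cap\mathcal P$ through its quadratic form, so that $\int F\mathcal A'_QF\,d\zeta=\sum_{j\ge 1}j(j+1)\cdots(j+n)\,\big(\|F_{j0}\|_2^2+\|F_{0j}\|_2^2\big)$. -/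

import Mathlib

open MeasureTheory

noncomputable section

namespace CRSphere

/-! ### The sphere and its measure -/

/-- The complex Euclidean space `ℂ^{n+1}`. -/
abbrev CSpace (n : ℕ) : Type := EuclideanSpace ℂ (Fin (n + 1))

/-- The unit sphere `S^{2n+1}` of `ℂ^{n+1}`. -/
abbrev Sph (n : ℕ) : Type := Metric.sphere (0 : CSpace n) 1

/-- The standard (unnormalized) Euclidean surface measure `dζ` on `S^{2n+1}`. -/
def surf (n : ℕ) : Measure (Sph n) := (volume : Measure (CSpace n)).toSphere

instance instIsFiniteMeasureSurf (n : ℕ) : IsFiniteMeasure (surf n) := by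
  unfold surf; infer_instance

/-- The space of complex valued functions `L²(S^{2n+1})`. -/
abbrev L2 (n : ℕ) : Type := Lp ℂ 2 (surf n)

/-! ### Spherical harmonics of bidegree `(j, k)` -/

/-- Polynomials in `ζ` and `ζ̄`: the variable `Sum.inl i` stands for `ζ_i`, and `Sum.inr i` for its
complex conjugate. -/
abbrev Poly (n : ℕ) : Type := MvPolynomial (Fin (n + 1) ⊕ Fin (n + 1)) ℂ

/-- Polynomials that are homogeneous of degree `j` in the `ζ`'s and of degree `k` in the `ζ̄`'s. -/
def bihomogeneous (n j k : ℕ) : Submodule ℂ (Poly n) :=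
  MvPolynomial.weightedHomogeneousSubmodule ℂ
    (Sum.elim (fun _ => ((1, 0) : ℕ × ℕ)) (fun _ => ((0, 1) : ℕ × ℕ))) (j, k)

/-- The operator `∑ᵢ ∂²/∂ζ_i ∂ζ̄_i` (a constant multiple of the Euclidean Laplacian). -/
def complexLaplacian (n : ℕ) : Poly n →ₗ[ℂ] Poly n :=
  ∑ i : Fin (n + 1),
    ((MvPolynomial.pderiv (R := ℂ) (Sum.inl i : Fin (n + 1) ⊕ Fin (n + 1))).toLinearMap ∘ₗ
      (MvPolynomial.pderiv (R := ℂ) (Sum.inr i : Fin (n + 1) ⊕ Fin (n + 1))).toLinearMap)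

/-- Restriction of a polynomial in `ζ, ζ̄` to a continuous function on the sphere. -/
def restrictSph (n : ℕ) : Poly n →ₐ[ℂ] C(Sph n, ℂ) :=
  MvPolynomial.aeval (Sum.elim
    (fun i => (⟨fun ζ => (ζ : CSpace n) i, by fun_prop⟩ : C(Sph n, ℂ)))
    (fun i => (⟨fun ζ => (starRingEnd ℂ) ((ζ : CSpace n) i), by fun_prop⟩ : C(Sph n, ℂ))))

/-- The space `H_{jk} ⊆ L²(S^{2n+1})` of restrictions to the sphere of the harmonic polynomials of
bidegree `(j, k)`. -/
def harm (n j k : ℕ) : Submodule ℂ (L2 n) :=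
  (bihomogeneous n j k ⊓ LinearMap.ker (complexLaplacian n)).map
    ((ContinuousMap.toLp (E := ℂ) 2 (surf n) ℂ).toLinearMap ∘ₗ (restrictSph n).toLinearMap)

lemma bihomogeneous_le (n j k : ℕ) :
    bihomogeneous n j k ≤
      MvPolynomial.restrictTotalDegree (Fin (n + 1) ⊕ Fin (n + 1)) ℂ (j + k) := by
  intro p hp
  rw [MvPolynomial.mem_restrictTotalDegree]
  refine Finset.sup_le fun d hd => ?_
  have h := hp (MvPolynomial.mem_support_iff.mp hd)
  have h1 := congrArg Prod.fst h
  have h2 := congrArg Prod.snd h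
  simp [Finsupp.weight_apply, Finsupp.sum_fintype, Prod.fst_sum, Prod.snd_sum] at h1 h2
  rw [Finsupp.sum_fintype _ _ (fun _ => rfl), Fintype.sum_sum_type]
  omega

instance instFiniteDimensionalHarm (n j k : ℕ) : FiniteDimensional ℂ (harm n j k) := by
  have h1 : FiniteDimensional ℂ
      (bihomogeneous n j k ⊓ LinearMap.ker (complexLaplacian n) : Submodule ℂ (Poly n)) :=
    Submodule.finiteDimensional_of_le (inf_le_left.trans (bihomogeneous_le n j k))
  unfold harm
  infer_instance

/-- The `L²` norm of the component of `F` in `H_{jk}`. -/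
def compNorm {n : ℕ} (j k : ℕ) (F : L2 n) : ℝ := ‖(harm n j k).starProjection F‖

/-! ### CR-pluriharmonic functions -/

/-- The space `P` of `L²` CR-pluriharmonic functions: the closed linear span (Hilbert sum) of the
spaces `H_{j0}` and `H_{0j}`, `j ≥ 0`. -/
def pluriharmonic (n : ℕ) : Submodule ℂ (L2 n) :=
  (⨆ j : ℕ, harm n j 0 ⊔ harm n 0 j).topologicalClosure

/-- The real vector space `RP` of real valued `L²` CR-pluriharmonic functions. -/
def realPluriharmonic (n : ℕ) : Submodule ℝ (L2 n) where
  carrier := {F | F ∈ pluriharmonic n ∧ ∀ᵐ ζ ∂(surf n), (F ζ).im = 0}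
  add_mem' := by
    rintro F G ⟨hF, hF'⟩ ⟨hG, hG'⟩
    refine ⟨add_mem hF hG, ?_⟩
    filter_upwards [hF', hG', Lp.coeFn_add F G] with ζ h1 h2 h3
    rw [h3, Pi.add_apply, Complex.add_im, h1, h2, add_zero]
  zero_mem' := by
    refine ⟨zero_mem _, ?_⟩
    filter_upwards [Lp.coeFn_zero ℂ 2 (surf n)] with ζ h
    rw [h, Pi.zero_apply, Complex.zero_im]
  smul_mem' := by
    rintro c F ⟨hF, hF'⟩
    refine ⟨((pluriharmonic n).restrictScalars ℝ).smul_mem c hF, ?_⟩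
    filter_upwards [hF', Lp.coeFn_smul c F] with ζ h1 h2
    simp [h2, h1]

/-! ### Folland-Stein Sobolev spaces

The conformal sublaplacian `D` acts on `H_{jk}` as multiplication by `(j + n/2) (k + n/2)`, so that
`‖D^{d/2} F‖₂² = ∑_{j,k} ((j + n/2) (k + n/2))^d ‖F_{jk}‖₂²`, where `F_{jk}` is the component of `F`
in `H_{jk}`. -/

/-- The contribution of `H_{jk}` to `‖D^{d/2} F‖₂²`. -/
def sobolevTerm {n : ℕ} (d : ℝ) (F : L2 n) (p : ℕ × ℕ) : ℝ :=
  (((p.1 : ℝ) + n / 2) * ((p.2 : ℝ) + n / 2)) ^ d * compNorm p.1 p.2 F ^ 2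

lemma sobolevTerm_nonneg {n : ℕ} (d : ℝ) (F : L2 n) (p : ℕ × ℕ) : 0 ≤ sobolevTerm d F p := by
  unfold sobolevTerm; positivity

/-- The Folland-Stein space `W^{d,2}` of all `F ∈ L²` with `D^{d/2} F ∈ L²`. -/
def sobolev (n : ℕ) (d : ℝ) : Submodule ℂ (L2 n) where
  carrier := {F | Summable (sobolevTerm d F)}
  add_mem' := by
    intro F G hF hG
    refine Summable.of_nonneg_of_le (sobolevTerm_nonneg d _) (fun p => ?_)
      ((hF.mul_left 2).add (hG.mul_left 2))
    have h : compNorm p.1 p.2 (F + G) ≤ compNorm p.1 p.2 F + compNorm p.1 p.2 G := by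
      unfold compNorm
      rw [map_add]
      exact norm_add_le _ _
    have h0 : 0 ≤ compNorm p.1 p.2 (F + G) := norm_nonneg _
    have hw : 0 ≤ (((p.1 : ℝ) + n / 2) * ((p.2 : ℝ) + n / 2)) ^ d := by positivity
    have h2 : compNorm p.1 p.2 (F + G) ^ 2 ≤
        2 * compNorm p.1 p.2 F ^ 2 + 2 * compNorm p.1 p.2 G ^ 2 := by
      nlinarith [sq_nonneg (compNorm p.1 p.2 F - compNorm p.1 p.2 G)]
    unfold sobolevTerm
    nlinarith [mul_le_mul_of_nonneg_left h2 hw]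
  zero_mem' := by
    have h : sobolevTerm d (0 : L2 n) = fun _ => 0 := by
      funext p
      simp [sobolevTerm, compNorm]
    change Summable (sobolevTerm d (0 : L2 n))
    rw [h]
    exact summable_zero
  smul_mem' := by
    intro c F hF
    have h : sobolevTerm d (c • F) = fun p => ‖c‖ ^ 2 * sobolevTerm d F p := by
      funext p
      simp only [sobolevTerm, compNorm, map_smul, norm_smul]
      ring
    change Summable (sobolevTerm d (c • F))
    rw [h]
    exact hF.mul_left _

/-- The norm `‖F‖_{W^{d,2}} = ‖D^{d/2} F‖₂`, for `F ∈ W^{d,2}`. -/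
def sobolevNorm {n : ℕ} (d : ℝ) (F : L2 n) : ℝ := Real.sqrt (∑' p : ℕ × ℕ, sobolevTerm d F p)

/-- `M` is a closed real subspace of the normed space `W^{d,2}`: it is contained in `W^{d,2}`, and
contains all its limit points with respect to the norm of `W^{d,2}`. -/
def IsClosedInSobolev {n : ℕ} (d : ℝ) (M : Submodule ℝ (L2 n)) : Prop :=
  M ≤ (sobolev n d).restrictScalars ℝ ∧
    ∀ F ∈ sobolev n d, (∀ ε : ℝ, 0 < ε → ∃ G ∈ M, sobolevNorm d (F - G) < ε) → F ∈ M

/-- The exponent `Q/2`, where `Q = 2n + 2` is the homogeneous dimension. -/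
def halfQ (n : ℕ) : ℝ := (2 * (n : ℝ) + 2) / 2

/-- The space `W^{Q/2,2} ∩ RP`. -/
def sobolevRealPluriharmonic (n : ℕ) : Submodule ℝ (L2 n) :=
  (sobolev n (halfQ n)).restrictScalars ℝ ⊓ realPluriharmonic n

/-! ### Conformal transformations and the conformal action -/

/-- The Hermitian form `|z_1|² + ⋯ + |z_{n+1}|² - |w|²` of signature `(n+1, 1)`. -/
def signForm (n : ℕ) : Matrix (Fin (n + 1) ⊕ Unit) (Fin (n + 1) ⊕ Unit) ℂ :=
  Matrix.diagonal (Sum.elim (fun _ => 1) (fun _ => -1))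

/-- Membership in `SU(n+1, 1)`. -/
def IsSU {n : ℕ} (A : Matrix (Fin (n + 1) ⊕ Unit) (Fin (n + 1) ⊕ Unit) ℂ) : Prop :=
  A.conjTranspose * signForm n * A = signForm n ∧ A.det = 1

/-- The null vector `(ζ, 1)`; the sphere is identified with the set of null lines of the form. -/
def lift {n : ℕ} (ζ : Sph n) : Fin (n + 1) ⊕ Unit → ℂ :=
  Sum.elim (fun i => (ζ : CSpace n) i) (fun _ => 1)

/-- `τ ∈ Aut(S^{2n+1})`: the map `τ` is a conformal transformation (CR automorphism) of the sphere,
i.e. the linear fractional map `ζ ↦ (a ζ + b) / (c · ζ + d)` given by a matrix of `SU(n+1, 1)` with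
blocks `a, b, c, d`. Here `w` is the denominator `c · ζ + d`. -/
def IsConformal {n : ℕ} (τ : Sph n → Sph n) : Prop :=
  ∃ A : Matrix (Fin (n + 1) ⊕ Unit) (Fin (n + 1) ⊕ Unit) ℂ, IsSU A ∧
    ∀ ζ : Sph n, ∃ w : ℂ, w ≠ 0 ∧ A.mulVec (lift ζ) = w • lift (τ ζ)

/-- The radial extension `x ↦ |x| τ(x/|x|)` of a self-map of the sphere. -/
def radialExt {n : ℕ} (τ : Sph n → Sph n) (x : CSpace n) : CSpace n :=
  open Classical in
  if hx : x = 0 then 0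
  else ‖x‖ • (τ ⟨‖x‖⁻¹ • x, by simp [norm_smul, hx]⟩ : CSpace n)

/-- The Jacobian determinant `|J_τ|` of a self-map `τ` of the sphere, with respect to the surface
measure. The differential at `ζ` of the radial extension of `τ` maps `ζ` to `τ(ζ)`, and restricts to
the differential of `τ` between the tangent spaces at `ζ` and `τ(ζ)`, which are orthogonal to `ζ` and
`τ(ζ)`; so its determinant on `ℂ^{n+1} = ℝ^{2n+2}` is that of `dτ`, up to sign. -/
def jac {n : ℕ} (τ : Sph n → Sph n) (ζ : Sph n) : ℝ :=
  |(fderiv ℝ (radialExt τ) (ζ : CSpace n)).det|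

/-- The conformal action `F ↦ F^τ = F ∘ τ + log |J_τ|`. -/
def confAct {n : ℕ} (τ : Sph n → Sph n) (F : Sph n → ℂ) : Sph n → ℂ :=
  fun ζ => F (τ ζ) + (Real.log (jac τ ζ) : ℂ)

/-- The set `M` is invariant under the conformal action: for all `F ∈ M` and all conformal `τ` the
function `F^τ` is in `L²` and its class belongs to `M`. -/
def IsInvariant {n : ℕ} (M : Submodule ℝ (L2 n)) : Prop :=
  ∀ τ : Sph n → Sph n, IsConformal τ → ∀ F ∈ M,
    ∃ h : MemLp (confAct τ F) 2 (surf n), h.toLp (confAct τ F) ∈ M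

/-! ### The conditional intertwinor and the Beckner-Onofri functional -/

/-- The eigenvalue `λ_j(Q) = j (j+1) ⋯ (j+n)` of the conditional intertwinor `A'_Q` on `H_{j0}` and
on `H_{0j}`. -/
def eigenvalueQ (n j : ℕ) : ℝ := ∏ l ∈ Finset.range (n + 1), ((j : ℝ) + l)

/-- The quadratic form `∫ F A'_Q F dζ` of the conditional intertwinor, for `F` in the form domain
`W^{Q/2,2} ∩ RP`. (The term `j = 0` vanishes.) -/
def condForm {n : ℕ} (F : L2 n) : ℝ :=
  ∑' j : ℕ, eigenvalueQ n j * (compNorm j 0 F ^ 2 + compNorm 0 j F ^ 2)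

/-- The Beckner-Onofri functional
`J[F] = 1/(2 (n+1)!) ⨍ F A'_Q F + ⨍ F - log ⨍ e^F`
on real valued functions, where `⨍` is the average over the sphere. -/
def becknerOnofri {n : ℕ} (F : L2 n) : ℝ :=
  1 / (2 * ((n + 1).factorial : ℝ)) * (((surf n).real Set.univ)⁻¹ * condForm F)
    + (⨍ ζ, (F ζ).re ∂(surf n)) - Real.log (⨍ ζ, Real.exp (F ζ).re ∂(surf n))

end CRSphere

end

noncomputable section

namespace CRSphere

variable {n : ℕ}

/-! ### Polynomials in `ζ` and `ζ̄` -/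

/-! Everything rests on the kernels `normKer p`, that is -log|1 - ⟨p, ζ⟩| + ½ log(1 - |p|²) with p
in the open unit ball. For τ given by A ∈ SU(n+1,1), invariance of the Hermitian form on the vectors
(p, 1) (`IsLinFrac.den_mul`) yields log|J_τ| = 2(n+1) `normKer q₀`, where q₀ is the point of the
ball that A moves to the center (`logJacL2_eq`), and shows that the pullback of a kernel is a
difference of two kernels (`compL2_normKer`).

Minimality. An invariant subspace contains 0^τ = log|J_τ|, and by `exists_boost` q₀ can be any point
of the ball, so the subspace contains every kernel. The coefficients of `normKer (r • p)` as a power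
series in r remain in a closed subspace (`mem_of_hasSum_pow_smul`); they are Re⟨p, ζ⟩^k / k minus
constants. By the reproducing property the powers ⟨p, ·⟩^k span H_{k0}, so the subspace contains the
real parts of all elements of H_{k0} and H_{0k}, hence also their limits
(`sobolevRealPluriharmonic_le`, `realPluriharmonic_le`).

Invariance. The combinations of kernels are therefore dense, and it suffices to know what τ does to
kernels. In L² this is immediate, since F ↦ F ∘ τ is bounded. In the Sobolev space one uses the form
of A'_Q: its eigenvalues cancel the factorials of the reproducing constants, so its Gram matrix on
the kernels is a multiple of -log|1 - ⟨p, q⟩| (`inner_lamMap_normKer`), which pullback preserves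
(`inner_realLamMap_kerPull`). Density, lower semicontinuity and the inverse of τ make the form
invariant under F ↦ F ∘ τ (`norm_realLamMap_compSob`).

The functional. In the expansion of the form at F ∘ τ + log|J_τ| the cross term is given by
`meanL2_compSob` and the diagonal term by the Gram matrix; both cancel against the change of the
mean. The exponential mean is invariant by change of variables.

Exponential integrability. The components with |m| < 2^k add up pointwise to at most T + k, while
the squared L² norm of the rest is O(4^{-k}). Chebyshev's inequality and e < 4 conclude
(`integrable_exp`). -/

/-- The bidegree weights. -/
abbrev biWeight (n : ℕ) : Fin (n + 1) ⊕ Fin (n + 1) → ℕ × ℕ :=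
  Sum.elim (fun _ => ((1, 0) : ℕ × ℕ)) (fun _ => ((0, 1) : ℕ × ℕ))

/-- The coordinate polynomial `ζ_i`. -/
abbrev zX {n : ℕ} (i : Fin (n + 1)) : Poly n := MvPolynomial.X (Sum.inl i)

/-- The coordinate polynomial `ζ̄_i`. -/
abbrev zY {n : ℕ} (i : Fin (n + 1)) : Poly n := MvPolynomial.X (Sum.inr i)

/-- The derivative with respect to `ζ_i`. -/
abbrev dX {n : ℕ} (i : Fin (n + 1)) : Derivation ℂ (Poly n) (Poly n) :=
  MvPolynomial.pderiv (Sum.inl i)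

/-- The derivative with respect to `ζ̄_i`. -/
abbrev dY {n : ℕ} (i : Fin (n + 1)) : Derivation ℂ (Poly n) (Poly n) :=
  MvPolynomial.pderiv (Sum.inr i)

lemma mem_bihomogeneous {j k : ℕ} {p : Poly n} :
    p ∈ bihomogeneous n j k ↔ MvPolynomial.IsWeightedHomogeneous (biWeight n) p (j, k) := Iff.rfl

lemma weight_biWeight (d : Fin (n + 1) ⊕ Fin (n + 1) →₀ ℕ) :
    Finsupp.weight (biWeight n) d = (∑ i, d (Sum.inl i), ∑ i, d (Sum.inr i)) := by
  ext <;> simp [Finsupp.weight_apply, Finsupp.sum_fintype, Prod.fst_sum, Prod.snd_sum]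

lemma monomial_mem_bihomogeneous (d : Fin (n + 1) ⊕ Fin (n + 1) →₀ ℕ) (c : ℂ) :
    MvPolynomial.monomial d c ∈ bihomogeneous n (∑ i, d (Sum.inl i)) (∑ i, d (Sum.inr i)) :=
  MvPolynomial.isWeightedHomogeneous_monomial _ _ _ (weight_biWeight d)

lemma bihomogeneous_mul {j k j' k' : ℕ} {p q : Poly n} (hp : p ∈ bihomogeneous n j k)
    (hq : q ∈ bihomogeneous n j' k') : p * q ∈ bihomogeneous n (j + j') (k + k') :=
  MvPolynomial.IsWeightedHomogeneous.mul hp hq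

lemma zX_mem (i : Fin (n + 1)) : zX i ∈ bihomogeneous n 1 0 :=
  MvPolynomial.isWeightedHomogeneous_X ℂ (biWeight n) (Sum.inl i)

lemma zY_mem (i : Fin (n + 1)) : zY i ∈ bihomogeneous n 0 1 :=
  MvPolynomial.isWeightedHomogeneous_X ℂ (biWeight n) (Sum.inr i)

/-- Two linear maps that agree on the monomials of bidegree `(j, k)` agree on `bihomogeneous`. -/
lemma bihomogeneous_ext {V : Type*} [AddCommMonoid V] [Module ℂ V] {j k : ℕ}
    (f g : Poly n →ₗ[ℂ] V)
    (h : ∀ d : Fin (n + 1) ⊕ Fin (n + 1) →₀ ℕ, ∑ i, d (Sum.inl i) = j → ∑ i, d (Sum.inr i) = k →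
      f (MvPolynomial.monomial d 1) = g (MvPolynomial.monomial d 1))
    {p : Poly n} (hp : p ∈ bihomogeneous n j k) : f p = g p := by
  rw [p.as_sum, map_sum, map_sum]
  refine Finset.sum_congr rfl fun d hd => ?_
  have hw := hp (MvPolynomial.mem_support_iff.mp hd)
  rw [weight_biWeight] at hw
  have h1 : MvPolynomial.monomial d (p.coeff d) = p.coeff d • MvPolynomial.monomial d (1 : ℂ) := by
    rw [MvPolynomial.smul_monomial, smul_eq_mul, mul_one]
  rw [h1, map_smul, map_smul, h d (congrArg Prod.fst hw) (congrArg Prod.snd hw)]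

lemma dX_mem {j k : ℕ} {p : Poly n} (hp : p ∈ bihomogeneous n (j + 1) k) (i : Fin (n + 1)) :
    dX i p ∈ bihomogeneous n j k :=
  MvPolynomial.IsWeightedHomogeneous.pderiv (w := biWeight n) hp (by simp)

lemma dY_mem {j k : ℕ} {p : Poly n} (hp : p ∈ bihomogeneous n j (k + 1)) (i : Fin (n + 1)) :
    dY i p ∈ bihomogeneous n j k :=
  MvPolynomial.IsWeightedHomogeneous.pderiv (w := biWeight n) hp (by simp)

lemma dX_eq_zero {k : ℕ} {p : Poly n} (hp : p ∈ bihomogeneous n 0 k) (i : Fin (n + 1)) :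
    dX i p = 0 := by
  refine bihomogeneous_ext (dX i).toLinearMap 0 (fun d hd _ => ?_) hp
  have : d (Sum.inl i) = 0 := by
    simpa using (Finset.sum_eq_zero_iff.mp hd) i (Finset.mem_univ i)
  simp [MvPolynomial.pderiv_monomial, this]

lemma dY_eq_zero {j : ℕ} {p : Poly n} (hp : p ∈ bihomogeneous n j 0) (i : Fin (n + 1)) :
    dY i p = 0 := by
  refine bihomogeneous_ext (dY i).toLinearMap 0 (fun d _ hd => ?_) hp
  have : d (Sum.inr i) = 0 := by
    simpa using (Finset.sum_eq_zero_iff.mp hd) i (Finset.mem_univ i)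
  simp [MvPolynomial.pderiv_monomial, this]

/-- Euler's identity in ζ alone, for the weights that count only the ζ's. It drives the inductions
on the degree below. -/
lemma sum_zX_mul_dX {j k : ℕ} {p : Poly n} (hp : p ∈ bihomogeneous n j k) :
    ∑ i, zX i * dX i p = (j : ℂ) • p := by
  have h : MvPolynomial.IsWeightedHomogeneous
      (Sum.elim (fun _ => 1) (fun _ => 0) : Fin (n + 1) ⊕ Fin (n + 1) → ℕ) p j := by
    intro d hd
    have hw := hp hd
    rw [weight_biWeight] at hw
    have := congrArg Prod.fst hw
    simpa [Finsupp.weight_apply, Finsupp.sum_fintype] using this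
  have := h.sum_weight_X_mul_pderiv
  rw [Fintype.sum_sum_type] at this
  simpa [Nat.cast_smul_eq_nsmul] using this

lemma sum_zY_mul_dY {j k : ℕ} {p : Poly n} (hp : p ∈ bihomogeneous n j k) :
    ∑ i, zY i * dY i p = (k : ℂ) • p := by
  have h : MvPolynomial.IsWeightedHomogeneous
      (Sum.elim (fun _ => 0) (fun _ => 1) : Fin (n + 1) ⊕ Fin (n + 1) → ℕ) p k := by
    intro d hd
    have hw := hp hd
    rw [weight_biWeight] at hw
    have := congrArg Prod.snd hw
    simpa [Finsupp.weight_apply, Finsupp.sum_fintype] using this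
  have := h.sum_weight_X_mul_pderiv
  rw [Fintype.sum_sum_type] at this
  simpa [Nat.cast_smul_eq_nsmul] using this

lemma complexLaplacian_apply (p : Poly n) : complexLaplacian n p = ∑ i, dX i (dY i p) := by
  simp [complexLaplacian]

lemma complexLaplacian_mem {j k : ℕ} {p : Poly n} (hp : p ∈ bihomogeneous n (j + 1) (k + 1)) :
    complexLaplacian n p ∈ bihomogeneous n j k := by
  rw [complexLaplacian_apply]
  exact Submodule.sum_mem _ fun i _ => dX_mem (dY_mem hp i) i

lemma complexLaplacian_eq_zero {j k : ℕ} {p : Poly n} (hp : p ∈ bihomogeneous n j k)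
    (h : j = 0 ∨ k = 0) : complexLaplacian n p = 0 := by
  rw [complexLaplacian_apply]
  refine Finset.sum_eq_zero fun i _ => ?_
  rcases k with _ | k
  · rw [dY_eq_zero hp, map_zero]
  · obtain rfl : j = 0 := by simpa using h
    exact dX_eq_zero (dY_mem hp i) i

/-- The polynomial `|ζ|²`. -/
def normSqPoly (n : ℕ) : Poly n := ∑ i, zX i * zY i

lemma normSqPoly_mem : normSqPoly n ∈ bihomogeneous n 1 1 :=
  Submodule.sum_mem _ fun i _ => bihomogeneous_mul (zX_mem i) (zY_mem i)

lemma dY_normSqPoly (i : Fin (n + 1)) : dY i (normSqPoly n) = zX i := by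
  classical
  simp only [normSqPoly, map_sum, Derivation.leibniz, MvPolynomial.pderiv_X, smul_eq_mul]
  simp [Pi.single_apply]

lemma dX_normSqPoly (i : Fin (n + 1)) : dX i (normSqPoly n) = zY i := by
  classical
  simp only [normSqPoly, map_sum, Derivation.leibniz, MvPolynomial.pderiv_X, smul_eq_mul]
  simp [Pi.single_apply]

/-- By Leibniz and Euler, the commutator of the Laplacian with multiplication by |ζ|² is a positive
scalar on each bidegree. -/
lemma complexLaplacian_normSqPoly_mul {a b : ℕ} {q : Poly n} (hq : q ∈ bihomogeneous n a b) :
    complexLaplacian n (normSqPoly n * q) =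
      normSqPoly n * complexLaplacian n q + ((n + 1 + a + b : ℕ) : ℂ) • q := by
  have h : ∀ i, dX i (dY i (normSqPoly n * q)) =
      normSqPoly n * dX i (dY i q) + (q + zX i * dX i q + zY i * dY i q) := by
    intro i
    have e1 : dY i (normSqPoly n * q) = normSqPoly n * dY i q + q * zX i := by
      rw [Derivation.leibniz, dY_normSqPoly, smul_eq_mul, smul_eq_mul]
    have e2 : dX i (normSqPoly n * dY i q) = normSqPoly n * dX i (dY i q) + dY i q * zY i := by
      rw [Derivation.leibniz, dX_normSqPoly, smul_eq_mul, smul_eq_mul]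
    have e3 : dX i (q * zX i) = q + zX i * dX i q := by
      rw [Derivation.leibniz, smul_eq_mul, smul_eq_mul, MvPolynomial.pderiv_X_self, mul_one]
    rw [e1, map_add, e2, e3]; ring
  rw [complexLaplacian_apply, complexLaplacian_apply, Finset.sum_congr rfl fun i _ => h i,
    Finset.sum_add_distrib, Finset.sum_add_distrib, Finset.sum_add_distrib, ← Finset.mul_sum,
    sum_zX_mul_dX hq, sum_zY_mul_dY hq]
  simp only [Finset.sum_const, Finset.card_univ, Fintype.card_fin]
  rw [← Nat.cast_smul_eq_nsmul ℂ]
  push_cast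
  module

/-- Only s = 0 is wanted: it says that q ↦ Δ(|ζ|² q) is injective. The parameter s makes the
induction close: the hypothesis gives |ζ|² Δq = -(n+1+a+b+s) q, and applying Δ yields the same kind
of equation for Δq in bidegree (a-1, b-1), with a larger s. All constants are positive, so nothing
cancels. -/
lemma eq_zero_of_complexLaplacian_normSqPoly_mul {a b : ℕ} (s : ℕ) {q : Poly n}
    (hq : q ∈ bihomogeneous n a b)
    (h : complexLaplacian n (normSqPoly n * q) = -((s : ℂ) • q)) : q = 0 := by
  induction a generalizing b s q with
  | zero =>
    rw [complexLaplacian_normSqPoly_mul hq, complexLaplacian_eq_zero hq (Or.inl rfl)] at h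
    have h2 : (((n + 1 + 0 + b + s : ℕ)) : ℂ) • q = 0 := by
      have e : (((n + 1 + 0 + b + s : ℕ)) : ℂ) • q
          = ((n + 1 + 0 + b : ℕ) : ℂ) • q + (s : ℂ) • q := by push_cast; module
      rw [mul_zero, zero_add] at h
      rw [e, h, neg_add_cancel]
    exact (smul_eq_zero.mp h2).resolve_left (Nat.cast_ne_zero.mpr (by omega))
  | succ a ih =>
    have h' := h
    rw [complexLaplacian_normSqPoly_mul hq] at h'
    have h2 : normSqPoly n * complexLaplacian n q
        = -(((n + 1 + (a + 1) + b + s : ℕ) : ℂ) • q) := by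
      have e : ((n + 1 + (a + 1) + b + s : ℕ) : ℂ) • q
          = ((n + 1 + (a + 1) + b : ℕ) : ℂ) • q + (s : ℂ) • q := by push_cast; module
      rw [e, ← sub_eq_zero, sub_neg_eq_add, ← add_assoc, h', neg_add_cancel]
    have h3 : complexLaplacian n q = 0 := by
      rcases b with _ | b
      · exact complexLaplacian_eq_zero hq (Or.inr rfl)
      · refine ih (n + 1 + (a + 1) + (b + 1) + s) (complexLaplacian_mem hq) ?_
        rw [h2, map_neg, map_smul]
    rw [h3, mul_zero] at h2
    exact (smul_eq_zero.mp (neg_eq_zero.mp h2.symm)).resolve_left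
      (Nat.cast_ne_zero.mpr (by omega))

instance instFiniteDimensionalBihomogeneous (n j k : ℕ) :
    FiniteDimensional ℂ (bihomogeneous n j k) :=
  Submodule.finiteDimensional_of_le (bihomogeneous_le n j k)

/-- The Fischer decomposition: `p = h + |ζ|² q` with `h` harmonic. -/
lemma exists_harmonic_add {a b : ℕ} {p : Poly n} (hp : p ∈ bihomogeneous n (a + 1) (b + 1)) :
    ∃ q ∈ bihomogeneous n a b,
      p - normSqPoly n * q ∈ bihomogeneous n (a + 1) (b + 1) ⊓
        LinearMap.ker (complexLaplacian n) := by
  have hR : ∀ q ∈ bihomogeneous n a b, normSqPoly n * q ∈ bihomogeneous n (a + 1) (b + 1) := by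
    intro q hq
    have := bihomogeneous_mul normSqPoly_mem hq
    rwa [add_comm 1 a, add_comm 1 b] at this
  -- An injective endomorphism of a finite-dimensional space is onto, so Δ(|ζ|² q) = Δp has a
  -- solution q.
  let T : bihomogeneous n a b →ₗ[ℂ] bihomogeneous n a b :=
    LinearMap.restrict (complexLaplacian n ∘ₗ LinearMap.mulLeft ℂ (normSqPoly n))
      (fun q hq => complexLaplacian_mem (hR q hq))
  have hinj : Function.Injective T := by
    rw [injective_iff_map_eq_zero]
    intro q hq
    have h := congrArg Subtype.val hq
    have : (q : Poly n) = 0 := eq_zero_of_complexLaplacian_normSqPoly_mul 0 q.2 (by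
      simpa [T] using h)
    exact Subtype.ext this
  obtain ⟨q, hq⟩ := (LinearMap.injective_iff_surjective.mp hinj)
    ⟨complexLaplacian n p, complexLaplacian_mem hp⟩
  refine ⟨q, q.2, sub_mem hp (hR q q.2), ?_⟩
  have h := congrArg Subtype.val hq
  change complexLaplacian n _ = 0
  rw [map_sub, sub_eq_zero]
  simpa [T] using h.symm

/-! ### Conjugation of polynomials -/

/-- Complex conjugation on polynomials in `ζ` and `ζ̄`. -/
def conjPoly (n : ℕ) : Poly n →+* Poly n :=
  (MvPolynomial.rename (R := ℂ) (Sum.swap : Fin (n + 1) ⊕ Fin (n + 1) → _)).toRingHom.comp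
    (MvPolynomial.map (starRingEnd ℂ))

lemma conjPoly_monomial (d : Fin (n + 1) ⊕ Fin (n + 1) →₀ ℕ) (c : ℂ) :
    conjPoly n (MvPolynomial.monomial d c) =
      MvPolynomial.monomial (d.mapDomain Sum.swap) (starRingEnd ℂ c) := by
  simp [conjPoly, MvPolynomial.rename_monomial]

lemma conjPoly_C (c : ℂ) : conjPoly n (MvPolynomial.C c) = MvPolynomial.C (starRingEnd ℂ c) := by
  simp [conjPoly]

lemma conjPoly_smul (c : ℂ) (p : Poly n) : conjPoly n (c • p) = starRingEnd ℂ c • conjPoly n p := by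
  rw [MvPolynomial.smul_eq_C_mul, MvPolynomial.smul_eq_C_mul, map_mul, conjPoly_C]

lemma conjPoly_X (s : Fin (n + 1) ⊕ Fin (n + 1)) :
    conjPoly n (MvPolynomial.X s) = MvPolynomial.X s.swap := by
  simp [conjPoly]

lemma conjPoly_mem {j k : ℕ} {p : Poly n} (hp : p ∈ bihomogeneous n j k) :
    conjPoly n p ∈ bihomogeneous n k j := by
  rw [p.as_sum, map_sum]
  refine Submodule.sum_mem _ fun d hd => ?_
  have hw := hp (MvPolynomial.mem_support_iff.mp hd)
  rw [weight_biWeight] at hw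
  have h1 := congrArg Prod.fst hw
  have h2 := congrArg Prod.snd hw
  simp only at h1 h2
  rw [conjPoly_monomial]
  have e : ∀ s, (d.mapDomain Sum.swap) s = d s.swap := by
    intro s
    conv_lhs => rw [← Sum.swap_swap s]
    exact Finsupp.mapDomain_apply (Sum.swap_leftInverse.injective) d _
  have := monomial_mem_bihomogeneous (d.mapDomain Sum.swap) (starRingEnd ℂ (p.coeff d))
  simpa only [e, Sum.swap_inl, Sum.swap_inr, h1, h2] using this

lemma pderiv_conjPoly (s : Fin (n + 1) ⊕ Fin (n + 1)) (p : Poly n) :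
    MvPolynomial.pderiv s (conjPoly n p) = conjPoly n (MvPolynomial.pderiv s.swap p) := by
  classical
  induction p using MvPolynomial.induction_on with
  | C a => simp [conjPoly_C]
  | add p q hp hq => rw [map_add, map_add, map_add, map_add, hp, hq]
  | mul_X p i hp =>
    rw [map_mul, Derivation.leibniz, Derivation.leibniz, hp, conjPoly_X]
    simp only [smul_eq_mul, map_add, map_mul, conjPoly_X, MvPolynomial.pderiv_X]
    congr 2
    have : (i.swap = s) ↔ (i = s.swap) := by
      constructor
      · rintro rfl; simp
      · rintro rfl; simp
    by_cases h : i = s.swap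
    · simp [h]
    · have h' : i.swap ≠ s := fun h2 => h (this.mp h2)
      rw [Pi.single_eq_of_ne' (Ne.symm h'), Pi.single_eq_of_ne' (Ne.symm h), map_zero]

/-- The commutator of two derivations is a derivation, so it is enough that it kills the variables.
-/
lemma pderiv_comm (s t : Fin (n + 1) ⊕ Fin (n + 1)) (p : Poly n) :
    MvPolynomial.pderiv s (MvPolynomial.pderiv t p) =
      MvPolynomial.pderiv t (MvPolynomial.pderiv s p) := by
  classical
  have h : ⁅(MvPolynomial.pderiv s : Derivation ℂ (Poly n) (Poly n)),
      (MvPolynomial.pderiv t : Derivation ℂ (Poly n) (Poly n))⁆ = 0 := by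
    refine MvPolynomial.derivation_ext fun i => ?_
    rw [Derivation.commutator_apply]
    simp [MvPolynomial.pderiv_X, Pi.single_apply, apply_ite]
  have := congrArg (fun D : Derivation ℂ (Poly n) (Poly n) => D p) h
  simpa [Derivation.commutator_apply, sub_eq_zero] using this

lemma complexLaplacian_conjPoly (p : Poly n) :
    complexLaplacian n (conjPoly n p) = conjPoly n (complexLaplacian n p) := by
  rw [complexLaplacian_apply, complexLaplacian_apply, map_sum]
  refine Finset.sum_congr rfl fun i _ => ?_
  rw [dX, dY, pderiv_conjPoly, pderiv_conjPoly]
  simp only [Sum.swap_inl, Sum.swap_inr]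
  rw [pderiv_comm]

/-! ### Gaussian integrals and integrals of monomials over the sphere -/

lemma finrank_CSpace : Module.finrank ℝ (CSpace n) = 2 * n + 2 := by
  rw [← Module.finrank_mul_finrank ℝ ℂ (CSpace n), Complex.finrank_real_complex,
    finrank_euclideanSpace, Fintype.card_fin]
  ring

lemma integral_volumeIoiPow (m : ℕ) (φ : ℝ → ℂ) :
    ∫ r : Set.Ioi (0 : ℝ), φ r ∂(Measure.volumeIoiPow m) =
      ∫ r in Set.Ioi (0 : ℝ), ((r ^ m : ℝ) : ℂ) * φ r := by
  simp only [Measure.volumeIoiPow, ENNReal.ofReal]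
  rw [integral_withDensity_eq_integral_smul,
    integral_subtype_comap measurableSet_Ioi fun a ↦ Real.toNNReal (a ^ m) • φ a,
    setIntegral_congr_fun measurableSet_Ioi fun x hx ↦ ?_]
  · simp only [NNReal.smul_def]
    rw [Real.coe_toNNReal _ (pow_nonneg (le_of_lt hx) _), Complex.real_smul]
  · exact (measurable_subtype_coe.pow_const _).real_toNNReal

/-- Integration in polar coordinates of a product of an angular and a radial function. -/
lemma integral_polar (f : CSpace n → ℂ) (g : Sph n → ℂ) (φ : ℝ → ℂ)
    (h : ∀ (r : ℝ), 0 < r → ∀ ζ : Sph n, f (r • (ζ : CSpace n)) = g ζ * φ r) :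
    ∫ x, f x = (∫ ζ, g ζ ∂(surf n)) *
      ∫ r in Set.Ioi (0 : ℝ), ((r ^ (2 * n + 1) : ℝ) : ℂ) * φ r := by
  have hd : Module.finrank ℝ (CSpace n) - 1 = 2 * n + 1 := by rw [finrank_CSpace]; omega
  calc ∫ x, f x = ∫ x : ({(0)}ᶜ : Set (CSpace n)), f x
          ∂((volume : Measure (CSpace n)).comap Subtype.val) := by
        rw [integral_subtype_comap (measurableSet_singleton _).compl f, restrict_compl_singleton]
    _ = ∫ x : Sph n × Set.Ioi (0 : ℝ), g x.1 * φ x.2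
          ∂((volume : Measure (CSpace n)).toSphere.prod
            (.volumeIoiPow (Module.finrank ℝ (CSpace n) - 1))) := by
        rw [← (volume : Measure (CSpace n)).measurePreserving_homeomorphUnitSphereProd.integral_comp
          (Homeomorph.measurableEmbedding _)]
        refine integral_congr_ae (Filter.Eventually.of_forall fun x => ?_)
        have hx : (x : CSpace n) ≠ 0 := x.2
        have hx' : 0 < ‖(x : CSpace n)‖ := norm_pos_iff.mpr hx
        simp only
        rw [homeomorphUnitSphereProd_apply_snd_coe, ← h _ hx', homeomorphUnitSphereProd_apply_fst_coe,
          smul_smul, mul_inv_cancel₀ hx'.ne', one_smul]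
    _ = _ := by
        rw [hd, integral_prod_mul (μ := (volume : Measure (CSpace n)).toSphere)
          (ν := .volumeIoiPow (2 * n + 1)) g (fun r : Set.Ioi (0 : ℝ) => φ r),
          integral_volumeIoiPow]
        rfl

/-- The volume of `ℂ^{n+1}` is a multiple of the product measure. -/
lemma exists_volume_eq_smul (n : ℕ) : ∃ c : NNReal, c ≠ 0 ∧
    (volume : Measure (CSpace n)) =
      c • Measure.map (EuclideanSpace.equiv (Fin (n + 1)) ℂ).symm
        (Measure.pi fun _ : Fin (n + 1) => (volume : Measure ℂ)) := by
  have : (Measure.pi fun _ : Fin (n + 1) => (volume : Measure ℂ)).IsAddHaarMeasure := inferInstance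
  have h1 : (Measure.map (EuclideanSpace.equiv (Fin (n + 1)) ℂ).symm
        (Measure.pi fun _ : Fin (n + 1) => (volume : Measure ℂ))).IsAddHaarMeasure :=
    ContinuousLinearEquiv.isAddHaarMeasure_map _ _
  refine ⟨_, (Measure.addHaarScalarFactor_pos_of_isAddHaarMeasure _ _).ne',
    Measure.isAddLeftInvariant_eq_smul _ _⟩

/-- The constant comes from uniqueness of Haar measure. Its value is never needed, because later
formulas are normalized by the total mass of the sphere. -/
lemma integral_volume_prod : ∃ c : ℝ, 0 < c ∧ ∀ f : Fin (n + 1) → ℂ → ℂ,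
    ∫ x : CSpace n, ∏ i, f i (x i) = c * ∏ i, ∫ z, f i z := by
  obtain ⟨c, hc, h⟩ := exists_volume_eq_smul n
  refine ⟨c, by positivity, fun f => ?_⟩
  have me : MeasurableEmbedding (EuclideanSpace.equiv (Fin (n + 1)) ℂ).symm :=
    (EuclideanSpace.equiv (Fin (n + 1)) ℂ).symm.toHomeomorph.measurableEmbedding
  rw [h, integral_smul_nnreal_measure, me.integral_map, ← integral_fintype_prod_eq_prod]
  rfl

lemma integral_gaussian_mul_conj (a b : ℕ) :
    ∫ z : ℂ, z ^ a * (starRingEnd ℂ z) ^ b * (Real.exp (-‖z‖ ^ 2) : ℂ) =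
      if a = b then (Real.pi * a.factorial : ℂ) else 0 := by
  split_ifs with hab
  · subst hab
    have h := Complex.integral_rpow_mul_exp_neg_rpow (p := 2) (q := 2 * a) (by norm_num)
      (by have : (0 : ℝ) ≤ 2 * a := by positivity
          linarith)
    have e : ∀ z : ℂ, z ^ a * (starRingEnd ℂ z) ^ a * (Real.exp (-‖z‖ ^ 2) : ℂ) =
        ((‖z‖ ^ (2 * a : ℝ) * Real.exp (-‖z‖ ^ (2 : ℝ)) : ℝ) : ℂ) := by
      intro z
      rw [← mul_pow, Complex.mul_conj, Complex.normSq_eq_norm_sq]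
      rw [show (2 * a : ℝ) = ((2 * a : ℕ) : ℝ) by push_cast; ring, Real.rpow_natCast,
        show (2 : ℝ) = ((2 : ℕ) : ℝ) by norm_num, Real.rpow_natCast, pow_mul]
      push_cast
      ring
    simp_rw [e]
    rw [integral_complex_ofReal, h, show ((2 : ℝ) * a + 2) / 2 = a + 1 by ring,
      Real.Gamma_nat_eq_factorial]
    push_cast; ring
  · set I := ∫ z : ℂ, z ^ a * (starRingEnd ℂ z) ^ b * (Real.exp (-‖z‖ ^ 2) : ℂ) with hI
    have key : ∀ u : Circle, I = (u : ℂ) ^ a * (starRingEnd ℂ u) ^ b * I := by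
      intro u
      conv_lhs => rw [hI, ← (rotation u).measurePreserving.integral_comp
        (rotation u).toHomeomorph.measurableEmbedding]
      rw [hI, ← integral_const_mul]
      refine integral_congr_ae (Filter.Eventually.of_forall fun z => ?_)
      simp only [rotation_apply, map_mul, mul_pow, norm_mul, Circle.norm_coe, one_mul]
      ring
    -- Rotation by one radian serves all exponents at once: e^{i(a-b)} = 1 with a ≠ b would make π
    -- rational.
    have h1 := key (Circle.exp 1)
    have h2 : ((Circle.exp 1 : Circle) : ℂ) ^ a *
        (starRingEnd ℂ (Circle.exp 1 : Circle)) ^ b ≠ 1 := by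
      rw [Circle.coe_exp, ← Complex.exp_conj, ← Complex.exp_nat_mul, ← Complex.exp_nat_mul,
        ← Complex.exp_add, Ne, Complex.exp_eq_one_iff]
      rintro ⟨k, hk⟩
      simp only [Complex.ofReal_one, one_mul, Complex.conj_I] at hk
      have h3 : ((a : ℝ) - b) = k * (2 * Real.pi) := by
        have := congrArg Complex.im hk
        simpa [sub_eq_add_neg] using this
      by_cases hk0 : k = 0
      · rw [hk0] at h3
        simp only [Int.cast_zero, zero_mul, sub_eq_zero, Nat.cast_inj] at h3
        exact hab h3
      · refine irrational_pi.ne_rat (((a : ℚ) - b) / (2 * k)) ?_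
        have : (k : ℝ) ≠ 0 := by exact_mod_cast hk0
        push_cast
        rw [h3]; field_simp
    have h4 : (1 - ((Circle.exp 1 : Circle) : ℂ) ^ a *
        (starRingEnd ℂ (Circle.exp 1 : Circle)) ^ b) * I = 0 := by
      rw [sub_mul, one_mul, ← h1, sub_self]
    exact (mul_eq_zero.mp h4).resolve_left (sub_ne_zero.mpr h2.symm)

lemma integral_radial_gaussian (n m : ℕ) :
    ∫ r in Set.Ioi (0 : ℝ), ((r ^ (2 * n + 1) : ℝ) : ℂ) *
      ((r ^ m * Real.exp (-r ^ 2) : ℝ) : ℂ) = ((1 / 2 * Real.Gamma ((2 * n + 2 + m : ℝ) / 2) : ℝ) : ℂ) := by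
  have h := integral_rpow_mul_exp_neg_rpow (p := 2) (q := (2 * n + 1 + m : ℕ)) (by norm_num)
    (by have : (0 : ℝ) ≤ (2 * n + 1 + m : ℕ) := by positivity
        linarith)
  rw [show (2 * n + 2 + m : ℝ) / 2 = ((2 * n + 1 + m : ℕ) + 1) / 2 by push_cast; ring, ← h,
    ← integral_complex_ofReal]
  refine setIntegral_congr_fun measurableSet_Ioi fun r _ => ?_
  rw [← Complex.ofReal_mul, Real.rpow_natCast, Real.rpow_ofNat, pow_add]
  congr 1
  ring

/-- The integral over the sphere, on polynomials. -/
def sphInt (n : ℕ) : Poly n →ₗ[ℂ] ℂ where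
  toFun p := ∫ ζ, restrictSph n p ζ ∂(surf n)
  map_add' p q := by
    simp only [map_add, ContinuousMap.add_apply]
    exact integral_add ((restrictSph n p).continuous.integrable_of_hasCompactSupport
      (HasCompactSupport.of_compactSpace _)) ((restrictSph n q).continuous.integrable_of_hasCompactSupport
      (HasCompactSupport.of_compactSpace _))
  map_smul' c p := by
    simp only [map_smul, ContinuousMap.smul_apply, RingHom.id_apply]
    exact integral_smul _ _

lemma sphInt_apply (p : Poly n) : sphInt n p = ∫ ζ, restrictSph n p ζ ∂(surf n) := rfl

lemma restrictSph_zX (i : Fin (n + 1)) (ζ : Sph n) :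
    restrictSph n (zX i) ζ = (ζ : CSpace n) i := by
  simp [restrictSph, zX]

lemma restrictSph_zY (i : Fin (n + 1)) (ζ : Sph n) :
    restrictSph n (zY i) ζ = (starRingEnd ℂ) ((ζ : CSpace n) i) := by
  simp [restrictSph, zY]

lemma restrictSph_monomial (d : Fin (n + 1) ⊕ Fin (n + 1) →₀ ℕ) (ζ : Sph n) :
    restrictSph n (MvPolynomial.monomial d 1) ζ =
      ∏ i, ((ζ : CSpace n) i ^ d (Sum.inl i) * (starRingEnd ℂ ((ζ : CSpace n) i)) ^ d (Sum.inr i)) := by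
  simp [restrictSph, MvPolynomial.aeval_monomial, Finsupp.prod_fintype, Fintype.prod_sum_type,
    Finset.prod_mul_distrib]

/-- Integrals of monomials over the sphere. -/
lemma exists_sphInt_monomial (n : ℕ) : ∃ c : ℝ, 0 < c ∧
    ∀ d : Fin (n + 1) ⊕ Fin (n + 1) →₀ ℕ, sphInt n (MvPolynomial.monomial d 1) =
      if ∀ i, d (Sum.inl i) = d (Sum.inr i) then
        (((c * ((∏ i, (d (Sum.inl i)).factorial : ℕ) : ℝ) /
          ((n + ∑ i, d (Sum.inl i)).factorial : ℝ)) : ℝ) : ℂ)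
      else 0 := by
  obtain ⟨c, hc, h⟩ := integral_volume_prod (n := n)
  -- A Gaussian integral is computed twice, by Fubini and in polar coordinates. Each plane
  -- contributes a factor π, and the 2 inverts the ½ in front of the radial Gamma integral.
  refine ⟨2 * c * Real.pi ^ (n + 1), by positivity, fun d => ?_⟩
  have h1 := h (fun i z => z ^ d (Sum.inl i) * (starRingEnd ℂ z) ^ d (Sum.inr i) *
    (Real.exp (-‖z‖ ^ 2) : ℂ))
  simp_rw [integral_gaussian_mul_conj] at h1
  have h2 := integral_polar (n := n) (fun x => ∏ i, (x i ^ d (Sum.inl i) *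
      (starRingEnd ℂ (x i)) ^ d (Sum.inr i) * (Real.exp (-‖x i‖ ^ 2) : ℂ)))
    (restrictSph n (MvPolynomial.monomial d 1))
    (fun r => ((r ^ (∑ i, d (Sum.inl i) + ∑ i, d (Sum.inr i)) * Real.exp (-r ^ 2) : ℝ) : ℂ)) (by
      intro r hr ζ
      have hs : ∑ i, ‖(ζ : CSpace n) i‖ ^ 2 = 1 := by
        rw [← EuclideanSpace.norm_sq_eq, norm_eq_of_mem_sphere, one_pow]
      have he : ∏ i, (Real.exp (-‖(r • (ζ : CSpace n)) i‖ ^ 2) : ℂ) = (Real.exp (-r ^ 2) : ℝ) := by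
        rw [← Complex.ofReal_prod, ← Real.exp_sum]
        congr 2
        simp only [PiLp.smul_apply, norm_smul, mul_pow, Finset.sum_neg_distrib, ← Finset.mul_sum, hs,
          Real.norm_eq_abs, sq_abs, mul_one]
      rw [Finset.prod_mul_distrib, he, restrictSph_monomial, Complex.ofReal_mul, ← mul_assoc]
      congr 1
      simp only [PiLp.smul_apply, Complex.real_smul, map_mul, Complex.conj_ofReal, mul_pow]
      rw [Complex.ofReal_pow, pow_add, ← Finset.prod_pow_eq_pow_sum, ← Finset.prod_pow_eq_pow_sum,
        ← Finset.prod_mul_distrib, ← Finset.prod_mul_distrib]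
      exact Finset.prod_congr rfl fun i _ => by ring)
  rw [h1, integral_radial_gaussian] at h2
  change _ = sphInt n (MvPolynomial.monomial d 1) * _ at h2
  split_ifs with hd
  · have hd' : ∑ i, d (Sum.inr i) = ∑ i, d (Sum.inl i) :=
      Finset.sum_congr rfl fun i _ => (hd i).symm
    rw [hd', Finset.prod_congr rfl fun i _ => if_pos (hd i), Finset.prod_mul_distrib,
      Finset.prod_const, Finset.card_univ, Fintype.card_fin,
      show ((2 * n + 2 + (∑ i, d (Sum.inl i) + ∑ i, d (Sum.inl i) : ℕ) : ℝ) / 2) =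
        ((n + ∑ i, d (Sum.inl i) : ℕ) : ℝ) + 1 by push_cast; ring, Real.Gamma_nat_eq_factorial] at h2
    have hf : (((n + ∑ i, d (Sum.inl i)).factorial : ℕ) : ℂ) ≠ 0 :=
      Nat.cast_ne_zero.mpr (Nat.factorial_ne_zero _)
    push_cast at h2 ⊢
    field_simp
    linear_combination -2 * h2
  · have h0 : ∏ i, (if d (Sum.inl i) = d (Sum.inr i) then
        (Real.pi * (d (Sum.inl i)).factorial : ℂ) else 0) = 0 := by
      push Not at hd
      obtain ⟨i, hi⟩ := hd
      exact Finset.prod_eq_zero (Finset.mem_univ i) (if_neg hi)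
    rw [h0, mul_zero, eq_comm, mul_eq_zero] at h2
    refine h2.resolve_right ?_
    have : 0 < Real.Gamma ((2 * n + 2 + (∑ i, d (Sum.inl i) + ∑ i, d (Sum.inr i) : ℕ) : ℝ) / 2) :=
      Real.Gamma_pos_of_pos (by positivity)
    exact Complex.ofReal_ne_zero.mpr (mul_pos one_half_pos this).ne'

lemma sphInt_eq_zero_of_ne {j k : ℕ} (hjk : j ≠ k) {p : Poly n} (hp : p ∈ bihomogeneous n j k) :
    sphInt n p = 0 := by
  obtain ⟨c, -, h⟩ := exists_sphInt_monomial n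
  refine bihomogeneous_ext (sphInt n) 0 (fun d h1 h2 => ?_) hp
  rw [h d, if_neg, LinearMap.zero_apply]
  intro hd
  exact hjk (by rw [← h1, ← h2]; exact Finset.sum_congr rfl fun i _ => hd i)

/-- Compare the explicit integrals: the factor n + k + 1 is the ratio of (n+k+1)! to (n+k)!. A
vanishing exponent of ζ_i is treated apart, because the exponent is lowered by truncated
subtraction. -/
lemma sphInt_dX_monomial {k : ℕ} (i : Fin (n + 1)) (d : Fin (n + 1) ⊕ Fin (n + 1) →₀ ℕ)
    (h1 : ∑ i, d (Sum.inl i) = k + 1) (h2 : ∑ i, d (Sum.inr i) = k) :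
    sphInt n (dX i (MvPolynomial.monomial d (1 : ℂ))) =
      ((n + k + 1 : ℕ) : ℂ) * sphInt n (zY i * MvPolynomial.monomial d 1) := by
  obtain ⟨c, -, h⟩ := exists_sphInt_monomial n
  have e1 : dX i (MvPolynomial.monomial d (1 : ℂ)) =
      (d (Sum.inl i) : ℂ) • MvPolynomial.monomial (d - Finsupp.single (Sum.inl i) 1) 1 := by
    rw [MvPolynomial.pderiv_monomial, MvPolynomial.smul_monomial, one_mul, smul_eq_mul, mul_one]
  have e2 : zY i * MvPolynomial.monomial d (1 : ℂ) =
      MvPolynomial.monomial (Finsupp.single (Sum.inr i) 1 + d) 1 := by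
    rw [zY, MvPolynomial.X, MvPolynomial.monomial_mul, one_mul]
  rw [e1, e2, map_smul, h, h, smul_eq_mul]
  have f1 : ∀ l, (d - Finsupp.single (Sum.inl i) 1 : _ →₀ ℕ) (Sum.inl l) =
      if l = i then d (Sum.inl l) - 1 else d (Sum.inl l) := by
    intro l
    rw [Finsupp.tsub_apply, Finsupp.single_apply]
    by_cases hl : l = i
    · simp [hl]
    · simp [hl, Ne.symm hl]
  have f2 : ∀ l, (d - Finsupp.single (Sum.inl i) 1 : _ →₀ ℕ) (Sum.inr l) = d (Sum.inr l) := by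
    intro l; simp [Finsupp.tsub_apply]
  have f3 : ∀ l, (Finsupp.single (Sum.inr i) 1 + d : _ →₀ ℕ) (Sum.inl l) = d (Sum.inl l) := by
    intro l; simp
  have f4 : ∀ l, (Finsupp.single (Sum.inr i) 1 + d : _ →₀ ℕ) (Sum.inr l) =
      if l = i then d (Sum.inr l) + 1 else d (Sum.inr l) := by
    intro l
    rw [Finsupp.add_apply, Finsupp.single_apply]
    by_cases hl : l = i
    · simp [hl, add_comm]
    · simp [hl, Ne.symm hl]
  simp only [f1, f2, f3, f4]
  by_cases h0 : d (Sum.inl i) = 0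
  · rw [h0, Nat.cast_zero, zero_mul, if_neg, mul_zero]
    intro hd
    have := hd i
    rw [if_pos rfl, h0] at this
    omega
  · have hiff : (∀ l, (if l = i then d (Sum.inl l) - 1 else d (Sum.inl l)) = d (Sum.inr l)) ↔
        ∀ l, d (Sum.inl l) = if l = i then d (Sum.inr l) + 1 else d (Sum.inr l) := by
      refine forall_congr' fun l => ?_
      split_ifs with hl
      · subst hl; omega
      · rfl
    by_cases hd : ∀ l, (if l = i then d (Sum.inl l) - 1 else d (Sum.inl l)) = d (Sum.inr l)
    · rw [if_pos hd, if_pos (hiff.mp hd)]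
      have s1 : ∑ l, (if l = i then d (Sum.inl l) - 1 else d (Sum.inl l)) = k := by
        rw [← h2]; exact Finset.sum_congr rfl fun l _ => hd l
      have p1 : d (Sum.inl i) * ∏ l, (if l = i then d (Sum.inl l) - 1 else d (Sum.inl l)).factorial =
          ∏ l, (d (Sum.inl l)).factorial := by
        rw [← Finset.mul_prod_erase _ _ (Finset.mem_univ i),
          ← Finset.mul_prod_erase Finset.univ (fun l => (d (Sum.inl l)).factorial) (Finset.mem_univ i),
          if_pos rfl, ← mul_assoc, Nat.mul_factorial_pred h0]
        congr 1
        exact Finset.prod_congr rfl fun l hl => by rw [if_neg (Finset.ne_of_mem_erase hl)]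
      rw [s1, h1, ← p1, show n + (k + 1) = (n + k) + 1 by ring, Nat.factorial_succ]
      have hf : (((n + k).factorial : ℕ) : ℂ) ≠ 0 := Nat.cast_ne_zero.mpr (Nat.factorial_ne_zero _)
      have hf' : ((n + k + 1 : ℕ) : ℂ) ≠ 0 := Nat.cast_ne_zero.mpr (Nat.succ_ne_zero _)
      push_cast at hf' ⊢
      field_simp
    · rw [if_neg hd, if_neg (fun h' => hd (hiff.mpr h')), mul_zero, mul_zero]

/-- Integration by parts on the sphere. -/
lemma sphInt_dX {k : ℕ} {p : Poly n} (hp : p ∈ bihomogeneous n (k + 1) k) (i : Fin (n + 1)) :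
    sphInt n (dX i p) = ((n + k + 1 : ℕ) : ℂ) * sphInt n (zY i * p) :=
  bihomogeneous_ext (sphInt n ∘ₗ (dX i).toLinearMap)
    (((n + k + 1 : ℕ) : ℂ) • (sphInt n ∘ₗ LinearMap.mulLeft ℂ (zY i)))
    (fun d h1 h2 => sphInt_dX_monomial i d h1 h2) hp

/-! ### Polynomials in `L²` -/

/-- The class in `L²` of a continuous function. -/
def contL2 (n : ℕ) : C(Sph n, ℂ) →L[ℂ] L2 n := ContinuousMap.toLp (E := ℂ) 2 (surf n) ℂ

lemma coeFn_contL2 (f : C(Sph n, ℂ)) : contL2 n f =ᵐ[surf n] f := ContinuousMap.coeFn_toLp _ f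

lemma inner_contL2 (f g : C(Sph n, ℂ)) :
    inner ℂ (contL2 n f) (contL2 n g) = ∫ ζ, g ζ * starRingEnd ℂ (f ζ) ∂(surf n) :=
  ContinuousMap.inner_toLp _ f g

/-- The class in `L²` of the restriction of a polynomial to the sphere. -/
def toL2 (n : ℕ) : Poly n →ₗ[ℂ] L2 n := (contL2 n).toLinearMap ∘ₗ (restrictSph n).toLinearMap

lemma toL2_apply (p : Poly n) : toL2 n p = contL2 n (restrictSph n p) := rfl

lemma restrictSph_conjPoly (p : Poly n) (ζ : Sph n) :
    restrictSph n (conjPoly n p) ζ = starRingEnd ℂ (restrictSph n p ζ) := by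
  induction p using MvPolynomial.induction_on with
  | C a =>
    rw [conjPoly_C, ← MvPolynomial.algebraMap_eq, AlgHom.commutes, AlgHom.commutes]
    simp
  | add p q hp hq => simp only [map_add, ContinuousMap.add_apply, hp, hq]
  | mul_X p i hp =>
    simp only [map_mul, ContinuousMap.mul_apply, hp, conjPoly_X]
    congr 1
    rcases i with i | i
    · exact (restrictSph_zY i ζ).trans (congrArg _ (restrictSph_zX i ζ).symm)
    · refine (restrictSph_zX i ζ).trans ?_
      erw [restrictSph_zY i ζ]
      rw [Complex.conj_conj]

lemma inner_toL2 (p q : Poly n) :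
    inner ℂ (toL2 n p) (toL2 n q) = sphInt n (conjPoly n p * q) := by
  rw [toL2_apply, toL2_apply, inner_contL2, sphInt_apply]
  refine integral_congr_ae (Filter.Eventually.of_forall fun ζ => ?_)
  simp only [map_mul, ContinuousMap.mul_apply, restrictSph_conjPoly]
  ring

lemma mem_harm {j k : ℕ} {F : L2 n} :
    F ∈ harm n j k ↔ ∃ p ∈ bihomogeneous n j k, complexLaplacian n p = 0 ∧ toL2 n p = F := by
  unfold harm
  rw [Submodule.mem_map]
  constructor
  · rintro ⟨p, hp, h⟩
    exact ⟨p, hp.1, hp.2, h⟩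
  · rintro ⟨p, hp, hp', h⟩
    exact ⟨p, ⟨hp, hp'⟩, h⟩

lemma toL2_mem_harm_left {j : ℕ} {p : Poly n} (hp : p ∈ bihomogeneous n j 0) :
    toL2 n p ∈ harm n j 0 :=
  mem_harm.mpr ⟨p, hp, complexLaplacian_eq_zero hp (Or.inr rfl), rfl⟩

/-! ### Orthogonality -/

lemma conjPoly_mul_mem {j k j' k' : ℕ} {p q : Poly n} (hp : p ∈ bihomogeneous n j k)
    (hq : q ∈ bihomogeneous n j' k') : conjPoly n p * q ∈ bihomogeneous n (k + j') (j + k') :=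
  bihomogeneous_mul (conjPoly_mem hp) hq

/-- The circle action ζ ↦ uζ separates bidegrees only through the difference j - k. For equal
differences harmonicity is needed, see `sphInt_mul_harmonic`. -/
lemma inner_harm_of_ne {j k j' k' : ℕ} (h : k + j' ≠ j + k') {F G : L2 n} (hF : F ∈ harm n j k)
    (hG : G ∈ harm n j' k') : inner ℂ F G = 0 := by
  obtain ⟨p, hp, -, rfl⟩ := mem_harm.mp hF
  obtain ⟨q, hq, -, rfl⟩ := mem_harm.mp hG
  rw [inner_toL2]
  exact sphInt_eq_zero_of_ne h (conjPoly_mul_mem hp hq)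

/-- Induction on the degree of y. Euler writes y through the products ζ̄_i ∂̄_i y, and integration
by parts turns the factor ζ̄_i into ∂_i, which falls on r alone since ∂̄_i y is antiholomorphic; ∂_i
r is again harmonic. For constant y, Euler reduces ∫ r to ∑ ∫ ζ̄_i ∂̄_i r, a multiple of ∫ Δr = 0.
-/
lemma sphInt_mul_harmonic {m b : ℕ} {y r : Poly n} (hy : y ∈ bihomogeneous n 0 m)
    (hr : r ∈ bihomogeneous n (m + (b + 1)) (b + 1)) (hΔ : complexLaplacian n r = 0) :
    sphInt n (y * r) = 0 := by
  induction m generalizing y r with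
  | zero =>
    have hy' : ∃ c : ℂ, y = MvPolynomial.C c := by
      refine ⟨y.coeff 0, ?_⟩
      ext d
      rw [MvPolynomial.coeff_C]
      split_ifs with hd
      · rw [hd]
      · by_contra h0
        have := hy h0
        rw [weight_biWeight] at this
        have h1 := congrArg Prod.fst this
        have h2 := congrArg Prod.snd this
        simp only [Finset.sum_eq_zero_iff, Finset.mem_univ, true_imp_iff] at h1 h2
        refine hd (Finsupp.ext fun s => ?_)
        rcases s with s | s
        · exact (h1 s).symm
        · exact (h2 s).symm
    obtain ⟨c, rfl⟩ := hy'
    rw [← MvPolynomial.smul_eq_C_mul, map_smul]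
    rw [zero_add] at hr
    have h1 := congrArg (sphInt n) (sum_zY_mul_dY hr)
    have h2 : ∀ i : Fin (n + 1), sphInt n (dX i (dY i r)) =
        ((n + b + 1 : ℕ) : ℂ) * sphInt n (zY i * dY i r) := fun i => sphInt_dX (dY_mem hr i) i
    have h3 : ((n + b + 1 : ℕ) : ℂ) * ∑ i, sphInt n (zY i * dY i r) = 0 := by
      rw [Finset.mul_sum, ← Finset.sum_congr rfl fun i _ => h2 i, ← map_sum,
        ← complexLaplacian_apply, hΔ, map_zero]
    have h4 := (mul_eq_zero.mp h3).resolve_left (Nat.cast_ne_zero.mpr (Nat.succ_ne_zero _))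
    rw [map_sum, h4, map_smul, eq_comm, smul_eq_zero] at h1
    rw [h1.resolve_left (Nat.cast_ne_zero.mpr (Nat.succ_ne_zero _)), smul_zero]
  | succ m ih =>
    have e := sum_zY_mul_dY hy
    have h0 : ((m + 1 : ℕ) : ℂ) * sphInt n (y * r) = 0 := by
      rw [← smul_eq_mul, ← map_smul, ← smul_mul_assoc, ← e, Finset.sum_mul, map_sum]
      refine Finset.sum_eq_zero fun i _ => ?_
      have hy1 : dY i y ∈ bihomogeneous n 0 m := dY_mem hy i
      have hr1 : dX i r ∈ bihomogeneous n (m + (b + 1)) (b + 1) :=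
        dX_mem (by rwa [show m + (b + 1) + 1 = m + 1 + (b + 1) by ring]) i
      have hyr : dY i y * r ∈ bihomogeneous n (m + (b + 1) + 1) (m + (b + 1)) := by
        have := bihomogeneous_mul hy1 hr
        rwa [show 0 + (m + 1 + (b + 1)) = m + (b + 1) + 1 by ring] at this
      have h1 := sphInt_dX hyr i
      rw [Derivation.leibniz, dX_eq_zero hy1, smul_zero, add_zero, smul_eq_mul, ih hy1 hr1 ?_,
        eq_comm, mul_eq_zero] at h1
      · rw [mul_assoc]
        exact h1.resolve_left (Nat.cast_ne_zero.mpr (Nat.succ_ne_zero _))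
      · rw [complexLaplacian_apply]
        have := congrArg (dX i) hΔ
        rw [map_zero, complexLaplacian_apply, map_sum] at this
        rw [← this]
        refine Finset.sum_congr rfl fun l _ => ?_
        rw [pderiv_comm (Sum.inr l) (Sum.inl i), pderiv_comm (Sum.inl l) (Sum.inl i)]
    exact (mul_eq_zero.mp h0).resolve_left (Nat.cast_ne_zero.mpr (Nat.succ_ne_zero _))

lemma inner_harm_left {j k m : ℕ} {F G : L2 n} (hF : F ∈ harm n m 0)
    (hG : G ∈ harm n j (k + 1)) : inner ℂ F G = 0 := by
  by_cases h : j = m + (k + 1)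
  · subst h
    obtain ⟨p, hp, -, rfl⟩ := mem_harm.mp hF
    obtain ⟨q, hq, hq', rfl⟩ := mem_harm.mp hG
    rw [inner_toL2]
    exact sphInt_mul_harmonic (conjPoly_mem hp) hq hq'
  · exact inner_harm_of_ne (by omega) hF hG

/-! ### Conjugation and real part on `L²` -/

/-- Complex conjugation on `L²`. -/
def conjL2 (n : ℕ) : L2 n →L⋆[ℂ] L2 n :=
  ContinuousLinearMap.compLpL 2 (surf n) ((starL ℂ : ℂ ≃L⋆[ℂ] ℂ) : ℂ →L⋆[ℂ] ℂ)

lemma coeFn_conjL2 (F : L2 n) : conjL2 n F =ᵐ[surf n] fun ζ => starRingEnd ℂ (F ζ) :=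
  ContinuousLinearMap.coeFn_compLpL _ F

lemma conjL2_conjL2 (F : L2 n) : conjL2 n (conjL2 n F) = F := by
  apply Lp.ext
  filter_upwards [coeFn_conjL2 F, coeFn_conjL2 (conjL2 n F)] with ζ h1 h2
  rw [h2, h1, Complex.conj_conj]

lemma conjL2_contL2 (f : C(Sph n, ℂ)) : conjL2 n (contL2 n f) = contL2 n (star f) := by
  apply Lp.ext
  filter_upwards [coeFn_conjL2 (contL2 n f), coeFn_contL2 f, coeFn_contL2 (star f)] with ζ h1 h2 h3
  rw [h1, h2, h3]
  rfl

lemma conjL2_toL2 (p : Poly n) : conjL2 n (toL2 n p) = toL2 n (conjPoly n p) := by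
  rw [toL2_apply, toL2_apply, conjL2_contL2]
  congr 1
  ext ζ
  exact (restrictSph_conjPoly p ζ).symm

lemma inner_conjL2 (F G : L2 n) :
    inner ℂ (conjL2 n F) (conjL2 n G) = starRingEnd ℂ (inner ℂ F G) := by
  rw [L2.inner_def, L2.inner_def, ← integral_conj]
  refine integral_congr_ae ?_
  filter_upwards [coeFn_conjL2 F, coeFn_conjL2 G] with ζ h1 h2
  rw [h1, h2]
  simp

lemma norm_conjL2 (F : L2 n) : ‖conjL2 n F‖ = ‖F‖ := by
  rw [@norm_eq_sqrt_re_inner ℂ, @norm_eq_sqrt_re_inner ℂ _ _ _ _ F, inner_conjL2]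
  simp

lemma conjL2_mem_harm {j k : ℕ} {F : L2 n} (hF : F ∈ harm n j k) : conjL2 n F ∈ harm n k j := by
  obtain ⟨p, hp, hp', rfl⟩ := mem_harm.mp hF
  rw [conjL2_toL2]
  exact mem_harm.mpr ⟨_, conjPoly_mem hp, by rw [complexLaplacian_conjPoly, hp', map_zero], rfl⟩

lemma starProjection_conjL2 (j k : ℕ) (F : L2 n) :
    (harm n k j).starProjection (conjL2 n F) = conjL2 n ((harm n j k).starProjection F) := by
  refine Submodule.eq_starProjection_of_mem_orthogonal
    (conjL2_mem_harm (Submodule.starProjection_apply_mem _ _)) ?_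
  rw [Submodule.mem_orthogonal]
  intro G hG
  rw [← map_sub, ← conjL2_conjL2 G, inner_conjL2, map_eq_zero]
  exact (Submodule.mem_orthogonal _ _).mp (Submodule.sub_starProjection_mem_orthogonal F) _
    (conjL2_mem_harm hG)

lemma inner_harm_right {j k m : ℕ} {F G : L2 n} (hF : F ∈ harm n 0 m)
    (hG : G ∈ harm n (j + 1) k) : inner ℂ F G = 0 := by
  have := inner_harm_left (conjL2_mem_harm hF) (conjL2_mem_harm hG)
  rwa [inner_conjL2, map_eq_zero] at this

lemma isReal_iff_conjL2 (F : L2 n) : (∀ᵐ ζ ∂(surf n), (F ζ).im = 0) ↔ conjL2 n F = F := by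
  constructor
  · intro h
    apply Lp.ext
    filter_upwards [coeFn_conjL2 F, h] with ζ h1 h2
    rw [h1]
    exact Complex.conj_eq_iff_im.mpr h2
  · intro h
    have h1 := coeFn_conjL2 F
    rw [h] at h1
    filter_upwards [h1] with ζ h2
    exact Complex.conj_eq_iff_im.mp h2.symm

/-- The real part of an `L²` function. -/
def reL2 (n : ℕ) : L2 n →L[ℝ] L2 n :=
  ContinuousLinearMap.compLpL 2 (surf n) (Complex.ofRealCLM.comp Complex.reCLM)

lemma coeFn_reL2 (F : L2 n) : reL2 n F =ᵐ[surf n] fun ζ => ((F ζ).re : ℂ) :=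
  ContinuousLinearMap.coeFn_compLpL _ F

lemma reL2_eq (F : L2 n) : reL2 n F = (1 / 2 : ℂ) • (F + conjL2 n F) := by
  apply Lp.ext
  filter_upwards [coeFn_conjL2 F, coeFn_reL2 F, Lp.coeFn_smul (1 / 2 : ℂ) (F + conjL2 n F),
    Lp.coeFn_add F (conjL2 n F)] with ζ h1 h2 h3 h4
  rw [h2, h3, Pi.smul_apply, h4, Pi.add_apply, h1, Complex.re_eq_add_conj, smul_eq_mul]
  ring

lemma conjL2_reL2 (F : L2 n) : conjL2 n (reL2 n F) = reL2 n F := by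
  rw [← isReal_iff_conjL2]
  filter_upwards [coeFn_reL2 F] with ζ h
  rw [h, Complex.ofReal_im]

lemma reL2_of_conjL2 {F : L2 n} (h : conjL2 n F = F) : reL2 n F = F := by
  rw [reL2_eq, h]
  module

lemma reL2_conjL2 (F : L2 n) : reL2 n (conjL2 n F) = reL2 n F := by
  rw [reL2_eq, reL2_eq, conjL2_conjL2]
  exact congrArg _ (add_comm _ _)

lemma mem_realPluriharmonic {F : L2 n} :
    F ∈ realPluriharmonic n ↔ F ∈ pluriharmonic n ∧ conjL2 n F = F := by
  rw [← isReal_iff_conjL2]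
  rfl

lemma conjL2_mem_pluriharmonic {F : L2 n} (hF : F ∈ pluriharmonic n) :
    conjL2 n F ∈ pluriharmonic n := by
  have hmap : ∀ G ∈ (⨆ j : ℕ, harm n j 0 ⊔ harm n 0 j), conjL2 n G ∈
      (⨆ j : ℕ, harm n j 0 ⊔ harm n 0 j) := by
    intro G hG
    have : (⨆ j : ℕ, harm n j 0 ⊔ harm n 0 j) ≤
        (⨆ j : ℕ, harm n j 0 ⊔ harm n 0 j).comap (conjL2 n).toLinearMap := by
      refine iSup_le fun j => sup_le ?_ ?_
      · intro G hG
        exact Submodule.mem_iSup_of_mem j (Submodule.mem_sup_right (conjL2_mem_harm hG))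
      · intro G hG
        exact Submodule.mem_iSup_of_mem j (Submodule.mem_sup_left (conjL2_mem_harm hG))
    exact this hG
  exact map_mem_closure (conjL2 n).continuous hF hmap

lemma reL2_mem_realPluriharmonic {F : L2 n} (hF : F ∈ pluriharmonic n) :
    reL2 n F ∈ realPluriharmonic n := by
  rw [mem_realPluriharmonic]
  refine ⟨?_, conjL2_reL2 F⟩
  rw [reL2_eq]
  exact Submodule.smul_mem _ _ (add_mem hF (conjL2_mem_pluriharmonic hF))

/-! ### Completeness of the spherical harmonics -/

lemma restrictSph_normSqPoly : restrictSph n (normSqPoly n) = 1 := by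
  ext ζ
  have hs : ∑ i, ‖(ζ : CSpace n) i‖ ^ 2 = 1 := by
    rw [← EuclideanSpace.norm_sq_eq, norm_eq_of_mem_sphere, one_pow]
  rw [normSqPoly, map_sum, ContinuousMap.coe_sum, Finset.sum_apply]
  simp only [map_mul, ContinuousMap.mul_apply, restrictSph_zX, restrictSph_zY, Complex.mul_conj,
    Complex.normSq_eq_norm_sq, ContinuousMap.one_apply]
  exact_mod_cast hs

/-- Since |ζ|² = 1 on the sphere, each Fischer decomposition splits off a harmonic polynomial and
leaves one of bidegree lower by (1, 1). -/
lemma toL2_mem_iSup_harm {j k : ℕ} {p : Poly n} (hp : p ∈ bihomogeneous n j k) :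
    toL2 n p ∈ ⨆ q : ℕ × ℕ, harm n q.1 q.2 := by
  induction j generalizing k p with
  | zero =>
    exact Submodule.mem_iSup_of_mem (0, k)
      (mem_harm.mpr ⟨p, hp, complexLaplacian_eq_zero hp (Or.inl rfl), rfl⟩)
  | succ j ih =>
    rcases k with _ | k
    · exact Submodule.mem_iSup_of_mem (j + 1, 0)
        (mem_harm.mpr ⟨p, hp, complexLaplacian_eq_zero hp (Or.inr rfl), rfl⟩)
    · obtain ⟨q, hq, h⟩ := exists_harmonic_add hp
      have e : toL2 n p = toL2 n (p - normSqPoly n * q) + toL2 n q := by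
        have : toL2 n (normSqPoly n * q) = toL2 n q := by
          rw [toL2_apply, map_mul, restrictSph_normSqPoly, one_mul, toL2_apply]
        rw [map_sub, this, sub_add_cancel]
      rw [e]
      exact add_mem (Submodule.mem_iSup_of_mem (j + 1, k + 1) (mem_harm.mpr ⟨_, h.1, h.2, rfl⟩))
        (ih hq)

lemma toL2_mem_iSup_harm' (p : Poly n) : toL2 n p ∈ ⨆ q : ℕ × ℕ, harm n q.1 q.2 := by
  rw [p.as_sum, map_sum]
  exact Submodule.sum_mem _ fun d _ => toL2_mem_iSup_harm (monomial_mem_bihomogeneous d _)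

lemma dense_range_restrictSph : DenseRange (restrictSph n) := by
  let A : StarSubalgebra ℂ C(Sph n, ℂ) :=
    { (restrictSph n).range with
      star_mem' := by
        rintro _ ⟨p, rfl⟩
        exact ⟨conjPoly n p, ContinuousMap.ext fun ζ => restrictSph_conjPoly p ζ⟩ }
  have hA : A.SeparatesPoints := by
    intro x y hxy
    have : ∃ i, (x : CSpace n) i ≠ (y : CSpace n) i := by
      by_contra! h
      exact hxy (Subtype.ext (PiLp.ext h))
    obtain ⟨i, hi⟩ := this
    refine ⟨_, ⟨restrictSph n (zX i), ⟨zX i, rfl⟩, rfl⟩, ?_⟩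
    change restrictSph n (zX i) x ≠ restrictSph n (zX i) y
    rwa [restrictSph_zX, restrictSph_zX]
  have h := ContinuousMap.starSubalgebra_topologicalClosure_eq_top_of_separatesPoints A hA
  intro f
  have hf : f ∈ A.topologicalClosure := by rw [h]; trivial
  exact hf

lemma denseRange_contL2 : DenseRange (contL2 n) := by
  have : (surf n).WeaklyRegular := inferInstance
  exact ContinuousMap.toLp_denseRange ℂ (surf n) ℂ (by norm_num)

lemma eq_zero_of_forall_harm {F : L2 n} (h : ∀ j k, ∀ G ∈ harm n j k, inner ℂ G F = 0) : F = 0 := by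
  have hd : DenseRange (toL2 n) := denseRange_contL2.comp dense_range_restrictSph
    (contL2 n).continuous
  have hp : ∀ p, inner ℂ (toL2 n p) F = 0 := by
    intro p
    have hle : (⨆ q : ℕ × ℕ, harm n q.1 q.2) ≤ (Submodule.span ℂ {F})ᗮ := by
      refine iSup_le fun q G hG => ?_
      rw [Submodule.mem_orthogonal_singleton_iff_inner_left]
      exact h _ _ G hG
    exact Submodule.mem_orthogonal_singleton_iff_inner_left.mp (hle (toL2_mem_iSup_harm' p))
  have hall : ∀ G : L2 n, inner ℂ G F = 0 := fun G => hd.induction_on G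
    (isClosed_eq (by fun_prop) continuous_const) hp
  exact inner_self_eq_zero.mp (hall F)

/-! ### The reproducing property -/

/-- The holomorphic linear form `ζ ↦ ⟨p, ζ⟩ = ∑ᵢ p̄ᵢ ζᵢ`. -/
def linPoly (p : CSpace n) : Poly n := ∑ i, starRingEnd ℂ (p i) • zX i

lemma linPoly_mem (p : CSpace n) : linPoly p ∈ bihomogeneous n 1 0 :=
  Submodule.sum_mem _ fun i _ => Submodule.smul_mem _ _ (zX_mem i)

lemma bihomogeneous_pow {j k : ℕ} {p : Poly n} (hp : p ∈ bihomogeneous n j k) (m : ℕ) :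
    p ^ m ∈ bihomogeneous n (m * j) (m * k) := by
  have := MvPolynomial.IsWeightedHomogeneous.pow (mem_bihomogeneous.mp hp) m
  rw [mem_bihomogeneous]
  simpa using this

lemma linPoly_pow_mem (p : CSpace n) (m : ℕ) : linPoly p ^ m ∈ bihomogeneous n m 0 := by
  simpa using bihomogeneous_pow (linPoly_mem p) m

/-- Evaluation of a polynomial at a point of `ℂ^{n+1}`. -/
def evalPoly (p : CSpace n) : Poly n →ₐ[ℂ] ℂ :=
  MvPolynomial.aeval (Sum.elim (fun i => p i) (fun i => starRingEnd ℂ (p i)))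

lemma evalPoly_zX (p : CSpace n) (i : Fin (n + 1)) : evalPoly p (zX i) = p i := by
  simp [evalPoly]

lemma evalPoly_eq_restrictSph (ζ : Sph n) (h : Poly n) :
    evalPoly (ζ : CSpace n) h = restrictSph n h ζ := by
  induction h using MvPolynomial.induction_on with
  | C a =>
    rw [← MvPolynomial.algebraMap_eq, AlgHom.commutes, AlgHom.commutes]
    simp
  | add p q hp hq => simp only [map_add, ContinuousMap.add_apply, hp, hq]
  | mul_X p i hp =>
    simp only [map_mul, ContinuousMap.mul_apply, hp]
    congr 1
    rcases i with i | i
    · simp [evalPoly, restrictSph]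
    · simp [evalPoly, restrictSph]

lemma evalPoly_linPoly (p q : CSpace n) : evalPoly q (linPoly p) = inner ℂ p q := by
  simp only [linPoly, map_sum, map_smul, evalPoly_zX, PiLp.inner_apply, smul_eq_mul]
  exact Finset.sum_congr rfl fun i _ => by rw [RCLike.inner_apply, mul_comm]

/-- The total surface measure of the sphere. -/
def surfTotal (n : ℕ) : ℝ := (surf n).real Set.univ

lemma surfTotal_pos : 0 < surfTotal n := by
  unfold surfTotal surf
  rw [Measure.toSphere_real_apply_univ, finrank_CSpace]
  have : 0 < (volume : Measure (CSpace n)).real (Metric.ball 0 1) :=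
    ENNReal.toReal_pos (Metric.measure_ball_pos _ _ one_pos).ne' measure_ball_lt_top.ne
  positivity

lemma sphInt_one : sphInt n 1 = surfTotal n := by
  rw [sphInt_apply]
  simp [surfTotal]

/-- The constant `‖⟨p, ·⟩^j‖₂²` for a unit vector `p`. -/
def reproConst (n j : ℕ) : ℝ :=
  surfTotal n * (n.factorial * j.factorial) / (n + j).factorial

lemma reproConst_pos (j : ℕ) : 0 < reproConst n j := by
  have := surfTotal_pos (n := n)
  unfold reproConst
  positivity

lemma reproConst_succ (j : ℕ) :
    ((n + j + 1 : ℕ) : ℝ) * reproConst n (j + 1) = ((j + 1 : ℕ) : ℝ) * reproConst n j := by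
  unfold reproConst
  rw [show n + (j + 1) = n + j + 1 by ring, Nat.factorial_succ, Nat.factorial_succ]
  push_cast
  field_simp

lemma conjPoly_linPoly (p : CSpace n) : conjPoly n (linPoly p) = ∑ i, p i • zY i := by
  simp [linPoly, conjPoly_smul, conjPoly_X]

/-- Up to a constant, ⟨p, ·⟩^j is the reproducing kernel of H_{j0}. Integration by parts trades one
factor ∑ p_i ζ̄_i for the derivative ∑ p_i ∂_i h, and Euler's identity at the point p closes the
recursion, with constants that obey `reproConst_succ`. -/
lemma sphInt_conj_linPoly_pow (p : CSpace n) {j : ℕ} {h : Poly n} (hh : h ∈ bihomogeneous n j 0) :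
    sphInt n (conjPoly n (linPoly p ^ j) * h) = (reproConst n j : ℂ) * evalPoly p h := by
  induction j generalizing h with
  | zero =>
    have e : h = MvPolynomial.C (h.coeff 0) := by
      ext d
      rw [MvPolynomial.coeff_C]
      split_ifs with hd
      · rw [hd]
      · by_contra h0
        have := hh h0
        rw [weight_biWeight] at this
        have h1 := congrArg Prod.fst this
        have h2 := congrArg Prod.snd this
        simp only [Finset.sum_eq_zero_iff, Finset.mem_univ, true_imp_iff] at h1 h2
        refine hd (Finsupp.ext fun s => ?_)
        rcases s with s | s
        · exact (h1 s).symm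
        · exact (h2 s).symm
    rw [e, pow_zero, map_one, one_mul, ← mul_one (MvPolynomial.C _), ← MvPolynomial.smul_eq_C_mul,
      map_smul, sphInt_one, map_smul, map_one, reproConst]
    have : ((n.factorial : ℕ) : ℂ) ≠ 0 := Nat.cast_ne_zero.mpr (Nat.factorial_ne_zero _)
    simp only [smul_eq_mul, add_zero, Nat.factorial_zero, Nat.cast_one, mul_one]
    push_cast
    field_simp
  | succ j ih =>
    set c := conjPoly n (linPoly p ^ j) with hc
    have hcm : c ∈ bihomogeneous n 0 j := conjPoly_mem (linPoly_pow_mem p j)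
    have hch : c * h ∈ bihomogeneous n (j + 1) j := by
      simpa using bihomogeneous_mul hcm hh
    have h1 : ∀ i, ((n + j + 1 : ℕ) : ℂ) * sphInt n (zY i * (c * h)) =
        (reproConst n j : ℂ) * evalPoly p (dX i h) := by
      intro i
      rw [← sphInt_dX hch i, Derivation.leibniz, dX_eq_zero hcm, smul_zero, add_zero, smul_eq_mul,
        ih (dX_mem hh i)]
    have h2 : conjPoly n (linPoly p ^ (j + 1)) * h = ∑ i, p i • (zY i * (c * h)) := by
      rw [pow_succ, map_mul, conjPoly_linPoly, ← hc, mul_right_comm, mul_comm, Finset.sum_mul]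
      exact Finset.sum_congr rfl fun i _ => by rw [smul_mul_assoc]
    have h3 : ((j + 1 : ℕ) : ℂ) * evalPoly p h = ∑ i, p i * evalPoly p (dX i h) := by
      rw [← smul_eq_mul, ← map_smul, ← sum_zX_mul_dX hh, map_sum]
      exact Finset.sum_congr rfl fun i _ => by rw [map_mul, evalPoly_zX]
    have h4 : ((n + j + 1 : ℕ) : ℂ) * sphInt n (conjPoly n (linPoly p ^ (j + 1)) * h) =
        ((n + j + 1 : ℕ) : ℂ) * ((reproConst n (j + 1) : ℂ) * evalPoly p h) := by
      have e := congrArg (fun x : ℝ => (x : ℂ)) (reproConst_succ (n := n) j)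
      simp only [Complex.ofReal_mul, Complex.ofReal_natCast] at e
      rw [← mul_assoc, e, mul_right_comm, h3, h2, map_sum, Finset.mul_sum, Finset.sum_mul]
      refine Finset.sum_congr rfl fun i _ => ?_
      rw [map_smul, smul_eq_mul, mul_left_comm, h1]
      ring
    exact mul_left_cancel₀ (Nat.cast_ne_zero.mpr (Nat.succ_ne_zero _)) h4

/-- The class in `L²` of the function `ζ ↦ ⟨p, ζ⟩^j`. -/
def powL2 (j : ℕ) (p : CSpace n) : L2 n := toL2 n (linPoly p ^ j)

lemma powL2_mem (j : ℕ) (p : CSpace n) : powL2 j p ∈ harm n j 0 :=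
  toL2_mem_harm_left (linPoly_pow_mem p j)

lemma inner_powL2_toL2 (p : CSpace n) {j : ℕ} {h : Poly n} (hh : h ∈ bihomogeneous n j 0) :
    inner ℂ (powL2 j p) (toL2 n h) = (reproConst n j : ℂ) * evalPoly p h := by
  rw [powL2, inner_toL2, sphInt_conj_linPoly_pow p hh]

lemma inner_powL2 (j : ℕ) (p q : CSpace n) :
    inner ℂ (powL2 j p) (powL2 j q) = (reproConst n j : ℂ) * (inner ℂ q p) ^ j := by
  rw [powL2, powL2, inner_toL2, sphInt_conj_linPoly_pow p (linPoly_pow_mem q j), map_pow,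
    evalPoly_linPoly]

lemma norm_powL2_sq (j : ℕ) (p : CSpace n) :
    ‖powL2 j p‖ ^ 2 = reproConst n j * ‖p‖ ^ (2 * j) := by
  have h := inner_powL2 j p p
  rw [inner_self_eq_norm_sq_to_K, inner_self_eq_norm_sq_to_K] at h
  rw [pow_mul]
  refine Complex.ofReal_injective ?_
  push_cast
  exact h

/-- Point evaluations on `harm n j 0` are bounded by the `L²` norm. -/
lemma norm_restrictSph_sq_le {j : ℕ} {h : Poly n} (hh : h ∈ bihomogeneous n j 0) (ζ : Sph n) :
    reproConst n j * ‖restrictSph n h ζ‖ ^ 2 ≤ ‖toL2 n h‖ ^ 2 := by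
  have h1 := norm_inner_le_norm (𝕜 := ℂ) (powL2 j (ζ : CSpace n)) (toL2 n h)
  rw [inner_powL2_toL2 _ hh, evalPoly_eq_restrictSph, norm_mul, Complex.norm_real,
    Real.norm_of_nonneg (reproConst_pos j).le] at h1
  have h2 := norm_powL2_sq j (ζ : CSpace n)
  rw [norm_eq_of_mem_sphere, one_pow, mul_one] at h2
  have h3 := pow_le_pow_left₀ (mul_nonneg (reproConst_pos j).le (norm_nonneg _)) h1 2
  rw [mul_pow, mul_pow, h2, sq (reproConst n j), mul_assoc] at h3
  exact le_of_mul_le_mul_left h3 (reproConst_pos j)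

lemma exists_bound_of_mem_harm_left {j : ℕ} {F : L2 n} (hF : F ∈ harm n j 0) :
    ∀ᵐ ζ ∂(surf n), reproConst n j * ‖F ζ‖ ^ 2 ≤ ‖F‖ ^ 2 := by
  obtain ⟨h, hh, -, rfl⟩ := mem_harm.mp hF
  filter_upwards [coeFn_contL2 (restrictSph n h)] with ζ hζ
  rw [toL2_apply, hζ]
  exact norm_restrictSph_sq_le hh ζ

/-- An element of `harm n j 0` that is orthogonal to all powers `⟨p, ·⟩^j` vanishes. -/
lemma eq_zero_of_inner_powL2 {j : ℕ} {F : L2 n} (hF : F ∈ harm n j 0)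
    (h : ∀ p : CSpace n, inner ℂ (powL2 j p) F = 0) : F = 0 := by
  obtain ⟨f, hf, -, rfl⟩ := mem_harm.mp hF
  have : restrictSph n f = 0 := by
    ext ζ
    have h1 := h ζ
    rw [inner_powL2_toL2 _ hf, evalPoly_eq_restrictSph, mul_eq_zero] at h1
    exact h1.resolve_left (Complex.ofReal_ne_zero.mpr (reproConst_pos j).ne')
  rw [toL2_apply, this, map_zero]

/-- The remainder of the projection onto the span is orthogonal to all powers, so by the reproducing
property it vanishes at every point. -/
lemma harm_le_span_powL2 (j : ℕ) :
    harm n j 0 ≤ Submodule.span ℂ (Set.range (powL2 j : CSpace n → L2 n)) := by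
  set S := Submodule.span ℂ (Set.range (powL2 j : CSpace n → L2 n)) with hS
  have hle : S ≤ harm n j 0 := Submodule.span_le.mpr (by rintro _ ⟨p, rfl⟩; exact powL2_mem j p)
  have : FiniteDimensional ℂ S := Submodule.finiteDimensional_of_le hle
  intro F hF
  have h0 : F - S.starProjection F = 0 := by
    refine eq_zero_of_inner_powL2 (sub_mem hF (hle (Submodule.starProjection_apply_mem _ _)))
      fun p => ?_
    exact (Submodule.mem_orthogonal _ _).mp (Submodule.sub_starProjection_mem_orthogonal F) _
      (Submodule.subset_span ⟨p, rfl⟩)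
  rw [sub_eq_zero.mp h0]
  exact Submodule.starProjection_apply_mem _ _

/-! ### The decomposition of pluriharmonic functions -/

/-- The spaces `H_{m0}` for `m ≥ 0`, and `H_{0,-m}` for `m ≤ 0`. -/
def harmZ (n : ℕ) (m : ℤ) : Submodule ℂ (L2 n) := harm n m.toNat (-m).toNat

instance instFiniteDimensionalHarmZ (n : ℕ) (m : ℤ) : FiniteDimensional ℂ (harmZ n m) := by
  unfold harmZ; infer_instance

lemma harmZ_natCast (j : ℕ) : harmZ n j = harm n j 0 := by simp [harmZ]

lemma harmZ_neg_natCast (j : ℕ) : harmZ n (-j) = harm n 0 j := by simp [harmZ]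

lemma iSup_harmZ : (⨆ m : ℤ, harmZ n m) = ⨆ j : ℕ, harm n j 0 ⊔ harm n 0 j := by
  apply le_antisymm
  · refine iSup_le fun m => ?_
    obtain ⟨j, rfl | rfl⟩ := m.eq_nat_or_neg
    · rw [harmZ_natCast]
      exact le_sup_left.trans (le_iSup (fun j : ℕ => harm n j 0 ⊔ harm n 0 j) j)
    · rw [harmZ_neg_natCast]
      exact le_sup_right.trans (le_iSup (fun j : ℕ => harm n j 0 ⊔ harm n 0 j) j)
  · refine iSup_le fun j => sup_le ?_ ?_
    · rw [← harmZ_natCast]; exact le_iSup _ _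
    · rw [← harmZ_neg_natCast]; exact le_iSup _ _

lemma inner_harmZ {m m' : ℤ} (h : m ≠ m') {F G : L2 n} (hF : F ∈ harmZ n m)
    (hG : G ∈ harmZ n m') : inner ℂ F G = 0 :=
  inner_harm_of_ne (by omega) hF hG

/-- The component in `harmZ n m`. -/
def comp (m : ℤ) : L2 n →L[ℂ] L2 n := (harmZ n m).starProjection

lemma comp_mem (m : ℤ) (F : L2 n) : comp m F ∈ harmZ n m := Submodule.starProjection_apply_mem _ _

lemma comp_eq_self {m : ℤ} {F : L2 n} (h : F ∈ harmZ n m) : comp m F = F :=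
  Submodule.starProjection_eq_self_iff.mpr h

lemma comp_eq_zero {m m' : ℤ} (h : m ≠ m') {F : L2 n} (hF : F ∈ harmZ n m') : comp m F = 0 := by
  refine Submodule.starProjection_apply_eq_zero_iff _ |>.mpr ?_
  rw [Submodule.mem_orthogonal]
  exact fun G hG => inner_harmZ h hG hF

lemma compNorm_natCast (j : ℕ) (F : L2 n) : compNorm j 0 F = ‖comp (j : ℤ) F‖ := by
  simp [compNorm, comp, harmZ]

lemma compNorm_neg_natCast (j : ℕ) (F : L2 n) : compNorm 0 j F = ‖comp (-j : ℤ) F‖ := by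
  simp [compNorm, comp, harmZ]

lemma comp_conjL2 (m : ℤ) (F : L2 n) : comp m (conjL2 n F) = conjL2 n (comp (-m) F) := by
  obtain ⟨j, rfl | rfl⟩ := m.eq_nat_or_neg
  · have := starProjection_conjL2 0 j F
    simpa [comp, harmZ] using this
  · have := starProjection_conjL2 j 0 F
    simpa [comp, harmZ] using this

lemma compNorm_eq_zero_of_mem_pluriharmonic {j k : ℕ} {F : L2 n} (hF : F ∈ pluriharmonic n) :
    compNorm (j + 1) (k + 1) F = 0 := by
  have hle : (⨆ j : ℕ, harm n j 0 ⊔ harm n 0 j) ≤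
      LinearMap.ker (harm n (j + 1) (k + 1)).starProjection.toLinearMap := by
    refine iSup_le fun m => sup_le ?_ ?_
    · intro G hG
      refine (Submodule.starProjection_apply_eq_zero_iff _).mpr ?_
      rw [Submodule.mem_orthogonal']
      exact fun H hH => inner_harm_left hG hH
    · intro G hG
      refine (Submodule.starProjection_apply_eq_zero_iff _).mpr ?_
      rw [Submodule.mem_orthogonal']
      exact fun H hH => inner_harm_right hG hH
  have hcl : IsClosed ((LinearMap.ker (harm n (j + 1) (k + 1)).starProjection.toLinearMap :
      Submodule ℂ (L2 n)) : Set (L2 n)) :=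
    ContinuousLinearMap.isClosed_ker (harm n (j + 1) (k + 1)).starProjection
  have := Submodule.topologicalClosure_minimal _ hle hcl hF
  rw [compNorm, norm_eq_zero]
  exact this

lemma harm_le_pluriharmonic_left (j : ℕ) : harm n j 0 ≤ pluriharmonic n :=
  (le_sup_left.trans (le_iSup (fun j : ℕ => harm n j 0 ⊔ harm n 0 j) j)).trans
    (Submodule.le_topologicalClosure _)

lemma harmZ_le_pluriharmonic (m : ℤ) : harmZ n m ≤ pluriharmonic n := by
  unfold pluriharmonic
  rw [← iSup_harmZ]
  exact (le_iSup _ m).trans (Submodule.le_topologicalClosure _)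

/-- A function without components in `H_{jk}`, `j, k ≥ 1`, is pluriharmonic. -/
lemma mem_pluriharmonic_of_compNorm {F : L2 n} (h : ∀ j k, compNorm (j + 1) (k + 1) F = 0) :
    F ∈ pluriharmonic n := by
  have : CompleteSpace (pluriharmonic n) :=
    (Submodule.isClosed_topologicalClosure _).completeSpace_coe
  set R := F - (pluriharmonic n).starProjection F with hR
  have hR1 : R ∈ (pluriharmonic n)ᗮ := Submodule.sub_starProjection_mem_orthogonal F
  have hR0 : R = 0 := by
    refine eq_zero_of_forall_harm fun j k G hG => ?_
    rcases k with _ | k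
    · exact (Submodule.mem_orthogonal _ _).mp hR1 G (harm_le_pluriharmonic_left j hG)
    · rcases j with _ | j
      · refine (Submodule.mem_orthogonal _ _).mp hR1 G (harmZ_le_pluriharmonic (-(k + 1 : ℕ)) ?_)
        rwa [harmZ_neg_natCast]
      · have h1 : (harm n (j + 1) (k + 1)).starProjection R = 0 := by
          rw [hR, map_sub, norm_eq_zero.mp (h j k), zero_sub, neg_eq_zero]
          exact norm_eq_zero.mp
            (compNorm_eq_zero_of_mem_pluriharmonic (Submodule.starProjection_apply_mem _ _))
        exact (Submodule.mem_orthogonal _ _).mp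
          ((Submodule.starProjection_apply_eq_zero_iff _).mp h1) G hG
  rw [sub_eq_zero.mp hR0]
  exact Submodule.starProjection_apply_mem _ _

/-- Bessel's inequality. Being uniform in s, it carries the expansion from the algebraic span to its
closure. -/
lemma norm_sum_comp_le (s : Finset ℤ) (F : L2 n) : ‖∑ m ∈ s, comp m F‖ ≤ ‖F‖ := by
  set T := ∑ m ∈ s, comp m F with hT
  have h0 : inner ℂ T (F - T) = 0 := by
    rw [hT, sum_inner]
    refine Finset.sum_eq_zero fun m hm => ?_
    have : comp m (F - T) = 0 := by
      rw [map_sub, hT, map_sum, Finset.sum_eq_single m, comp_eq_self (comp_mem m F), sub_self]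
      · exact fun m' _ hne => comp_eq_zero (Ne.symm hne) (comp_mem m' F)
      · exact fun h => absurd hm h
    exact (Submodule.mem_orthogonal _ _).mp
      ((Submodule.starProjection_apply_eq_zero_iff _).mp this) _ (comp_mem m F)
  have h1 : ‖F‖ * ‖F‖ = ‖T‖ * ‖T‖ + ‖F - T‖ * ‖F - T‖ := by
    have := norm_add_sq_eq_norm_sq_add_norm_sq_of_inner_eq_zero T (F - T) h0
    rwa [add_sub_cancel] at this
  nlinarith [norm_nonneg T, norm_nonneg F, norm_nonneg (F - T)]

/-- The expansion of a pluriharmonic function. -/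
lemma hasSum_comp {F : L2 n} (hF : F ∈ pluriharmonic n) : HasSum (fun m : ℤ => comp m F) F := by
  have hfin : ∀ G ∈ ⨆ m : ℤ, harmZ n m, HasSum (fun m : ℤ => comp m G) G := by
    intro G hG
    refine Submodule.iSup_induction (harmZ n) (motive := fun G => HasSum (fun m : ℤ => comp m G) G)
      hG ?_ ?_ ?_
    · intro m G hG
      have := hasSum_single (f := fun m : ℤ => comp m G) m fun m' hne => comp_eq_zero hne hG
      rwa [comp_eq_self hG] at this
    · simp
    · intro G G' h h'
      simpa using h.add h'
  rw [pluriharmonic, ← iSup_harmZ] at hF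
  rw [HasSum, Metric.tendsto_nhds]
  intro ε hε
  obtain ⟨G, hG, hFG⟩ := Metric.mem_closure_iff.mp hF (ε / 3) (by positivity)
  have h1 := Metric.tendsto_nhds.mp (hfin G hG) (ε / 3) (by positivity)
  filter_upwards [h1] with s hs
  rw [dist_eq_norm] at hs hFG ⊢
  have e : ∑ m ∈ s, comp m F - F =
      ∑ m ∈ s, comp m (F - G) + (∑ m ∈ s, comp m G - G) - (F - G) := by
    simp only [map_sub, Finset.sum_sub_distrib]
    abel
  have h2 := norm_sum_comp_le s (F - G)
  rw [e]
  calc _ ≤ ‖∑ m ∈ s, comp m (F - G)‖ + ‖∑ m ∈ s, comp m G - G‖ + ‖F - G‖ :=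
        (norm_sub_le _ _).trans (add_le_add (norm_add_le _ _) le_rfl)
    _ < ε := by linarith

lemma hasSum_norm_comp_sq {F : L2 n} (hF : F ∈ pluriharmonic n) :
    HasSum (fun m : ℤ => ‖comp m F‖ ^ 2) (‖F‖ ^ 2) := by
  have h := (hasSum_comp hF).mapL (innerSL ℂ F)
  have h2 := h.mapL Complex.reCLM
  convert h2 using 1
  · funext m
    simp only [innerSL_apply_apply, Complex.reCLM_apply]
    have : inner ℂ F (comp m F) = inner ℂ (comp m F) (comp m F) := by
      conv_lhs => rw [← comp_eq_self (comp_mem m F)]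
      exact (Submodule.inner_starProjection_left_eq_right _ _ _).symm
    rw [this, inner_self_eq_norm_sq_to_K]
    norm_cast
  · simp only [innerSL_apply_apply, Complex.reCLM_apply]
    rw [inner_self_eq_norm_sq_to_K]
    norm_cast

/-! ### Weighted square sums of components -/

section Weighted

variable {E ι : Type*} [NormedAddCommGroup E] [InnerProductSpace ℂ E]

/-- The vectors `F` with `∑ᵢ wᵢ ‖Pᵢ F‖² < ∞`. -/
def wDom (P : ι → E →L[ℂ] E) (w : ι → NNReal) : Submodule ℂ E where
  carrier := {F | Memℓp (fun i => (Real.sqrt (w i) : ℂ) • P i F) 2}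
  add_mem' {F G} hF hG := by
    have h := Memℓp.add hF hG
    have e : (fun i => (Real.sqrt (w i) : ℂ) • P i (F + G)) =
        (fun i => (Real.sqrt (w i) : ℂ) • P i F) + fun i => (Real.sqrt (w i) : ℂ) • P i G := by
      funext i
      rw [map_add, smul_add, Pi.add_apply]
    change Memℓp (fun i => (Real.sqrt (w i) : ℂ) • P i (F + G)) 2
    rw [e]
    exact h
  zero_mem' := by
    have e : (fun i => (Real.sqrt (w i) : ℂ) • P i (0 : E)) = 0 := by
      funext i
      rw [map_zero, smul_zero, Pi.zero_apply]
    change Memℓp (fun i => (Real.sqrt (w i) : ℂ) • P i (0 : E)) 2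
    rw [e]
    exact zero_memℓp
  smul_mem' c F hF := by
    have h := Memℓp.const_smul hF c
    have e : (fun i => (Real.sqrt (w i) : ℂ) • P i (c • F)) =
        c • fun i => (Real.sqrt (w i) : ℂ) • P i F := by
      funext i
      rw [map_smul, Pi.smul_apply, smul_comm]
    change Memℓp (fun i => (Real.sqrt (w i) : ℂ) • P i (c • F)) 2
    rw [e]
    exact h

variable {P : ι → E →L[ℂ] E} {w : ι → NNReal}

lemma norm_sqrt_smul_sq (i : ι) (F : E) :
    ‖(Real.sqrt (w i) : ℂ) • P i F‖ ^ 2 = w i * ‖P i F‖ ^ 2 := by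
  rw [norm_smul, Complex.norm_real, Real.norm_of_nonneg (Real.sqrt_nonneg _), mul_pow,
    Real.sq_sqrt (NNReal.coe_nonneg _)]

lemma mem_wDom {F : E} : F ∈ wDom P w ↔ Summable fun i => (w i : ℝ) * ‖P i F‖ ^ 2 := by
  change Memℓp _ 2 ↔ _
  rw [memℓp_gen_iff (by norm_num)]
  simp only [ENNReal.toReal_ofNat, Real.rpow_ofNat, norm_sqrt_smul_sq]

/-- The isometric embedding `F ↦ (√wᵢ Pᵢ F)ᵢ` into the Hilbert sum. -/
def wMap (P : ι → E →L[ℂ] E) (w : ι → NNReal) : wDom P w →ₗ[ℂ] lp (fun _ : ι => E) 2 where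
  toFun F := ⟨fun i => (Real.sqrt (w i) : ℂ) • P i F, F.2⟩
  map_add' F G := lp.ext (funext fun i => by
    change (Real.sqrt (w i) : ℂ) • P i (F + G : E) =
      (Real.sqrt (w i) : ℂ) • P i F + (Real.sqrt (w i) : ℂ) • P i G
    rw [map_add, smul_add])
  map_smul' c F := lp.ext (funext fun i => by
    change (Real.sqrt (w i) : ℂ) • P i (c • F : E) = c • (Real.sqrt (w i) : ℂ) • P i F
    rw [map_smul, smul_comm])

lemma wMap_apply (F : wDom P w) (i : ι) : wMap P w F i = (Real.sqrt (w i) : ℂ) • P i F := rfl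

lemma hasSum_norm_wMap_sq (F : wDom P w) :
    HasSum (fun i => (w i : ℝ) * ‖P i F‖ ^ 2) (‖wMap P w F‖ ^ 2) := by
  have h := lp.hasSum_norm (p := 2) (by norm_num) (wMap P w F)
  simpa only [ENNReal.toReal_ofNat, Real.rpow_ofNat, wMap_apply, norm_sqrt_smul_sq] using h

lemma norm_wMap_sq (F : wDom P w) : ‖wMap P w F‖ ^ 2 = ∑' i, (w i : ℝ) * ‖P i F‖ ^ 2 :=
  (hasSum_norm_wMap_sq F).tsum_eq.symm

lemma hasSum_inner_wMap (F G : wDom P w) :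
    HasSum (fun i => ((w i : ℝ) : ℂ) * inner ℂ (P i F) (P i G))
      (inner ℂ (wMap P w F) (wMap P w G)) := by
  have h := lp.hasSum_inner (𝕜 := ℂ) (wMap P w F) (wMap P w G)
  refine h.congr_fun fun i => ?_
  rw [wMap_apply, wMap_apply, inner_smul_left, inner_smul_right, Complex.conj_ofReal, ← mul_assoc,
    ← Complex.ofReal_mul, Real.mul_self_sqrt (NNReal.coe_nonneg _)]

/-- `wMap` is a closed operator, in a form suited to series. -/
lemma hasSum_wMap [CompleteSpace E] {κ : Type*} {a : κ → wDom P w} {F : E}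
    (h : HasSum (fun k => (a k : E)) F) (hs : Summable fun k => ‖wMap P w (a k)‖) :
    ∃ hF : F ∈ wDom P w, HasSum (fun k => wMap P w (a k)) (wMap P w ⟨F, hF⟩) := by
  obtain ⟨v, hv⟩ := hs.of_norm
  have hcoord : ∀ i, v i = (Real.sqrt (w i) : ℂ) • P i F := by
    intro i
    have h1 := (lp.evalCLM ℂ (fun _ : ι => E) 2 i).hasSum hv
    have h2 := (h.mapL (P i)).const_smul (Real.sqrt (w i) : ℂ)
    exact h1.unique h2
  have hF : F ∈ wDom P w := by
    change Memℓp _ 2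
    have : (fun i => (Real.sqrt (w i) : ℂ) • P i F) = v := by funext i; rw [hcoord]
    rw [this]
    exact lp.memℓp v
  refine ⟨hF, ?_⟩
  have : v = wMap P w ⟨F, hF⟩ := lp.ext (funext fun i => hcoord i)
  rwa [← this]

/-- Lower semicontinuity of the weighted norm. -/
lemma mem_wDom_of_tendsto {u : ℕ → wDom P w} {F : E} {C : ℕ → ℝ} {c : ℝ}
    (h : Filter.Tendsto (fun m => (u m : E)) Filter.atTop (nhds F))
    (hC : ∀ m, ‖wMap P w (u m)‖ ^ 2 ≤ C m) (hc : Filter.Tendsto C Filter.atTop (nhds c)) :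
    ∃ hF : F ∈ wDom P w, ‖wMap P w ⟨F, hF⟩‖ ^ 2 ≤ c := by
  have hpart : ∀ s : Finset ι, ∑ i ∈ s, (w i : ℝ) * ‖P i F‖ ^ 2 ≤ c := by
    intro s
    have h1 : Filter.Tendsto (fun m => ∑ i ∈ s, (w i : ℝ) * ‖P i (u m)‖ ^ 2) Filter.atTop
        (nhds (∑ i ∈ s, (w i : ℝ) * ‖P i F‖ ^ 2)) := by
      have hcont : Continuous fun G : E => ∑ i ∈ s, (w i : ℝ) * ‖P i G‖ ^ 2 := by fun_prop
      exact (hcont.tendsto F).comp h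
    refine le_of_tendsto_of_tendsto' h1 hc fun m => ?_
    refine le_trans ?_ (hC m)
    exact sum_le_hasSum s (fun i _ => by positivity) (hasSum_norm_wMap_sq (u m))
  have hF : F ∈ wDom P w := mem_wDom.mpr (summable_of_sum_le (fun i => by positivity) hpart)
  refine ⟨hF, ?_⟩
  rw [norm_wMap_sq]
  exact (mem_wDom.mp hF).tsum_le_of_sum_le hpart

/-- The restriction of `wMap` to a real subspace. -/
def wMapReal [NormedSpace ℝ E] [IsScalarTower ℝ ℂ E] (P : ι → E →L[ℂ] E) (w : ι → NNReal)
    (S : Submodule ℝ E) (hS : ∀ F ∈ S, F ∈ wDom P w) : S →ₗ[ℝ] lp (fun _ : ι => E) 2 where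
  toFun F := wMap P w ⟨F, hS F F.2⟩
  map_add' F G := (wMap P w).map_add ⟨F, hS F F.2⟩ ⟨G, hS G G.2⟩
  map_smul' r F := lp.ext (funext fun i => by
    change (Real.sqrt (w i) : ℂ) • P i (r • (F : E)) = r • (Real.sqrt (w i) : ℂ) • P i (F : E)
    have h : ∀ x : E, r • x = (r : ℂ) • x := fun x => (algebraMap_smul ℂ r x).symm
    rw [h, h, map_smul, smul_comm])

lemma hasSum_wMapReal [CompleteSpace E] [NormedSpace ℝ E] [IsScalarTower ℝ ℂ E]
    {S : Submodule ℝ E} {hS : ∀ F ∈ S, F ∈ wDom P w} {κ : Type*} {a : κ → S} {F : E}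
    (h : HasSum (fun k => (a k : E)) F) (hs : Summable fun k => ‖wMapReal P w S hS (a k)‖) :
    ∃ hF : F ∈ wDom P w, HasSum (fun k => wMapReal P w S hS (a k)) (wMap P w ⟨F, hF⟩) :=
  hasSum_wMap (P := P) (w := w) (a := fun k => ⟨a k, hS _ (a k).2⟩) h hs

/-- Cutting off coordinates in the Hilbert sum corresponds to cutting off the expansion of F. Hence
finite partial sums approximate F in the weighted norm. -/
lemma single_wMap [DecidableEq ι] {F : E} (hF : F ∈ wDom P w) {m : ι} (hm : P m F ∈ wDom P w)
    (h1 : P m (P m F) = P m F) (h2 : ∀ i ≠ m, P i (P m F) = 0) :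
    lp.single 2 m (wMap P w ⟨F, hF⟩ m) = wMap P w ⟨P m F, hm⟩ := by
  refine lp.ext (funext fun i => ?_)
  rw [wMap_apply, lp.single_apply, wMap_apply]
  by_cases hi : i = m
  · subst hi
    rw [Pi.single_eq_same, h1]
  · rw [Pi.single_eq_of_ne hi, h2 i hi, smul_zero]

end Weighted

/-! ### The weights of the Sobolev norm and of the conditional intertwinor -/

/-- The Sobolev weight of `harmZ n m`. -/
def sobWeight (n : ℕ) (m : ℤ) : NNReal :=
  (((m.natAbs : NNReal) + n / 2) * (n / 2)) ^ (n + 1)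

/-- The eigenvalue of the conditional intertwinor on `harmZ n m`. -/
def lamWeight (n : ℕ) (m : ℤ) : NNReal := ∏ l ∈ Finset.range (n + 1), ((m.natAbs : NNReal) + l)

lemma coe_lamWeight (m : ℤ) : (lamWeight n m : ℝ) = eigenvalueQ n m.natAbs := by
  simp [lamWeight, eigenvalueQ]

lemma lamWeight_zero : lamWeight n 0 = 0 := by
  rw [lamWeight, Finset.prod_eq_zero (Finset.mem_range.mpr (Nat.succ_pos n))]
  simp

lemma halfQ_eq : halfQ n = ((n + 1 : ℕ) : ℝ) := by
  rw [halfQ]; push_cast; ring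

lemma sobolevTerm_toNat (m : ℤ) (F : L2 n) :
    sobolevTerm (halfQ n) F (m.toNat, (-m).toNat) = (sobWeight n m : ℝ) * ‖comp m F‖ ^ 2 := by
  unfold sobolevTerm
  rw [halfQ_eq, Real.rpow_natCast]
  obtain ⟨j, rfl | rfl⟩ := m.eq_nat_or_neg
  · rw [← compNorm_natCast]
    simp [sobWeight]
  · rw [← compNorm_neg_natCast]
    simp [sobWeight, mul_comm]

lemma toNat_injective : Function.Injective fun m : ℤ => (m.toNat, (-m).toNat) := by
  intro m m' h
  simp only [Prod.mk.injEq] at h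
  omega

lemma sobolevTerm_eq_zero {F : L2 n} (hF : F ∈ pluriharmonic n) (p : ℕ × ℕ)
    (hp : p ∉ Set.range fun m : ℤ => (m.toNat, (-m).toNat)) :
    sobolevTerm (halfQ n) F p = 0 := by
  obtain ⟨j, k⟩ := p
  rcases j with _ | j
  · exact absurd ⟨-k, by simp⟩ hp
  · rcases k with _ | k
    · exact absurd ⟨(j + 1 : ℕ), by simp⟩ hp
    · rw [sobolevTerm, compNorm_eq_zero_of_mem_pluriharmonic hF]
      simp

/-- The Sobolev domain. -/
abbrev sobDom (n : ℕ) : Submodule ℂ (L2 n) := wDom comp (sobWeight n)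

/-- The isometric embedding of the pluriharmonic part of the Sobolev space into a Hilbert sum. -/
abbrev sobMap (n : ℕ) : sobDom n →ₗ[ℂ] lp (fun _ : ℤ => L2 n) 2 := wMap comp (sobWeight n)

/-- The form domain. -/
abbrev lamDom (n : ℕ) : Submodule ℂ (L2 n) := wDom comp (lamWeight n)

/-- The embedding which induces the quadratic form of the conditional intertwinor. -/
abbrev lamMap (n : ℕ) : lamDom n →ₗ[ℂ] lp (fun _ : ℤ => L2 n) 2 := wMap comp (lamWeight n)

lemma mem_sobolev_iff {F : L2 n} (hF : F ∈ pluriharmonic n) :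
    F ∈ sobolev n (halfQ n) ↔ F ∈ sobDom n := by
  rw [mem_wDom]
  change Summable (sobolevTerm (halfQ n) F) ↔ _
  rw [← toNat_injective.summable_iff fun p hp => sobolevTerm_eq_zero hF p hp]
  simp only [Function.comp_def, sobolevTerm_toNat]

lemma sobolevNorm_eq {F : L2 n} (hF : F ∈ pluriharmonic n) (h : F ∈ sobDom n) :
    sobolevNorm (halfQ n) F = ‖sobMap n ⟨F, h⟩‖ := by
  rw [sobolevNorm, ← Function.Injective.tsum_eq toNat_injective
    (fun p hp => by
      by_contra h'
      exact hp (sobolevTerm_eq_zero hF p h'))]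
  simp only [sobolevTerm_toNat]
  rw [← norm_wMap_sq (P := comp) (w := sobWeight n) ⟨F, h⟩, Real.sqrt_sq (norm_nonneg _)]

/-- For n ≥ 1 both factors j + n/2 and k + n/2 are at least 1/2, so each weight is at least
4^{-(n+1)}; the constant is the inverse square root of this bound. -/
lemma compNorm_le_sobolevNorm (hn : 1 ≤ n) {F : L2 n} (hF : F ∈ sobolev n (halfQ n)) (j k : ℕ) :
    compNorm j k F ≤ 2 ^ (n + 1) * sobolevNorm (halfQ n) F := by
  have h1 : sobolevTerm (halfQ n) F (j, k) ≤ sobolevNorm (halfQ n) F ^ 2 := by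
    rw [sobolevNorm, Real.sq_sqrt (tsum_nonneg (sobolevTerm_nonneg _ _))]
    exact Summable.le_tsum hF _ (fun p _ => sobolevTerm_nonneg _ _ p)
  have hw : (1 / 4 : ℝ) ^ (n + 1) ≤ (((j : ℝ) + n / 2) * ((k : ℝ) + n / 2)) ^ halfQ n := by
    rw [halfQ_eq, Real.rpow_natCast]
    have hn' : (1 : ℝ) ≤ n := by exact_mod_cast hn
    have hj : (0 : ℝ) ≤ j := Nat.cast_nonneg _
    have hk : (0 : ℝ) ≤ k := Nat.cast_nonneg _
    refine pow_le_pow_left₀ (by norm_num) ?_ _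
    nlinarith
  have h2 : (1 / 4 : ℝ) ^ (n + 1) * compNorm j k F ^ 2 ≤ sobolevNorm (halfQ n) F ^ 2 :=
    (mul_le_mul_of_nonneg_right hw (sq_nonneg _)).trans h1
  have h3 : compNorm j k F ^ 2 ≤ (2 ^ (n + 1) * sobolevNorm (halfQ n) F) ^ 2 := by
    rw [mul_pow, ← pow_mul, mul_comm (n + 1), pow_mul]
    norm_num only at h2 ⊢
    have h4 : (4 : ℝ) ^ (n + 1) * (1 / 4) ^ (n + 1) = 1 := by rw [← mul_pow]; norm_num
    have h5 := mul_le_mul_of_nonneg_left h2 (by positivity : (0 : ℝ) ≤ 4 ^ (n + 1))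
    rwa [← mul_assoc, h4, one_mul] at h5
  exact (abs_le_of_sq_le_sq' h3 (mul_nonneg (by positivity) (Real.sqrt_nonneg _))).2

lemma one_div_four_pow_le_sobWeight (hn : 1 ≤ n) (m : ℤ) :
    (1 / 4 : ℝ) ^ (n + 1) ≤ sobWeight n m := by
  have hn' : (1 : ℝ) ≤ n := by exact_mod_cast hn
  have hj : (0 : ℝ) ≤ m.natAbs := Nat.cast_nonneg _
  simp only [sobWeight, NNReal.coe_pow, NNReal.coe_mul, NNReal.coe_add, NNReal.coe_natCast,
    NNReal.coe_div, NNReal.coe_ofNat]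
  refine pow_le_pow_left₀ (by norm_num) ?_ _
  nlinarith

lemma norm_le_sobMap (hn : 1 ≤ n) {F : L2 n} (hF : F ∈ pluriharmonic n) (h : F ∈ sobDom n) :
    ‖F‖ ≤ 2 ^ (n + 1) * ‖sobMap n ⟨F, h⟩‖ := by
  have h1 : (1 / 4 : ℝ) ^ (n + 1) * ‖F‖ ^ 2 ≤ ‖sobMap n ⟨F, h⟩‖ ^ 2 :=
    hasSum_le (fun m => mul_le_mul_of_nonneg_right (one_div_four_pow_le_sobWeight hn m)
      (sq_nonneg _)) ((hasSum_norm_comp_sq hF).mul_left _) (hasSum_norm_wMap_sq ⟨F, h⟩)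
  refine (abs_le_of_sq_le_sq' ?_ (by positivity)).2
  rw [mul_pow, ← pow_mul, mul_comm (n + 1), pow_mul]
  norm_num only at h1 ⊢
  have h4 : (4 : ℝ) ^ (n + 1) * (1 / 4) ^ (n + 1) = 1 := by rw [← mul_pow]; norm_num
  have h5 := mul_le_mul_of_nonneg_left h1 (by positivity : (0 : ℝ) ≤ 4 ^ (n + 1))
  rwa [← mul_assoc, h4, one_mul] at h5

/-- `W^{Q/2,2} ∩ RP` in terms of the expansion in the spaces `harmZ n m`. -/
lemma mem_sobolevRealPluriharmonic {F : L2 n} :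
    F ∈ sobolevRealPluriharmonic n ↔ F ∈ realPluriharmonic n ∧ F ∈ sobDom n := by
  constructor
  · rintro ⟨h1, h2⟩
    exact ⟨h2, (mem_sobolev_iff h2.1).mp h1⟩
  · rintro ⟨h1, h2⟩
    exact ⟨(mem_sobolev_iff h1.1).mpr h2, h1⟩

lemma isClosed_realPluriharmonic : IsClosed (realPluriharmonic n : Set (L2 n)) := by
  have : (realPluriharmonic n : Set (L2 n)) =
      (pluriharmonic n : Set (L2 n)) ∩ {F | conjL2 n F = F} := by
    ext F
    exact mem_realPluriharmonic
  rw [this]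
  exact (Submodule.isClosed_topologicalClosure _).inter
    (isClosed_eq (conjL2 n).continuous continuous_id)

/-- The mixed components pass to the limit one by one, so a Sobolev limit is pluriharmonic. Only
then does the Sobolev norm of the differences reduce to `sobMap`, which dominates the L² norm, and
closedness of RP in L² applies. -/
lemma isClosedInSobolev_sobolevRealPluriharmonic (hn : 1 ≤ n) :
    IsClosedInSobolev (halfQ n) (sobolevRealPluriharmonic n) := by
  refine ⟨inf_le_left, fun F hF h => ⟨hF, ?_⟩⟩
  have hP : F ∈ pluriharmonic n := by
    refine mem_pluriharmonic_of_compNorm fun j k => ?_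
    refine le_antisymm (le_of_forall_pos_lt_add fun ε hε => ?_) (norm_nonneg _)
    obtain ⟨G, hG, hFG⟩ := h (ε / 2 ^ (n + 1)) (by positivity)
    have h1 := compNorm_le_sobolevNorm hn (sub_mem hF hG.1) (j + 1) (k + 1)
    have h2 : compNorm (j + 1) (k + 1) (F - G) = compNorm (j + 1) (k + 1) F := by
      have := compNorm_eq_zero_of_mem_pluriharmonic (j := j) (k := k) hG.2.1
      rw [compNorm, norm_eq_zero] at this
      rw [compNorm, map_sub, this, sub_zero, compNorm]
    rw [h2] at h1
    rw [lt_div_iff₀ (by positivity)] at hFG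
    linarith
  have : F ∈ closure (realPluriharmonic n : Set (L2 n)) := by
    rw [Metric.mem_closure_iff]
    intro ε hε
    obtain ⟨G, hG, hFG⟩ := h (ε / 2 ^ (n + 1)) (by positivity)
    refine ⟨G, hG.2, ?_⟩
    have hs : F - G ∈ pluriharmonic n := sub_mem hP hG.2.1
    have hd : F - G ∈ sobDom n := (mem_sobolev_iff hs).mp (sub_mem hF hG.1)
    have h1 := norm_le_sobMap hn hs hd
    rw [← sobolevNorm_eq hs] at h1
    rw [dist_eq_norm]
    rw [lt_div_iff₀ (by positivity)] at hFG
    linarith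
  rwa [isClosed_realPluriharmonic.closure_eq] at this

/-! ### The quadratic form of the conditional intertwinor -/

lemma condForm_eq {F : L2 n} (h : F ∈ lamDom n) : condForm F = ‖lamMap n ⟨F, h⟩‖ ^ 2 := by
  have hs := hasSum_norm_wMap_sq (P := comp) (w := lamWeight n) ⟨F, h⟩
  -- Folding ℤ onto ℕ counts the index 0 twice, which is harmless because its eigenvalue vanishes.
  have h1 := hs.nat_add_neg
  simp only [lamWeight_zero, NNReal.coe_zero, zero_mul, add_zero] at h1
  rw [← h1.tsum_eq, condForm]
  refine tsum_congr fun j => ?_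
  rw [coe_lamWeight, coe_lamWeight, compNorm_natCast, compNorm_neg_natCast, Int.natAbs_neg,
    Int.natAbs_natCast, mul_add]

/-! ### Power series with values in a closed subspace -/

/-- In the quotient X / V the power series sums to zero near the origin, so uniqueness of power
series kills the class of every coefficient. -/
lemma mem_of_hasSum_pow_smul {X : Type*} [NormedAddCommGroup X] [NormedSpace ℝ X]
    (V : Submodule ℝ X) (hV : IsClosed (V : Set X)) (a : ℕ → X) {ρ : ℝ} (hρ : 0 < ρ)
    (h : ∀ r : ℝ, |r| < ρ → ∃ x ∈ V, HasSum (fun k => r ^ k • a k) x) (k : ℕ) : a k ∈ V := by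
  have : IsClosed (V : Set X) := hV
  let π : X →L[ℝ] X ⧸ V := V.mkQL
  let p : FormalMultilinearSeries ℝ ℝ (X ⧸ V) :=
    fun k => ContinuousMultilinearMap.mkPiRing ℝ (Fin k) (π (a k))
  have hc : ∀ k, p.coeff k = π (a k) := by
    intro k
    simp [p, FormalMultilinearSeries.coeff]
  have hp : HasFPowerSeriesAt (0 : ℝ → X ⧸ V) p 0 := by
    rw [hasFPowerSeriesAt_iff]
    filter_upwards [Metric.ball_mem_nhds (0 : ℝ) hρ] with r hr
    rw [mem_ball_zero_iff, Real.norm_eq_abs] at hr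
    obtain ⟨x, hx, hs⟩ := h r hr
    have h1 := hs.mapL π
    have h2 : π x = 0 := (Submodule.Quotient.mk_eq_zero V).mpr hx
    rw [h2] at h1
    simpa [hc] using h1
  have h0 : π (a k) = 0 := by
    rw [← hc, hp.eq_zero]
    rfl
  exact (Submodule.Quotient.mk_eq_zero V).mp h0

/-! ### The logarithmic kernel -/

lemma norm_inner_lt_one {p : CSpace n} (hp : ‖p‖ < 1) (ζ : Sph n) :
    ‖inner ℂ p (ζ : CSpace n)‖ < 1 := by
  refine (norm_inner_le_norm _ _).trans_lt ?_
  rwa [norm_eq_of_mem_sphere, mul_one]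

lemma one_sub_inner_ne_zero {p : CSpace n} (hp : ‖p‖ < 1) (ζ : Sph n) :
    1 - inner ℂ p (ζ : CSpace n) ≠ 0 := by
  intro h
  have := norm_inner_lt_one hp ζ
  rw [← sub_eq_zero.mp h, norm_one] at this
  exact lt_irrefl _ this

/-- The function `ζ ↦ -log |1 - ⟨p, ζ⟩|`. -/
def logKer (p : CSpace n) (hp : ‖p‖ < 1) : C(Sph n, ℂ) where
  toFun ζ := ((-Real.log ‖1 - inner ℂ p (ζ : CSpace n)‖ : ℝ) : ℂ)
  continuous_toFun := by
    refine Complex.continuous_ofReal.comp (Continuous.neg (Continuous.log (by fun_prop) ?_))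
    exact fun ζ => norm_ne_zero_iff.mpr (one_sub_inner_ne_zero hp ζ)

/-- The class of `logKer` in `L²`. -/
def kerL2 (p : CSpace n) (hp : ‖p‖ < 1) : L2 n := contL2 n (logKer p hp)

/-- The function `ζ ↦ Re ⟨p, ζ⟩^k`. -/
def reKer (k : ℕ) (p : CSpace n) : C(Sph n, ℂ) where
  toFun ζ := (((inner ℂ p (ζ : CSpace n)) ^ k).re : ℂ)

lemma restrictSph_linPoly_pow (k : ℕ) (p : CSpace n) (ζ : Sph n) :
    restrictSph n (linPoly p ^ k) ζ = (inner ℂ p (ζ : CSpace n)) ^ k := by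
  rw [← evalPoly_eq_restrictSph, map_pow, evalPoly_linPoly]

lemma contL2_reKer (k : ℕ) (p : CSpace n) : contL2 n (reKer k p) = reL2 n (powL2 k p) := by
  apply Lp.ext
  filter_upwards [coeFn_contL2 (reKer k p), coeFn_reL2 (powL2 k p),
    coeFn_contL2 (restrictSph n (linPoly p ^ k))] with ζ h1 h2 h3
  rw [h1, h2, powL2, toL2_apply, h3, restrictSph_linPoly_pow]
  rfl

/-- The real part of the Taylor series of -log(1 - z) at z = ⟨p, ζ⟩, uniformly in ζ since |z| ≤ |p|
< 1. The term k = 0 vanishes because 1 / 0 = 0. -/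
lemma hasSum_logKer (p : CSpace n) (hp : ‖p‖ < 1) :
    HasSum (fun k : ℕ => ((1 / k : ℝ) : ℂ) • reKer k p) (logKer p hp) := by
  have hs : Summable (fun k : ℕ => ((1 / k : ℝ) : ℂ) • reKer k p) := by
    refine Summable.of_norm_bounded (g := fun k => ‖p‖ ^ k)
      (summable_geometric_of_lt_one (norm_nonneg _) hp) fun k => ?_
    rw [ContinuousMap.norm_le _ (by positivity)]
    intro ζ
    change ‖((1 / k : ℝ) : ℂ) * (((inner ℂ p (ζ : CSpace n)) ^ k).re : ℂ)‖ ≤ _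
    rw [norm_mul, Complex.norm_real, Complex.norm_real]
    have h1 : ‖(1 / k : ℝ)‖ ≤ 1 := by
      rw [Real.norm_of_nonneg (by positivity)]
      rcases k with _ | k
      · simp
      · rw [div_le_one (by positivity)]
        push_cast
        linarith [(Nat.cast_nonneg k : (0 : ℝ) ≤ k)]
    have h2 : ‖((inner ℂ p (ζ : CSpace n)) ^ k).re‖ ≤ ‖p‖ ^ k := by
      refine (Complex.abs_re_le_norm _).trans ?_
      rw [norm_pow]
      refine pow_le_pow_left₀ (norm_nonneg _) ?_ k
      refine (norm_inner_le_norm _ _).trans ?_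
      rw [norm_eq_of_mem_sphere, mul_one]
    calc _ ≤ 1 * ‖p‖ ^ k := mul_le_mul h1 h2 (norm_nonneg _) zero_le_one
      _ = _ := one_mul _
  have he : ∑' k : ℕ, ((1 / k : ℝ) : ℂ) • reKer k p = logKer p hp := by
    ext ζ
    have h1 := (ContinuousMap.evalCLM ℂ ζ).hasSum hs.hasSum
    have h2 := Complex.hasSum_taylorSeries_neg_log (norm_inner_lt_one hp ζ)
    have h3 := (Complex.ofRealCLM.comp Complex.reCLM).hasSum h2
    have h4 : HasSum (fun k : ℕ => (((1 / k : ℝ) : ℂ) • reKer k p) ζ) (logKer p hp ζ) := by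
      convert h3 using 1
      · funext k
        change ((1 / k : ℝ) : ℂ) * (((inner ℂ p (ζ : CSpace n)) ^ k).re : ℂ) =
          (((inner ℂ p (ζ : CSpace n)) ^ k / (k : ℂ)).re : ℂ)
        rw [Complex.div_natCast_re]
        push_cast
        ring
      · change _ = (((-Complex.log (1 - inner ℂ p (ζ : CSpace n))).re : ℝ) : ℂ)
        rw [Complex.neg_re, Complex.log_re]
        rfl
    exact h1.unique h4
  rw [← he]
  exact hs.hasSum

lemma hasSum_kerL2 (p : CSpace n) (hp : ‖p‖ < 1) :
    HasSum (fun k : ℕ => ((1 / k : ℝ) : ℂ) • reL2 n (powL2 k p)) (kerL2 p hp) := by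
  have h := (hasSum_logKer p hp).mapL (contL2 n)
  simp only [map_smul, contL2_reKer] at h
  exact h

lemma conjL2_kerL2 (p : CSpace n) (hp : ‖p‖ < 1) : conjL2 n (kerL2 p hp) = kerL2 p hp := by
  rw [kerL2, conjL2_contL2]
  congr 1
  ext ζ
  exact Complex.conj_ofReal _

/-- The constant function `1`. -/
def oneL2 (n : ℕ) : L2 n := toL2 n 1

lemma powL2_zero (p : CSpace n) : powL2 0 p = oneL2 n := by rw [powL2, pow_zero, oneL2]

lemma coeFn_oneL2 : oneL2 n =ᵐ[surf n] fun _ => 1 := by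
  filter_upwards [coeFn_contL2 (restrictSph n 1)] with ζ h
  rw [oneL2, toL2_apply, h, map_one, ContinuousMap.one_apply]

lemma oneL2_mem : oneL2 n ∈ harmZ n 0 := by
  have h := powL2_mem 0 (0 : CSpace n)
  rw [powL2_zero, ← harmZ_natCast] at h
  exact h

lemma conjL2_oneL2 : conjL2 n (oneL2 n) = oneL2 n := by
  rw [oneL2, conjL2_toL2, map_one]

lemma oneL2_mem_realPluriharmonic : oneL2 n ∈ realPluriharmonic n :=
  mem_realPluriharmonic.mpr ⟨harmZ_le_pluriharmonic 0 oneL2_mem, conjL2_oneL2⟩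

lemma powL2_mem_harmZ (k : ℕ) (p : CSpace n) : powL2 k p ∈ harmZ n k := by
  rw [harmZ_natCast]; exact powL2_mem k p

lemma conjL2_mem_harmZ {m : ℤ} {F : L2 n} (hF : F ∈ harmZ n m) : conjL2 n F ∈ harmZ n (-m) := by
  unfold harmZ at hF ⊢
  rw [neg_neg]
  exact conjL2_mem_harm hF

lemma reL2_powL2_mem (k : ℕ) (p : CSpace n) : reL2 n (powL2 k p) ∈ realPluriharmonic n :=
  reL2_mem_realPluriharmonic (harmZ_le_pluriharmonic k (powL2_mem_harmZ k p))

lemma ofReal_smul_eq (r : ℝ) (F : L2 n) : (r : ℂ) • F = r • F := by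
  apply Lp.ext
  filter_upwards [Lp.coeFn_smul (r : ℂ) F, Lp.coeFn_smul r F] with ζ h1 h2
  rw [h1, h2]
  simp

lemma hasSum_kerL2_real (p : CSpace n) (hp : ‖p‖ < 1) :
    HasSum (fun k : ℕ => (1 / k : ℝ) • reL2 n (powL2 k p)) (kerL2 p hp) := by
  simpa only [ofReal_smul_eq] using hasSum_kerL2 p hp

/-! ### Weighted norms of the components -/

lemma mem_wDom_of_mem_harmZ {w : ℤ → NNReal} {m : ℤ} {F : L2 n} (hF : F ∈ harmZ n m) :
    ∃ h : F ∈ wDom comp w, ‖wMap comp w ⟨F, h⟩‖ ^ 2 = w m * ‖F‖ ^ 2 := by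
  have h1 : HasSum (fun i => (w i : ℝ) * ‖comp i F‖ ^ 2) (w m * ‖F‖ ^ 2) := by
    have := hasSum_single (f := fun i => (w i : ℝ) * ‖comp i F‖ ^ 2) m fun m' hne => by
      rw [comp_eq_zero hne hF]; simp
    rwa [comp_eq_self hF] at this
  exact ⟨mem_wDom.mpr h1.summable, (hasSum_norm_wMap_sq ⟨F, _⟩).unique h1⟩

/-- Conjugation exchanges the components m and -m, which an even weight does not see. -/
lemma conjL2_mem_wDom {w : ℤ → NNReal} (hw : ∀ m, w (-m) = w m) {F : L2 n} (hF : F ∈ wDom comp w) :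
    ∃ h : conjL2 n F ∈ wDom comp w, ‖wMap comp w ⟨conjL2 n F, h⟩‖ = ‖wMap comp w ⟨F, hF⟩‖ := by
  have h1 := hasSum_norm_wMap_sq (P := comp) (w := w) ⟨F, hF⟩
  rw [← (Equiv.neg ℤ).hasSum_iff] at h1
  have h2 : HasSum (fun i => (w i : ℝ) * ‖comp i (conjL2 n F)‖ ^ 2) (‖wMap comp w ⟨F, hF⟩‖ ^ 2) := by
    convert h1 using 1
    funext i
    simp only [Function.comp, Equiv.neg_apply, hw, comp_conjL2, norm_conjL2]
  refine ⟨mem_wDom.mpr h2.summable, ?_⟩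
  have h3 := (hasSum_norm_wMap_sq (P := comp) (w := w) ⟨conjL2 n F, mem_wDom.mpr h2.summable⟩).unique h2
  exact (sq_eq_sq₀ (norm_nonneg _) (norm_nonneg _)).mp h3

lemma reL2_mem_wDom {w : ℤ → NNReal} (hw : ∀ m, w (-m) = w m) {F : L2 n} (hF : F ∈ wDom comp w) :
    ∃ h : reL2 n F ∈ wDom comp w, ‖wMap comp w ⟨reL2 n F, h⟩‖ ≤ ‖wMap comp w ⟨F, hF⟩‖ := by
  obtain ⟨h, hn⟩ := conjL2_mem_wDom hw hF
  have e := reL2_eq F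
  have hm : reL2 n F ∈ wDom comp w := by
    rw [e]; exact Submodule.smul_mem _ _ (add_mem hF h)
  refine ⟨hm, ?_⟩
  have e2 : (⟨reL2 n F, hm⟩ : wDom comp w) = (1 / 2 : ℂ) • (⟨F, hF⟩ + ⟨conjL2 n F, h⟩) :=
    Subtype.ext e
  rw [e2, map_smul, map_add, norm_smul]
  have := norm_add_le (wMap comp w ⟨F, hF⟩) (wMap comp w ⟨conjL2 n F, h⟩)
  rw [hn] at this
  norm_num
  linarith

lemma sobWeight_neg (m : ℤ) : sobWeight n (-m) = sobWeight n m := by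
  rw [sobWeight, sobWeight, Int.natAbs_neg]

lemma lamWeight_neg (m : ℤ) : lamWeight n (-m) = lamWeight n m := by
  rw [lamWeight, lamWeight, Int.natAbs_neg]

/-- Each of the n + 1 factors is at most |m| + n, and |m| + n ≤ 4 (|m| + n/2)(n/2) when n ≥ 1. -/
lemma lamWeight_le (hn : 1 ≤ n) (m : ℤ) : (lamWeight n m : ℝ) ≤ 4 ^ (n + 1) * sobWeight n m := by
  have hn' : (1 : ℝ) ≤ n := by exact_mod_cast hn
  have hj : (0 : ℝ) ≤ m.natAbs := Nat.cast_nonneg _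
  have h1 : (lamWeight n m : ℝ) ≤ ((m.natAbs : ℝ) + n) ^ (n + 1) := by
    rw [coe_lamWeight, eigenvalueQ]
    refine (Finset.prod_le_prod (g := fun _ => (m.natAbs : ℝ) + n) (fun _ _ => by positivity)
      fun l hl => ?_).trans_eq (by simp)
    have : (l : ℝ) ≤ n := by exact_mod_cast Nat.lt_succ_iff.mp (Finset.mem_range.mp hl)
    linarith
  refine h1.trans ?_
  simp only [sobWeight, NNReal.coe_pow, NNReal.coe_mul, NNReal.coe_add, NNReal.coe_natCast,
    NNReal.coe_div, NNReal.coe_ofNat]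
  rw [← mul_pow]
  refine pow_le_pow_left₀ (by positivity) ?_ _
  nlinarith

/-- The added 1 is needed at m = 0, where the eigenvalue vanishes. With `lamWeight_le` it makes the
form norm together with the L² norm equivalent to the Sobolev norm on pluriharmonic functions. -/
lemma sobWeight_le (m : ℤ) :
    (sobWeight n m : ℝ) ≤ ((1 + n / 2) * (n / 2)) ^ (n + 1) * (lamWeight n m + 1) := by
  simp only [sobWeight, NNReal.coe_pow, NNReal.coe_mul, NNReal.coe_add, NNReal.coe_natCast,
    NNReal.coe_div, NNReal.coe_ofNat]
  have hn0 : (0 : ℝ) ≤ n := Nat.cast_nonneg _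
  rcases Nat.eq_zero_or_pos m.natAbs with h0 | hpos
  · rw [h0]
    have h1 : (((0 : ℕ) : ℝ) + n / 2) * (n / 2) ≤ (1 + n / 2) * (n / 2) := by
      refine mul_le_mul_of_nonneg_right ?_ (by positivity)
      simp
    calc _ ≤ ((1 + (n : ℝ) / 2) * (n / 2)) ^ (n + 1) * 1 := by
          rw [mul_one]; exact pow_le_pow_left₀ (by positivity) h1 _
      _ ≤ _ := mul_le_mul_of_nonneg_left (by simp) (by positivity)
  · have hj : (1 : ℝ) ≤ m.natAbs := by exact_mod_cast hpos
    have h1 : ((m.natAbs : ℝ)) ^ (n + 1) ≤ lamWeight n m := by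
      rw [coe_lamWeight, eigenvalueQ]
      calc _ = ∏ _l ∈ Finset.range (n + 1), (m.natAbs : ℝ) := by simp
        _ ≤ _ := Finset.prod_le_prod (fun _ _ => by positivity) fun l _ => by simp
    have h2 : ((m.natAbs : ℝ) + n / 2) * (n / 2) ≤ ((1 + n / 2) * (n / 2)) * m.natAbs := by
      nlinarith [mul_nonneg hn0 hn0, mul_nonneg (mul_nonneg hn0 hn0) (sub_nonneg.mpr hj)]
    calc _ ≤ (((1 + (n : ℝ) / 2) * (n / 2)) * m.natAbs) ^ (n + 1) :=
          pow_le_pow_left₀ (by positivity) h2 _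
      _ = ((1 + (n : ℝ) / 2) * (n / 2)) ^ (n + 1) * (m.natAbs : ℝ) ^ (n + 1) := mul_pow _ _ _
      _ ≤ _ := mul_le_mul_of_nonneg_left (by linarith) (by positivity)

lemma mem_lamDom_of_mem_sobDom (hn : 1 ≤ n) {F : L2 n} (hF : F ∈ sobDom n) :
    ∃ h : F ∈ lamDom n, ‖lamMap n ⟨F, h⟩‖ ^ 2 ≤ 4 ^ (n + 1) * ‖sobMap n ⟨F, hF⟩‖ ^ 2 := by
  have h1 := (hasSum_norm_wMap_sq (P := comp) (w := sobWeight n) ⟨F, hF⟩).mul_left (4 ^ (n + 1))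
  have hle : ∀ m, (lamWeight n m : ℝ) * ‖comp m F‖ ^ 2 ≤
      4 ^ (n + 1) * ((sobWeight n m : ℝ) * ‖comp m F‖ ^ 2) := fun m => by
    rw [← mul_assoc]
    exact mul_le_mul_of_nonneg_right (lamWeight_le hn m) (sq_nonneg _)
  have hF' : F ∈ lamDom n :=
    mem_wDom.mpr (Summable.of_nonneg_of_le (fun m => by positivity) hle h1.summable)
  exact ⟨hF', hasSum_le hle (hasSum_norm_wMap_sq ⟨F, hF'⟩) h1⟩

lemma mem_sobDom_of_mem_lamDom {F : L2 n} (hP : F ∈ pluriharmonic n) (hF : F ∈ lamDom n) :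
    ∃ h : F ∈ sobDom n, ‖sobMap n ⟨F, h⟩‖ ^ 2 ≤
      ((1 + n / 2) * (n / 2)) ^ (n + 1) * (‖lamMap n ⟨F, hF⟩‖ ^ 2 + ‖F‖ ^ 2) := by
  have h1 := ((hasSum_norm_wMap_sq (P := comp) (w := lamWeight n) ⟨F, hF⟩).add
    (hasSum_norm_comp_sq hP)).mul_left (((1 + (n : ℝ) / 2) * (n / 2)) ^ (n + 1))
  have hle : ∀ m, (sobWeight n m : ℝ) * ‖comp m F‖ ^ 2 ≤ ((1 + (n : ℝ) / 2) * (n / 2)) ^ (n + 1) *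
      ((lamWeight n m : ℝ) * ‖comp m F‖ ^ 2 + ‖comp m F‖ ^ 2) := fun m => by
    have := mul_le_mul_of_nonneg_right (sobWeight_le (n := n) m) (sq_nonneg ‖comp m F‖)
    linarith
  have hF' : F ∈ sobDom n :=
    mem_wDom.mpr (Summable.of_nonneg_of_le (fun m => by positivity) hle h1.summable)
  exact ⟨hF', hasSum_le hle (hasSum_norm_wMap_sq ⟨F, hF'⟩) h1⟩

lemma reproConst_le (j : ℕ) : reproConst n j ≤ surfTotal n := by
  unfold reproConst
  rw [div_le_iff₀ (by positivity)]
  refine mul_le_mul_of_nonneg_left ?_ surfTotal_pos.le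
  exact_mod_cast Nat.le_of_dvd (Nat.factorial_pos _) (Nat.factorial_mul_factorial_dvd_factorial_add n j)

/-- The weight grows polynomially in k. This is what makes the expansions of the kernels converge in
the Sobolev norm and not only in L². -/
lemma summable_sqrt_sobWeight_mul_pow {ρ : ℝ} (h0 : 0 ≤ ρ) (h1 : ρ < 1) :
    Summable fun k : ℕ => Real.sqrt (sobWeight n k) * ρ ^ k := by
  have hs1 := summable_pow_mul_geometric_of_norm_lt_one (n + 1)
    (by rwa [Real.norm_of_nonneg h0] : ‖ρ‖ < 1)
  have hs0 := summable_geometric_of_lt_one h0 h1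
  set c : ℝ := ((n : ℝ) / 2) ^ (n + 1) * 2 ^ n with hc
  refine Summable.of_nonneg_of_le (fun k => by positivity) (fun k => ?_)
    ((hs1.mul_left c).add (hs0.mul_left (1 + c * ((n : ℝ) / 2) ^ (n + 1))))
  have hw : (sobWeight n k : ℝ) ≤ c * ((k : ℝ) ^ (n + 1) + ((n : ℝ) / 2) ^ (n + 1)) := by
    simp only [sobWeight, NNReal.coe_pow, NNReal.coe_mul, NNReal.coe_add, NNReal.coe_natCast,
      NNReal.coe_div, NNReal.coe_ofNat, Int.natAbs_natCast]
    have := add_pow_le (Nat.cast_nonneg k : (0 : ℝ) ≤ k) (by positivity : (0 : ℝ) ≤ (n : ℝ) / 2) (n + 1)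
    rw [mul_pow, mul_comm, hc, mul_assoc]
    exact mul_le_mul_of_nonneg_left this (by positivity)
  have hsq : Real.sqrt (sobWeight n k) ≤ 1 + sobWeight n k := by
    refine Real.sqrt_le_iff.mpr ⟨by positivity, ?_⟩
    nlinarith [(sobWeight n k).2, sq_nonneg (sobWeight n k : ℝ)]
  have hp : 0 ≤ ρ ^ k := by positivity
  calc _ ≤ (1 + c * ((k : ℝ) ^ (n + 1) + ((n : ℝ) / 2) ^ (n + 1))) * ρ ^ k :=
        mul_le_mul_of_nonneg_right (by linarith) hp
    _ = _ := by ring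

lemma norm_powL2_le (k : ℕ) (p : CSpace n) : ‖powL2 k p‖ ≤ Real.sqrt (surfTotal n) * ‖p‖ ^ k := by
  refine (abs_le_of_sq_le_sq' ?_ (by positivity)).2
  rw [norm_powL2_sq, mul_pow, Real.sq_sqrt surfTotal_pos.le, ← pow_mul, mul_comm k 2]
  exact mul_le_mul_of_nonneg_right (reproConst_le k) (by positivity)

lemma reL2_powL2_mem_sobDom (k : ℕ) (p : CSpace n) :
    ∃ h : reL2 n (powL2 k p) ∈ sobDom n, ‖sobMap n ⟨reL2 n (powL2 k p), h⟩‖ ≤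
      Real.sqrt (surfTotal n) * (Real.sqrt (sobWeight n k) * ‖p‖ ^ k) := by
  obtain ⟨h, hn⟩ := mem_wDom_of_mem_harmZ (w := sobWeight n) (powL2_mem_harmZ k p)
  obtain ⟨h', hn'⟩ := reL2_mem_wDom sobWeight_neg h
  refine ⟨h', hn'.trans ((abs_le_of_sq_le_sq' ?_ (by positivity)).2)⟩
  rw [hn, mul_left_comm, mul_pow, Real.sq_sqrt (NNReal.coe_nonneg _)]
  exact mul_le_mul_of_nonneg_left (pow_le_pow_left₀ (norm_nonneg _) (norm_powL2_le k p) 2)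
    (NNReal.coe_nonneg _)

/-- The isometric embedding of `W^{Q/2,2} ∩ RP` into a Hilbert sum. -/
def realSobMap (n : ℕ) : sobolevRealPluriharmonic n →ₗ[ℝ] lp (fun _ : ℤ => L2 n) 2 :=
  wMapReal comp (sobWeight n) (sobolevRealPluriharmonic n)
    fun _ hF => (mem_sobolevRealPluriharmonic.mp hF).2

lemma norm_realSobMap (F : sobolevRealPluriharmonic n) :
    sobolevNorm (halfQ n) (F : L2 n) = ‖realSobMap n F‖ :=
  sobolevNorm_eq F.2.2.1 _

lemma norm_le_realSobMap (hn : 1 ≤ n) (F : sobolevRealPluriharmonic n) :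
    ‖(F : L2 n)‖ ≤ 2 ^ (n + 1) * ‖realSobMap n F‖ :=
  norm_le_sobMap hn F.2.2.1 _

lemma hasSum_realSobMap {κ : Type*} {a : κ → sobolevRealPluriharmonic n} {F : L2 n}
    (h : HasSum (fun k => (a k : L2 n)) F) (hs : Summable fun k => ‖realSobMap n (a k)‖) :
    ∃ hF : F ∈ sobolevRealPluriharmonic n,
      HasSum (fun k => realSobMap n (a k)) (realSobMap n ⟨F, hF⟩) := by
  obtain ⟨hF, hs'⟩ := hasSum_wMapReal h hs
  have hR : F ∈ realPluriharmonic n :=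
    isClosed_realPluriharmonic.mem_of_tendsto h
      (Filter.Eventually.of_forall fun _ => Submodule.sum_mem _ fun k _ => (a k).2.2)
  exact ⟨mem_sobolevRealPluriharmonic.mpr ⟨hR, hF⟩, hs'⟩

/-- `ζ ↦ Re ⟨p, ζ⟩^k` as an element of `W^{Q/2,2} ∩ RP`. -/
def rePow (k : ℕ) (p : CSpace n) : sobolevRealPluriharmonic n :=
  ⟨reL2 n (powL2 k p), mem_sobolevRealPluriharmonic.mpr
    ⟨reL2_powL2_mem k p, (reL2_powL2_mem_sobDom k p).1⟩⟩

lemma norm_realSobMap_rePow_le (k : ℕ) (p : CSpace n) : ‖realSobMap n (rePow k p)‖ ≤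
    Real.sqrt (surfTotal n) * (Real.sqrt (sobWeight n k) * ‖p‖ ^ k) :=
  (reL2_powL2_mem_sobDom k p).2

/-- The constant `1` as an element of `W^{Q/2,2} ∩ RP`. -/
def oneSob (n : ℕ) : sobolevRealPluriharmonic n :=
  ⟨oneL2 n, mem_sobolevRealPluriharmonic.mpr
    ⟨oneL2_mem_realPluriharmonic, (mem_wDom_of_mem_harmZ oneL2_mem).1⟩⟩

lemma summable_norm_rePow {p : CSpace n} (hp : ‖p‖ < 1) :
    Summable fun k : ℕ => ‖realSobMap n (rePow k p)‖ :=
  Summable.of_nonneg_of_le (fun _ => norm_nonneg _) (fun k => norm_realSobMap_rePow_le k p)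
    ((summable_sqrt_sobWeight_mul_pow (norm_nonneg _) hp).mul_left _)

lemma one_div_natCast_le_one (k : ℕ) : |(1 / k : ℝ)| ≤ 1 := by
  rw [abs_of_nonneg (by positivity)]
  rcases k with _ | k
  · simp
  · rw [div_le_one (by positivity)]
    push_cast
    linarith [(Nat.cast_nonneg k : (0 : ℝ) ≤ k)]

lemma hasSum_realSobMap_kerL2 (p : CSpace n) (hp : ‖p‖ < 1) :
    ∃ hF : kerL2 p hp ∈ sobolevRealPluriharmonic n,
      HasSum (fun k : ℕ => realSobMap n ((1 / k : ℝ) • rePow k p)) (realSobMap n ⟨kerL2 p hp, hF⟩) := by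
  refine hasSum_realSobMap (a := fun k : ℕ => (1 / k : ℝ) • rePow k p) (hasSum_kerL2_real p hp)
    (Summable.of_nonneg_of_le (fun _ => norm_nonneg _) (fun k => ?_) (summable_norm_rePow hp))
  rw [map_smul, norm_smul, Real.norm_eq_abs]
  exact mul_le_of_le_one_left (norm_nonneg _) (one_div_natCast_le_one k)

lemma kerL2_mem_sobolev (p : CSpace n) (hp : ‖p‖ < 1) : kerL2 p hp ∈ sobolevRealPluriharmonic n :=
  (hasSum_realSobMap_kerL2 p hp).1

/-- The function `-log |1 - ⟨p, ζ⟩| + ½ log (1 - |p|²)`. -/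
def normKer (p : CSpace n) (hp : ‖p‖ < 1) : L2 n :=
  kerL2 p hp + (1 / 2 * Real.log (1 - ‖p‖ ^ 2)) • oneL2 n

/-- The coefficients of the expansion of `normKer (r • p)` in powers of `r`. -/
def normKerCoeff (k : ℕ) (p : CSpace n) : sobolevRealPluriharmonic n :=
  (1 / k : ℝ) • rePow k p - ((1 + (-1) ^ k) / 2 * (‖p‖ ^ k / k)) • oneSob n

lemma powL2_smul (k : ℕ) (c : ℂ) (p : CSpace n) :
    powL2 k (c • p) = (starRingEnd ℂ c) ^ k • powL2 k p := by
  have : linPoly (c • p) = starRingEnd ℂ c • linPoly p := by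
    simp [linPoly, Finset.smul_sum, smul_smul]
  rw [powL2, this, smul_pow, map_smul, powL2]

lemma reL2_smul_real (r : ℝ) (F : L2 n) : reL2 n ((r : ℂ) • F) = r • reL2 n F := by
  rw [ofReal_smul_eq, map_smul]

lemma rePow_real_smul (k : ℕ) (r : ℝ) (p : CSpace n) : rePow k (r • p) = r ^ k • rePow k p := by
  apply Subtype.ext
  change reL2 n (powL2 k (r • p)) = r ^ k • reL2 n (powL2 k p)
  have : r • p = (r : ℂ) • p := by
    ext i; simp
  rw [this, powL2_smul, Complex.conj_ofReal, ← Complex.ofReal_pow, reL2_smul_real]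

/-- The mean of the series of log(1 - x) and log(1 + x). The factor (1 + (-1)^k) / 2 selects the
even exponents, so that this series can be added term by term to that of the kernel. -/
lemma hasSum_half_log {x : ℝ} (hx : |x| < 1) :
    HasSum (fun k : ℕ => -((1 + (-1) ^ k) / 2 * (x ^ k / k))) (1 / 2 * Real.log (1 - x ^ 2)) := by
  have aux : ∀ {y : ℝ}, |y| < 1 → HasSum (fun k : ℕ => y ^ k / k) (-Real.log (1 - y)) := by
    intro y hy
    have h := Real.hasSum_pow_div_log_of_abs_lt_one hy
    rw [← hasSum_nat_add_iff' 1]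
    simpa using h
  have h1 := aux hx
  have h2 := aux (y := -x) (by rwa [abs_neg])
  have h3 := (h1.add h2).mul_left (-(1 / 2))
  rw [abs_lt] at hx
  have e : 1 / 2 * Real.log (1 - x ^ 2) = -(1 / 2) * (-Real.log (1 - x) + -Real.log (1 - -x)) := by
    rw [show 1 - x ^ 2 = (1 - x) * (1 - -x) by ring, Real.log_mul (by linarith) (by linarith)]
    ring
  rw [e]
  refine h3.congr_fun fun k => ?_
  rw [neg_pow x k]
  ring

lemma hasSum_normKer {p : CSpace n} (hp : ‖p‖ ≤ 1) {r : ℝ} (hr : |r| < 1) (h : ‖r • p‖ < 1) :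
    HasSum (fun k : ℕ => ((r ^ k • normKerCoeff k p : sobolevRealPluriharmonic n) : L2 n))
      (normKer (r • p) h) := by
  have hx : |r * ‖p‖| < 1 := by
    rw [abs_mul, abs_norm]
    calc _ ≤ |r| * 1 := mul_le_mul_of_nonneg_left hp (abs_nonneg _)
      _ < 1 := by rwa [mul_one]
  have h1 := hasSum_kerL2_real (r • p) h
  have h2 := (hasSum_half_log hx).smul_const (oneL2 n)
  have h3 := h1.add h2
  have e : normKer (r • p) h = kerL2 (r • p) h +
      (1 / 2 * Real.log (1 - (r * ‖p‖) ^ 2)) • oneL2 n := by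
    rw [normKer, norm_smul, mul_pow, mul_pow, Real.norm_eq_abs, sq_abs]
  rw [e]
  convert h3 using 1
  funext k
  have e2 : reL2 n (powL2 k (r • p)) = r ^ k • reL2 n (powL2 k p) :=
    congrArg Subtype.val (rePow_real_smul k r p)
  rw [e2]
  change r ^ k • ((1 / k : ℝ) • reL2 n (powL2 k p) -
    ((1 + (-1) ^ k) / 2 * (‖p‖ ^ k / k)) • oneL2 n) = _
  rw [mul_pow]
  module

lemma summable_norm_normKer {p : CSpace n} (hp : ‖p‖ ≤ 1) {r : ℝ} (hr : |r| < 1) :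
    Summable fun k : ℕ => ‖realSobMap n (r ^ k • normKerCoeff k p)‖ := by
  have hs := summable_sqrt_sobWeight_mul_pow (n := n) (abs_nonneg r) hr
  have hs0 := summable_geometric_of_lt_one (abs_nonneg r) hr
  refine Summable.of_nonneg_of_le (fun _ => norm_nonneg _) (fun k => ?_)
    ((hs.mul_left (Real.sqrt (surfTotal n))).add (hs0.mul_left ‖realSobMap n (oneSob n)‖))
  have hpk : ‖p‖ ^ k ≤ 1 := pow_le_one₀ (norm_nonneg _) hp
  have b1 : ‖realSobMap n ((1 / k : ℝ) • rePow k p)‖ ≤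
      Real.sqrt (surfTotal n) * Real.sqrt (sobWeight n k) := by
    rw [map_smul, norm_smul, Real.norm_eq_abs]
    refine (mul_le_of_le_one_left (norm_nonneg _) (one_div_natCast_le_one k)).trans ?_
    refine (norm_realSobMap_rePow_le k p).trans ?_
    refine mul_le_mul_of_nonneg_left ?_ (Real.sqrt_nonneg _)
    exact mul_le_of_le_one_right (Real.sqrt_nonneg _) hpk
  have b2 : ‖realSobMap n (((1 + (-1) ^ k) / 2 * (‖p‖ ^ k / k)) • oneSob n)‖ ≤
      ‖realSobMap n (oneSob n)‖ := by
    rw [map_smul, norm_smul, Real.norm_eq_abs, abs_mul]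
    refine mul_le_of_le_one_left (norm_nonneg _) ?_
    have c1 : |((1 + (-1) ^ k) / 2 : ℝ)| ≤ 1 := by
      rcases neg_one_pow_eq_or ℝ k with h | h <;> rw [h] <;> norm_num
    have c2 : |‖p‖ ^ k / k| ≤ 1 := by
      rw [div_eq_mul_one_div, abs_mul, abs_of_nonneg (by positivity : 0 ≤ ‖p‖ ^ k)]
      exact mul_le_one₀ hpk (abs_nonneg _) (one_div_natCast_le_one k)
    exact mul_le_one₀ c1 (abs_nonneg _) c2
  rw [map_smul, norm_smul, normKerCoeff, map_sub, norm_pow, Real.norm_eq_abs]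
  have := norm_sub_le (realSobMap n ((1 / k : ℝ) • rePow k p))
    (realSobMap n (((1 + (-1) ^ k) / 2 * (‖p‖ ^ k / k)) • oneSob n))
  calc _ ≤ |r| ^ k * (Real.sqrt (surfTotal n) * Real.sqrt (sobWeight n k) +
        ‖realSobMap n (oneSob n)‖) :=
        mul_le_mul_of_nonneg_left (this.trans (add_le_add b1 b2)) (by positivity)
    _ = _ := by ring

/-! ### Minimality -/

lemma exists_norm_eq_one (n : ℕ) : ∃ p : CSpace n, ‖p‖ = 1 :=
  ⟨EuclideanSpace.single 0 1, by simp⟩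

/-- A subspace that is closed in the Sobolev norm and that contains all the functions `normKer p`
contains `W^{Q/2,2} ∩ RP`. -/
theorem sobolevRealPluriharmonic_le (M : Submodule ℝ (L2 n))
    (hcl : ∀ F ∈ sobolevRealPluriharmonic n,
      (∀ ε : ℝ, 0 < ε → ∃ G ∈ M, sobolevNorm (halfQ n) (F - G) < ε) → F ∈ M)
    (hker : ∀ (p : CSpace n) (hp : ‖p‖ < 1), normKer p hp ∈ M) :
    sobolevRealPluriharmonic n ≤ M := by
  -- V is the closure of the image of M ∩ W^{Q/2,2} ∩ RP in the Hilbert sum. As M is closed in the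
  -- Sobolev norm, membership in V and in M agree for functions of W^{Q/2,2} ∩ RP, so the power
  -- series argument may take place in a Banach space.
  set V : Submodule ℝ (lp (fun _ : ℤ => L2 n) 2) :=
    ((M.comap (sobolevRealPluriharmonic n).subtype).map (realSobMap n)).topologicalClosure with hV
  have hVM : ∀ F : sobolevRealPluriharmonic n, realSobMap n F ∈ V → (F : L2 n) ∈ M := by
    intro F hF
    refine hcl F F.2 fun ε hε => ?_
    obtain ⟨_, ⟨G, hG, rfl⟩, hFG⟩ := Metric.mem_closure_iff.mp hF ε hε
    refine ⟨G, hG, ?_⟩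
    rw [dist_eq_norm, ← map_sub, ← norm_realSobMap] at hFG
    exact hFG
  have hMV : ∀ F : sobolevRealPluriharmonic n, (F : L2 n) ∈ M → realSobMap n F ∈ V := fun F hF =>
    Submodule.le_topologicalClosure _ ⟨F, hF, rfl⟩
  -- the coefficients
  have hcoeff : ∀ (p : CSpace n), ‖p‖ ≤ 1 → ∀ k, (normKerCoeff k p : L2 n) ∈ M := by
    intro p hp k
    apply hVM
    refine mem_of_hasSum_pow_smul V (Submodule.isClosed_topologicalClosure _)
      (fun k => realSobMap n (normKerCoeff k p)) one_pos (fun r hr => ?_) k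
    have hrp : ‖r • p‖ < 1 := by
      rw [norm_smul, Real.norm_eq_abs]
      calc _ ≤ |r| * 1 := mul_le_mul_of_nonneg_left hp (abs_nonneg _)
        _ < 1 := by rwa [mul_one]
    obtain ⟨hF, hs⟩ := hasSum_realSobMap (hasSum_normKer hp hr hrp) (summable_norm_normKer hp hr)
    exact ⟨_, hMV ⟨_, hF⟩ (hker _ hrp), by simpa only [map_smul] using hs⟩
  -- the constants
  have hone : oneL2 n ∈ M := by
    obtain ⟨p, hp⟩ := exists_norm_eq_one n
    have hIp : ‖Complex.I • p‖ = 1 := by rw [norm_smul, Complex.norm_I, one_mul, hp]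
    -- For k = 2 the real parts at p and ip cancel because i² = -1, while the two constants -1/2 add
    -- up to -1.
    have h := M.add_mem (hcoeff p hp.le 2) (hcoeff (Complex.I • p) hIp.le 2)
    have e : ((normKerCoeff 2 p : sobolevRealPluriharmonic n) : L2 n) +
        (normKerCoeff 2 (Complex.I • p) : sobolevRealPluriharmonic n) = (-1 : ℝ) • oneL2 n := by
      change (((1 / (2 : ℕ) : ℝ) • reL2 n (powL2 2 p) -
        ((1 + (-1) ^ 2) / 2 * (‖p‖ ^ 2 / (2 : ℕ)) : ℝ) • oneL2 n) : L2 n) +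
        ((1 / (2 : ℕ) : ℝ) • reL2 n (powL2 2 (Complex.I • p)) -
        ((1 + (-1) ^ 2) / 2 * (‖Complex.I • p‖ ^ 2 / (2 : ℕ)) : ℝ) • oneL2 n) = _
      have e1 : powL2 2 (Complex.I • p) = ((-1 : ℝ) : ℂ) • powL2 2 p := by
        rw [powL2_smul]
        congr 1
        rw [Complex.conj_I, neg_sq, Complex.I_sq]
        simp
      rw [e1, reL2_smul_real, hp, hIp]
      norm_num
      module
    rw [e] at h
    have h2 := M.smul_mem (-1 : ℝ) h
    rwa [smul_smul, neg_one_mul, neg_neg, one_smul] at h2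
  -- the real parts of powers
  have hpow1 : ∀ (k : ℕ) (p : CSpace n), ‖p‖ ≤ 1 → reL2 n (powL2 k p) ∈ M := by
    intro k p hp
    rcases Nat.eq_zero_or_pos k with rfl | hk
    · rw [powL2_zero, reL2_of_conjL2 conjL2_oneL2]
      exact hone
    · have hk' : (k : ℝ) ≠ 0 := by positivity
      have h1 : (1 / k : ℝ) • reL2 n (powL2 k p) - ((1 + (-1) ^ k) / 2 * (‖p‖ ^ k / k)) • oneL2 n ∈ M :=
        hcoeff p hp k
      have h2 := M.add_mem h1 (M.smul_mem ((1 + (-1) ^ k) / 2 * (‖p‖ ^ k / k) : ℝ) hone)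
      rw [sub_add_cancel] at h2
      have h3 := M.smul_mem (k : ℝ) h2
      rwa [smul_smul, mul_one_div_cancel hk', one_smul] at h3
  have hpow : ∀ (k : ℕ) (c : ℂ) (p : CSpace n), reL2 n (c • powL2 k p) ∈ M := by
    intro k c p
    rcases Nat.eq_zero_or_pos k with rfl | hk
    · rw [powL2_zero]
      have : reL2 n (c • oneL2 n) = c.re • oneL2 n := by
        rw [reL2_eq, map_smulₛₗ, conjL2_oneL2, ← add_smul, smul_smul, ← ofReal_smul_eq,
          Complex.re_eq_add_conj]
        congr 1
        ring
      rw [this]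
      exact M.smul_mem _ hone
    · obtain ⟨z, hz⟩ := IsAlgClosed.exists_pow_nat_eq (starRingEnd ℂ c) hk
      have e : c • powL2 k p = powL2 k (z • p) := by
        rw [powL2_smul, ← map_pow, hz, Complex.conj_conj]
      rw [e]
      set q := z • p
      rcases eq_or_ne q 0 with h0 | h0
      · rw [h0]; exact hpow1 k 0 (by simp)
      · have h1 := hpow1 k (‖q‖⁻¹ • q) (by rw [norm_smul, norm_inv, norm_norm,
          inv_mul_cancel₀ (norm_ne_zero_iff.mpr h0)])
        have h2 := congrArg Subtype.val (rePow_real_smul k ‖q‖ (‖q‖⁻¹ • q))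
        rw [smul_smul, mul_inv_cancel₀ (norm_ne_zero_iff.mpr h0), one_smul] at h2
        change reL2 n (powL2 k q) = ‖q‖ ^ k • reL2 n (powL2 k (‖q‖⁻¹ • q)) at h2
        rw [h2]
        exact M.smul_mem _ h1
  have hharm : ∀ (k : ℕ) (F : L2 n), F ∈ harm n k 0 → reL2 n F ∈ M := by
    intro k F hF
    -- The real part is only real-linear; allowing a complex factor makes the claim stable under
    -- complex spans.
    have : ∀ c : ℂ, reL2 n (c • F) ∈ M := by
      refine Submodule.span_induction (p := fun F _ => ∀ c : ℂ, reL2 n (c • F) ∈ M) ?_ ?_ ?_ ?_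
        (harm_le_span_powL2 k hF)
      · rintro _ ⟨p, rfl⟩ c
        exact hpow k c p
      · intro c
        rw [smul_zero, map_zero]
        exact M.zero_mem
      · intro F G _ _ h1 h2 c
        rw [smul_add, map_add]
        exact M.add_mem (h1 c) (h2 c)
      · intro a F _ h c
        rw [smul_smul]
        exact h _
    simpa using this 1
  have hharmZ : ∀ (m : ℤ) (F : L2 n), F ∈ harmZ n m → reL2 n F ∈ M := by
    intro m F hF
    obtain ⟨j, rfl | rfl⟩ := m.eq_nat_or_neg
    · rw [harmZ_natCast] at hF
      exact hharm j F hF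
    · rw [harmZ_neg_natCast] at hF
      rw [← reL2_conjL2]
      exact hharm j _ (conjL2_mem_harm hF)
  -- truncation
  intro F hF
  obtain ⟨hR, hS⟩ := mem_sobolevRealPluriharmonic.mp hF
  obtain ⟨hP, hc⟩ := mem_realPluriharmonic.mp hR
  refine hcl F hF fun ε hε => ?_
  have hsingle : ∀ m, ∃ h : comp m F ∈ sobDom n,
      lp.single 2 m (sobMap n ⟨F, hS⟩ m) = sobMap n ⟨comp m F, h⟩ := by
    intro m
    exact ⟨(mem_wDom_of_mem_harmZ (comp_mem m F)).1, single_wMap hS _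
      (comp_eq_self (comp_mem m F)) fun i hi => comp_eq_zero hi (comp_mem m F)⟩
  have hsum := lp.hasSum_single (p := 2) (by norm_num) (sobMap n ⟨F, hS⟩)
  obtain ⟨s, hs⟩ := (Metric.tendsto_nhds.mp hsum ε hε).exists
  choose hmem hval using hsingle
  have hTmem : ∑ m ∈ s, comp m F ∈ sobDom n := Submodule.sum_mem _ fun m _ => hmem m
  have hT : ∑ m ∈ s, lp.single 2 m (sobMap n ⟨F, hS⟩ m) = sobMap n ⟨∑ m ∈ s, comp m F, hTmem⟩ := by
    rw [Finset.sum_congr rfl fun m _ => hval m, ← map_sum]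
    congr 1
    apply Subtype.ext
    simp
  -- The truncation need not be real. Taking its real part does not increase the distance to the
  -- real function F.
  refine ⟨reL2 n (∑ m ∈ s, comp m F), ?_, ?_⟩
  · rw [map_sum]
    exact Submodule.sum_mem _ fun m _ => hharmZ m _ (comp_mem m F)
  · have e : F - reL2 n (∑ m ∈ s, comp m F) = reL2 n (F - ∑ m ∈ s, comp m F) := by
      rw [map_sub, reL2_of_conjL2 hc]
    have hd : F - ∑ m ∈ s, comp m F ∈ sobDom n := sub_mem hS hTmem
    obtain ⟨h1, h2⟩ := reL2_mem_wDom sobWeight_neg hd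
    have hPd : F - ∑ m ∈ s, comp m F ∈ pluriharmonic n :=
      sub_mem hP (Submodule.sum_mem _ fun m _ => harmZ_le_pluriharmonic m (comp_mem m F))
    rw [e, sobolevNorm_eq (reL2_mem_realPluriharmonic hPd).1 h1]
    refine h2.trans_lt ?_
    rw [dist_eq_norm, hT, norm_sub_rev, ← map_sub] at hs
    exact hs

/-- A closed subspace of `L²` that contains all the functions `normKer p` contains `RP`. -/
theorem realPluriharmonic_le (hn : 1 ≤ n) (M : Submodule ℝ (L2 n)) (hM : IsClosed (M : Set (L2 n)))
    (hker : ∀ (p : CSpace n) (hp : ‖p‖ < 1), normKer p hp ∈ M) :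
    realPluriharmonic n ≤ M := by
  -- The Sobolev norm dominates the L² norm, so this intersection is closed in the Sobolev sense.
  -- The rest of RP is reached through the L² expansion, whose terms are smooth.
  have h1 : sobolevRealPluriharmonic n ≤ M ⊓ sobolevRealPluriharmonic n := by
    refine sobolevRealPluriharmonic_le _ (fun F hF h => ⟨?_, hF⟩) fun p hp =>
      ⟨hker p hp, add_mem (kerL2_mem_sobolev p hp) (Submodule.smul_mem _ _ (oneSob n).2)⟩
    have : F ∈ closure (M : Set (L2 n)) := by
      rw [Metric.mem_closure_iff]
      intro ε hε
      obtain ⟨G, hG, hFG⟩ := h (ε / 2 ^ (n + 1)) (by positivity)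
      refine ⟨G, hG.1, ?_⟩
      have h1 := norm_le_realSobMap hn (⟨F, hF⟩ - ⟨G, hG.2⟩)
      rw [← norm_realSobMap] at h1
      rw [dist_eq_norm]
      rw [lt_div_iff₀ (by positivity)] at hFG
      refine lt_of_le_of_lt h1 ?_
      rw [mul_comm]
      exact hFG
    rwa [hM.closure_eq] at this
  intro F hF
  obtain ⟨hP, hc⟩ := mem_realPluriharmonic.mp hF
  have hs := (hasSum_comp hP).mapL (reL2 n)
  rw [reL2_of_conjL2 hc] at hs
  refine hM.mem_of_tendsto hs (Filter.Eventually.of_forall fun s => Submodule.sum_mem _ fun m _ => ?_)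
  refine (h1 (mem_sobolevRealPluriharmonic.mpr ⟨?_, ?_⟩)).1
  · exact reL2_mem_realPluriharmonic (harmZ_le_pluriharmonic m (comp_mem m F))
  · exact (reL2_mem_wDom sobWeight_neg (mem_wDom_of_mem_harmZ (comp_mem m F)).1).1

/-! ### Linear fractional maps -/

/-- Matrices of size `(n+1) + 1`. -/
abbrev BlockMat (n : ℕ) : Type := Matrix (Fin (n + 1) ⊕ Unit) (Fin (n + 1) ⊕ Unit) ℂ

/-- The vector `(p, 1)`. -/
def vec (p : CSpace n) : Fin (n + 1) ⊕ Unit → ℂ := Sum.elim (fun i => p i) (fun _ => 1)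

/-- The Hermitian form of signature `(n+1, 1)`. -/
def hForm (u v : Fin (n + 1) ⊕ Unit → ℂ) : ℂ := star u ⬝ᵥ (signForm n).mulVec v

lemma lift_eq_vec (ζ : Sph n) : lift ζ = vec (ζ : CSpace n) := rfl

lemma hForm_eq (u v : Fin (n + 1) ⊕ Unit → ℂ) :
    hForm u v = ∑ i, starRingEnd ℂ (u (Sum.inl i)) * v (Sum.inl i) -
      starRingEnd ℂ (u (Sum.inr ())) * v (Sum.inr ()) := by
  simp [hForm, signForm, dotProduct, Matrix.mulVec_diagonal, sub_eq_add_neg]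

/-- In these coordinates the sphere consists of null vectors and the open ball of negative ones.
Invariance of the form thus becomes a transformation law for 1 - ⟨p, q⟩. -/
lemma hForm_vec (p q : CSpace n) : hForm (vec p) (vec q) = inner ℂ p q - 1 := by
  rw [hForm_eq, PiLp.inner_apply]
  simp [vec, mul_comm]

lemma hForm_smul_left (c : ℂ) (u v : Fin (n + 1) ⊕ Unit → ℂ) :
    hForm (c • u) v = starRingEnd ℂ c * hForm u v := by
  simp [hForm, star_smul]

lemma hForm_smul_right (c : ℂ) (u v : Fin (n + 1) ⊕ Unit → ℂ) :
    hForm u (c • v) = c * hForm u v := by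
  simp [hForm, Matrix.mulVec_smul]

lemma hForm_mulVec {A : BlockMat n} (hA : IsSU A) (u v : Fin (n + 1) ⊕ Unit → ℂ) :
    hForm (A.mulVec u) (A.mulVec v) = hForm u v := by
  unfold hForm
  rw [Matrix.star_mulVec, ← Matrix.dotProduct_mulVec, Matrix.mulVec_mulVec, Matrix.mulVec_mulVec,
    hA.1]

lemma IsSU.isUnit_det {A : BlockMat n} (hA : IsSU A) : IsUnit A.det := by rw [hA.2]; exact isUnit_one

lemma IsSU.inv {A : BlockMat n} (hA : IsSU A) : IsSU A⁻¹ := by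
  have h1 : A * A⁻¹ = 1 := Matrix.mul_nonsing_inv A hA.isUnit_det
  have h2 : (A⁻¹).conjTranspose * A.conjTranspose = 1 := by
    rw [← Matrix.conjTranspose_mul, h1, Matrix.conjTranspose_one]
  refine ⟨?_, ?_⟩
  · calc (A⁻¹).conjTranspose * signForm n * A⁻¹
        = (A⁻¹).conjTranspose * (A.conjTranspose * signForm n * A) * A⁻¹ := by rw [hA.1]
      _ = ((A⁻¹).conjTranspose * A.conjTranspose) * signForm n * (A * A⁻¹) := by
          simp only [mul_assoc]
      _ = signForm n := by rw [h1, h2, one_mul, mul_one]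
  · rw [Matrix.det_nonsing_inv, hA.2, Ring.inverse_one]

/-- The denominator of the linear fractional map. -/
def den (A : BlockMat n) (p : CSpace n) : ℂ := A.mulVec (vec p) (Sum.inr ())

/-- `τ` is the linear fractional map given by `A`. -/
def IsLinFrac (A : BlockMat n) (τ : Sph n → Sph n) : Prop :=
  IsSU A ∧ ∀ ζ : Sph n, den A ζ ≠ 0 ∧
    A.mulVec (vec (ζ : CSpace n)) = den A ζ • vec (τ ζ : CSpace n)

lemma isConformal_iff {τ : Sph n → Sph n} : IsConformal τ ↔ ∃ A, IsLinFrac A τ := by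
  constructor
  · rintro ⟨A, hA, h⟩
    refine ⟨A, hA, fun ζ => ?_⟩
    obtain ⟨w, hw, e⟩ := h ζ
    rw [lift_eq_vec, lift_eq_vec] at e
    have : den A ζ = w := by
      rw [den, e]
      simp [vec]
    rw [this]
    exact ⟨hw, e⟩
  · rintro ⟨A, hA, h⟩
    exact ⟨A, hA, fun ζ => ⟨den A ζ, (h ζ).1, (h ζ).2⟩⟩

lemma hForm_self (u : Fin (n + 1) ⊕ Unit → ℂ) :
    hForm u u = ((∑ i, ‖u (Sum.inl i)‖ ^ 2 - ‖u (Sum.inr ())‖ ^ 2 : ℝ) : ℂ) := by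
  rw [hForm_eq]
  simp only [← Complex.normSq_eq_conj_mul_self, Complex.normSq_eq_norm_sq]
  push_cast
  rfl

/-- The vector A⁻¹(p, 1) is negative for the form, so its last coordinate s cannot vanish, and
dividing by s gives a point of the ball. This is the action of A⁻¹ on the ball, with its factor of
automorphy s. -/
lemma exists_vec_eq_of_hForm_neg {A : BlockMat n} (hA : IsSU A) {p : CSpace n} (hp : ‖p‖ < 1) :
    ∃ (s : ℂ) (q : CSpace n), s ≠ 0 ∧ ‖q‖ < 1 ∧ vec p = s • A.mulVec (vec q) := by
  set v := (A⁻¹).mulVec (vec p) with hv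
  have h1 : hForm v v = ((‖p‖ ^ 2 - 1 : ℝ) : ℂ) := by
    rw [hv, hForm_mulVec hA.inv, hForm_vec, inner_self_eq_norm_sq_to_K]
    push_cast
    rfl
  rw [hForm_self] at h1
  have h2 := Complex.ofReal_injective h1
  have hp2 : ‖p‖ ^ 2 < 1 := by nlinarith [norm_nonneg p]
  have h3 : 0 ≤ ∑ i, ‖v (Sum.inl i)‖ ^ 2 := Finset.sum_nonneg fun _ _ => sq_nonneg _
  have hs : v (Sum.inr ()) ≠ 0 := by
    intro h0
    rw [h0, norm_zero] at h2
    nlinarith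
  have hs' : 0 < ‖v (Sum.inr ())‖ := norm_pos_iff.mpr hs
  set q : CSpace n := WithLp.toLp 2 (fun i => (v (Sum.inr ()))⁻¹ * v (Sum.inl i)) with hq
  have hvq : v = v (Sum.inr ()) • vec q := by
    funext k
    rcases k with i | i
    · simp [vec, hq, hs]
    · simp [vec]
  refine ⟨v (Sum.inr ()), q, hs, ?_, ?_⟩
  · have h4 : ‖q‖ ^ 2 = (‖v (Sum.inr ())‖ ^ 2)⁻¹ * ∑ i, ‖v (Sum.inl i)‖ ^ 2 := by
      rw [EuclideanSpace.norm_sq_eq, Finset.mul_sum]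
      refine Finset.sum_congr rfl fun i _ => ?_
      simp only [hq]
      rw [norm_mul, norm_inv, mul_pow, inv_pow]
    have h5 : ‖q‖ ^ 2 < 1 := by
      rw [h4, inv_mul_lt_iff₀ (by positivity)]
      linarith
    nlinarith [norm_nonneg q]
  · rw [← Matrix.mulVec_smul, ← hvq, hv, Matrix.mulVec_mulVec,
      Matrix.mul_nonsing_inv A hA.isUnit_det, Matrix.one_mulVec]

lemma vec_injective : Function.Injective (vec : CSpace n → _) := fun _ _ h =>
  PiLp.ext fun i => congrFun h (Sum.inl i)

/-- A sends (ζ, 1) to a nonzero null vector. A null vector whose last coordinate vanishes is zero,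
so one can divide by that coordinate. -/
lemma exists_isLinFrac {A : BlockMat n} (hA : IsSU A) : ∃ τ : Sph n → Sph n, IsLinFrac A τ := by
  have key : ∀ ζ : Sph n, ∃ η : Sph n, den A ζ ≠ 0 ∧
      A.mulVec (vec (ζ : CSpace n)) = den A ζ • vec (η : CSpace n) := by
    intro ζ
    set v := A.mulVec (vec (ζ : CSpace n)) with hv
    have h1 : hForm v v = 0 := by
      rw [hv, hForm_mulVec hA, hForm_vec, inner_self_eq_norm_sq_to_K, norm_eq_of_mem_sphere]
      simp
    rw [hForm_self] at h1
    have h2 : ∑ i, ‖v (Sum.inl i)‖ ^ 2 - ‖v (Sum.inr ())‖ ^ 2 = 0 := Complex.ofReal_eq_zero.mp h1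
    have hs : v (Sum.inr ()) ≠ 0 := by
      intro h0
      rw [h0, norm_zero, zero_pow two_ne_zero, sub_zero,
        Finset.sum_eq_zero_iff_of_nonneg fun _ _ => sq_nonneg _] at h2
      have hv0 : v = 0 := by
        funext k
        rcases k with i | i
        · simpa using h2 i (Finset.mem_univ i)
        · exact h0
      have : vec (ζ : CSpace n) = 0 := by
        have h3 := congrArg (A⁻¹).mulVec hv0
        rwa [hv, Matrix.mulVec_mulVec, Matrix.nonsing_inv_mul A hA.isUnit_det, Matrix.one_mulVec,
          Matrix.mulVec_zero] at h3
      have := congrFun this (Sum.inr ())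
      simp [vec] at this
    have hs' : 0 < ‖v (Sum.inr ())‖ := norm_pos_iff.mpr hs
    set q : CSpace n := WithLp.toLp 2 (fun i => (v (Sum.inr ()))⁻¹ * v (Sum.inl i)) with hq
    have h4 : ‖q‖ ^ 2 = 1 := by
      have : ‖q‖ ^ 2 = (‖v (Sum.inr ())‖ ^ 2)⁻¹ * ∑ i, ‖v (Sum.inl i)‖ ^ 2 := by
        rw [EuclideanSpace.norm_sq_eq, Finset.mul_sum]
        refine Finset.sum_congr rfl fun i _ => ?_
        simp only [hq]
        rw [norm_mul, norm_inv, mul_pow, inv_pow]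
      rw [this, sub_eq_zero.mp h2, inv_mul_cancel₀ (by positivity)]
    refine ⟨⟨q, ?_⟩, hs, ?_⟩
    · rw [mem_sphere_zero_iff_norm]
      exact (pow_eq_one_iff_of_nonneg (norm_nonneg q) two_ne_zero).mp h4
    · funext k
      change v k = v (Sum.inr ()) * vec q k
      rcases k with i | i
      · simp [vec, hq, hs]
      · simp [vec]
  choose τ h1 h2 using key
  exact ⟨τ, hA, fun ζ => ⟨h1 ζ, h2 ζ⟩⟩

lemma IsLinFrac.leftInverse {A : BlockMat n} {τ σ : Sph n → Sph n} (h : IsLinFrac A τ)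
    (h' : IsLinFrac A⁻¹ σ) : Function.LeftInverse σ τ := by
  intro ζ
  have h1 := congrArg (A⁻¹).mulVec (h.2 ζ).2
  rw [Matrix.mulVec_mulVec, Matrix.nonsing_inv_mul A h.1.isUnit_det, Matrix.one_mulVec,
    Matrix.mulVec_smul, (h'.2 (τ ζ)).2, smul_smul] at h1
  have h2 := congrFun h1 (Sum.inr ())
  simp only [vec, Sum.elim_inr, Pi.smul_apply, smul_eq_mul, mul_one] at h2
  rw [← h2, one_smul] at h1
  exact (Subtype.ext (vec_injective h1)).symm

/-- Conformal transformations are invertible. -/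
lemma IsLinFrac.exists_inverse {A : BlockMat n} {τ : Sph n → Sph n} (h : IsLinFrac A τ) :
    ∃ σ : Sph n → Sph n, IsLinFrac A⁻¹ σ ∧ Function.LeftInverse σ τ ∧
      Function.RightInverse σ τ := by
  obtain ⟨σ, hσ⟩ := exists_isLinFrac h.1.inv
  refine ⟨σ, hσ, h.leftInverse hσ, ?_⟩
  have h' : IsLinFrac (A⁻¹)⁻¹ τ := by rwa [Matrix.nonsing_inv_nonsing_inv A h.1.isUnit_det]
  exact hσ.leftInverse h'

section Pullback

variable {A : BlockMat n} {τ : Sph n → Sph n} {p q p' q' : CSpace n} {s s' : ℂ}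

/-- Invariance of the form, applied to an interior point and a boundary point. The formulas for the
Jacobian kernel and for pullbacks are logarithms of this identity. -/
lemma IsLinFrac.den_mul (h : IsLinFrac A τ) (hp : vec p = s • A.mulVec (vec q)) (ζ : Sph n) :
    den A ζ * (1 - inner ℂ p (τ ζ : CSpace n)) =
      starRingEnd ℂ s * (1 - inner ℂ q (ζ : CSpace n)) := by
  have h1 : hForm (vec p) (A.mulVec (vec (ζ : CSpace n))) = starRingEnd ℂ s *
      hForm (vec q) (vec (ζ : CSpace n)) := by
    rw [hp, hForm_smul_left, hForm_mulVec h.1]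
  rw [(h.2 ζ).2, hForm_smul_right, hForm_vec, hForm_vec] at h1
  linear_combination -h1

lemma IsSU.one_sub_inner (h : IsSU A) (hp : vec p = s • A.mulVec (vec q))
    (hp' : vec p' = s' • A.mulVec (vec q')) :
    1 - inner ℂ p p' = starRingEnd ℂ s * s' * (1 - inner ℂ q q') := by
  have h1 : hForm (vec p) (vec p') = starRingEnd ℂ s * (s' * hForm (vec q) (vec q')) := by
    rw [hp, hp', hForm_smul_left, hForm_smul_right, hForm_mulVec h]
  rw [hForm_vec, hForm_vec] at h1
  linear_combination -h1

/-- The case p = 0: the denominator is itself a factor 1 - ⟨q, ζ⟩, which is why log|J_τ| is a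
multiple of a kernel. -/
lemma IsLinFrac.den_eq (h : IsLinFrac A τ) (hp : vec (0 : CSpace n) = s • A.mulVec (vec q))
    (ζ : Sph n) : den A ζ = starRingEnd ℂ s * (1 - inner ℂ q (ζ : CSpace n)) := by
  have := h.den_mul hp ζ
  rwa [inner_zero_left, sub_zero, mul_one] at this

end Pullback

/-! ### Boosts -/

lemma signForm_eq : signForm n = Matrix.fromBlocks 1 0 0 (-1) := by
  ext i j
  rcases i with i | i <;> rcases j with j | j <;>
    simp [signForm, Matrix.diagonal_apply, Matrix.one_apply]

/-- The boosts of `SU(n+1,1)`. -/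
lemma exists_boost (p : CSpace n) (hp : ‖p‖ < 1) :
    ∃ (A : BlockMat n) (s : ℂ), IsSU A ∧ vec (0 : CSpace n) = s • A.mulVec (vec p) := by
  have hp2 : 0 < 1 - ‖p‖ ^ 2 := by nlinarith [norm_nonneg p]
  set s : ℝ := (Real.sqrt (1 - ‖p‖ ^ 2))⁻¹ with hs
  have hspos : 0 < s := inv_pos.mpr (Real.sqrt_pos.mpr hp2)
  have hs2 : s ^ 2 * (1 - ‖p‖ ^ 2) = 1 := by
    rw [hs, inv_pow, Real.sq_sqrt hp2.le, inv_mul_cancel₀ hp2.ne']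
  -- With s the Lorentz factor, κ is (s - 1) / |p|², written so that it makes sense at p = 0: the
  -- block 1 + κ p p* stretches the direction of p by s.
  set κ : ℝ := s ^ 2 / (1 + s) with hκ
  have hκ1 : κ * (1 + s) = s ^ 2 := by rw [hκ]; field_simp
  have hκ2 : κ * ‖p‖ ^ 2 = s - 1 := by
    have : κ * ‖p‖ ^ 2 * (1 + s) = (s - 1) * (1 + s) := by
      linear_combination ‖p‖ ^ 2 * hκ1 - hs2
    exact mul_right_cancel₀ (by positivity) this
  set r : ℝ := ‖p‖ ^ 2 with hr
  let P : Matrix (Fin (n + 1)) Unit ℂ := Matrix.of fun i _ => p i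
  have hPP : P.conjTranspose * P = (r : ℂ) • (1 : Matrix Unit Unit ℂ) := by
    ext i j
    have h1 := inner_self_eq_norm_sq_to_K (𝕜 := ℂ) p
    rw [PiLp.inner_apply] at h1
    simp only [Matrix.mul_apply, Matrix.conjTranspose_apply, Matrix.smul_apply, P, Matrix.of_apply]
    simp only [RCLike.inner_apply] at h1
    rw [hr]
    simp only [Matrix.one_apply_eq, smul_eq_mul, mul_one]
    push_cast
    refine Eq.trans ?_ h1
    exact Finset.sum_congr rfl fun i _ => mul_comm _ _
  set Q := P * P.conjTranspose with hQ
  have hQP : Q * P = (r : ℂ) • P := by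
    rw [hQ, Matrix.mul_assoc, hPP, Matrix.mul_smul, Matrix.mul_one]
  have hQQ : Q * Q = (r : ℂ) • Q := by
    conv_lhs => rw [hQ, ← Matrix.mul_assoc, ← hQ, hQP, Matrix.smul_mul, ← hQ]
  have hQH : Q.conjTranspose = Q := by
    rw [hQ, Matrix.conjTranspose_mul, Matrix.conjTranspose_conjTranspose]
  have hPQ : P.conjTranspose * Q = (r : ℂ) • P.conjTranspose := by
    rw [hQ, ← Matrix.mul_assoc, hPP, Matrix.smul_mul, Matrix.one_mul]
  set A : BlockMat n := Matrix.fromBlocks (1 + (κ : ℂ) • Q) (-(s : ℂ) • P)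
    (-(s : ℂ) • P.conjTranspose) ((s : ℂ) • 1) with hA
  have cs2 : (s : ℂ) ^ 2 * (1 - (r : ℂ)) = 1 := by exact_mod_cast congrArg Complex.ofReal hs2
  have cκ1 : (κ : ℂ) * (1 + s) = (s : ℂ) ^ 2 := by exact_mod_cast congrArg Complex.ofReal hκ1
  have cκ2 : (κ : ℂ) * (r : ℂ) = (s : ℂ) - 1 := by exact_mod_cast congrArg Complex.ofReal hκ2
  have hAH : A.conjTranspose = A := by
    rw [hA, Matrix.fromBlocks_conjTranspose]
    simp [Matrix.conjTranspose_add, Matrix.conjTranspose_smul, hQH]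
  have hAvec : ∀ B : BlockMat n, B = A → B.mulVec (vec p) = (s : ℂ)⁻¹ • vec 0 := by
    rintro B rfl
    funext k
    rcases k with i | i
    · have h1 : ∑ j, Q i j * p j = (r : ℂ) * p i := by
        have := congrFun (congrFun hQP i) ()
        simpa [Matrix.mul_apply, P] using this
      simp only [hA, Matrix.mulVec, dotProduct, Fintype.sum_sum_type, Matrix.fromBlocks_apply₁₁,
        Matrix.fromBlocks_apply₁₂, vec, Sum.elim_inl, Sum.elim_inr, Matrix.add_apply,
        Matrix.smul_apply, smul_eq_mul, add_mul, Finset.sum_add_distrib, mul_assoc,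
        ← Finset.mul_sum, h1]
      simp [Matrix.one_apply, P]
      linear_combination p i * cκ2
    · have h1 : ∑ j, starRingEnd ℂ (p j) * p j = (r : ℂ) := by
        have := congrFun (congrFun hPP ()) ()
        simpa [Matrix.mul_apply, P] using this
      simp only [hA, Matrix.mulVec, dotProduct, Fintype.sum_sum_type, Matrix.fromBlocks_apply₂₁,
        Matrix.fromBlocks_apply₂₂, vec, Sum.elim_inl, Sum.elim_inr,
        Matrix.smul_apply, smul_eq_mul, mul_assoc, ← Finset.mul_sum]
      simp [P, h1]
      have hs0 : (s : ℂ) ≠ 0 := by exact_mod_cast hspos.ne'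
      field_simp
      linear_combination cs2
  refine ⟨A, s, ⟨?_, ?_⟩, ?_⟩
  · rw [hAH, hA, signForm_eq, Matrix.fromBlocks_multiply, Matrix.fromBlocks_multiply]
    simp only [Matrix.mul_one, Matrix.mul_zero, add_zero, zero_add, Matrix.mul_neg, Matrix.neg_mul,
      neg_smul, neg_neg]
    congr 1
    · simp only [Matrix.add_mul, Matrix.mul_add, Matrix.one_mul, Matrix.mul_one, Matrix.smul_mul,
        Matrix.mul_smul, hQQ, ← hQ, smul_smul]
      have e : (s : ℂ) * s = κ * (1 + s) := by rw [cκ1, sq]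
      rw [cκ2, e]
      module
    · simp only [Matrix.add_mul, Matrix.one_mul, Matrix.mul_one, Matrix.smul_mul,
        Matrix.mul_smul, hQP, smul_smul]
      rw [cκ2]
      module
    · simp only [Matrix.mul_add, Matrix.one_mul, Matrix.mul_one, Matrix.smul_mul,
        Matrix.mul_smul, hPQ, smul_smul]
      have e : (κ : ℂ) * (s * r) = s * (s - 1) := by linear_combination (s : ℂ) * cκ2
      simp only [e]
      module
    · simp only [Matrix.mul_one, Matrix.smul_mul, Matrix.mul_smul, hPP, smul_smul]
      have e : (s : ℂ) * (s * r) = s * s - 1 := by linear_combination -cs2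
      rw [e]
      module
  -- A column operation makes A block triangular; the diagonal blocks have determinants 1 + κ|p|² =
  -- s and s⁻¹.
  · let R : BlockMat n := Matrix.fromBlocks 1 P 0 1
    have hR : R.det = 1 := by
      simp [R]
    have hAR : A * R = Matrix.fromBlocks (1 + (κ : ℂ) • Q) 0 (-(s : ℂ) • P.conjTranspose)
        ((s : ℂ)⁻¹ • 1) := by
      rw [hA, Matrix.fromBlocks_multiply]
      simp only [Matrix.mul_one, Matrix.mul_zero, add_zero]
      congr 1
      · simp only [Matrix.add_mul, Matrix.one_mul, Matrix.smul_mul, hQP, smul_smul, cκ2]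
        module
      · simp only [Matrix.smul_mul, hPP, smul_smul]
        have hs0 : (s : ℂ) ≠ 0 := by exact_mod_cast hspos.ne'
        have e : (s : ℂ)⁻¹ = s - s * r := by
          field_simp
          linear_combination -cs2
        rw [e]
        module
    have hd := congrArg Matrix.det hAR
    rw [Matrix.det_mul, hR, mul_one, Matrix.det_fromBlocks_zero₁₂] at hd
    have h1 : (1 + (κ : ℂ) • Q).det = s := by
      rw [hQ, ← Matrix.smul_mul, Matrix.det_one_add_mul_comm, Matrix.mul_smul, hPP]
      simp [cκ2]
    rw [hd, h1]
    have hs0 : (s : ℂ) ≠ 0 := by exact_mod_cast hspos.ne'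
    simp [hs0]
  · rw [hAvec A rfl, smul_smul, mul_inv_cancel₀ (by exact_mod_cast hspos.ne'), one_smul]

/-! ### The Jacobian of a conformal transformation -/

/-- The block `a` of a matrix with blocks `a, b, c, d`. -/
def linPart (A : BlockMat n) : CSpace n →L[ℂ] CSpace n :=
  LinearMap.toContinuousLinearMap (Matrix.toLpLin 2 2 A.toBlocks₁₁)

/-- The block `b` of a matrix with blocks `a, b, c, d`. -/
def translPart (A : BlockMat n) : CSpace n := WithLp.toLp 2 fun i => A (Sum.inl i) (Sum.inr ())

/-- The block `c` of a matrix with blocks `a, b, c, d`. -/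
def denLin (A : BlockMat n) : CSpace n →L[ℂ] ℂ :=
  LinearMap.toContinuousLinearMap
    { toFun := fun x => ∑ j, A (Sum.inr ()) (Sum.inl j) * x j
      map_add' := fun x y => by simp [mul_add, Finset.sum_add_distrib]
      map_smul' := fun c x => by simp [Finset.mul_sum, mul_left_comm] }

lemma linPart_apply (A : BlockMat n) (x : CSpace n) (i : Fin (n + 1)) :
    linPart A x i = ∑ j, A (Sum.inl i) (Sum.inl j) * x j := rfl

lemma denLin_apply (A : BlockMat n) (x : CSpace n) :
    denLin A x = ∑ j, A (Sum.inr ()) (Sum.inl j) * x j := rfl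

lemma mulVec_elim_inl (A : BlockMat n) (x : CSpace n) (c : ℂ) (i : Fin (n + 1)) :
    A.mulVec (Sum.elim (fun i => x i) (fun _ => c)) (Sum.inl i) =
      linPart A x i + c * translPart A i := by
  simp [Matrix.mulVec, dotProduct, linPart_apply, translPart, mul_comm c]

lemma mulVec_elim_inr (A : BlockMat n) (x : CSpace n) (c : ℂ) :
    A.mulVec (Sum.elim (fun i => x i) (fun _ => c)) (Sum.inr ()) =
      denLin A x + c * A (Sum.inr ()) (Sum.inr ()) := by
  simp [Matrix.mulVec, dotProduct, denLin_apply, mul_comm c]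

lemma den_eq_add (A : BlockMat n) (x : CSpace n) :
    den A x = denLin A x + A (Sum.inr ()) (Sum.inr ()) := by
  rw [den, vec, mulVec_elim_inr, one_mul]

lemma IsLinFrac.smul_apply {A : BlockMat n} {τ : Sph n → Sph n} (h : IsLinFrac A τ) (ζ : Sph n) :
    den A ζ • (τ ζ : CSpace n) = linPart A ζ + translPart A := by
  ext i
  have := congrFun (h.2 ζ).2 (Sum.inl i)
  rw [vec, mulVec_elim_inl, one_mul] at this
  exact this.symm

lemma IsLinFrac.apply_eq {A : BlockMat n} {τ : Sph n → Sph n} (h : IsLinFrac A τ) (ζ : Sph n) :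
    (τ ζ : CSpace n) = (den A ζ)⁻¹ • (linPart A ζ + translPart A) := by
  rw [← h.smul_apply, smul_smul, inv_mul_cancel₀ (h.2 ζ).1, one_smul]

lemma IsLinFrac.continuous {A : BlockMat n} {τ : Sph n → Sph n} (h : IsLinFrac A τ) :
    Continuous τ := by
  rw [continuous_induced_rng]
  have e : (Subtype.val ∘ τ) = fun ζ : Sph n => (den A ζ)⁻¹ • (linPart A ζ + translPart A) :=
    funext h.apply_eq
  rw [e]
  refine Continuous.smul (Continuous.inv₀ ?_ fun ζ => (h.2 ζ).1) (by fun_prop)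
  simp only [den_eq_add]
  fun_prop

/-- Homogenizing the fraction, with |x| in the place of 1, avoids the normalization x / |x| and
leaves an expression that can be differentiated directly. -/
lemma IsLinFrac.radialExt_eq {A : BlockMat n} {τ : Sph n → Sph n} (h : IsLinFrac A τ)
    {x : CSpace n} (hx : x ≠ 0) :
    denLin A x + (‖x‖ : ℂ) * A (Sum.inr ()) (Sum.inr ()) ≠ 0 ∧
    radialExt τ x = ‖x‖ • ((denLin A x + (‖x‖ : ℂ) * A (Sum.inr ()) (Sum.inr ()))⁻¹ •
      (linPart A x + (‖x‖ : ℂ) • translPart A)) := by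
  have hr : (‖x‖ : ℂ) ≠ 0 := by exact_mod_cast norm_ne_zero_iff.mpr hx
  set ζ : Sph n := ⟨‖x‖⁻¹ • x, by simp [norm_smul, hx]⟩ with hζ
  have hxζ : x = (‖x‖ : ℂ) • (ζ : CSpace n) := by
    have h0 : ‖x‖ • ‖x‖⁻¹ • x = x := by
      rw [smul_smul, mul_inv_cancel₀ (norm_ne_zero_iff.mpr hx), one_smul]
    exact h0.symm.trans (by simp [hζ])
  have e1 : denLin A x + (‖x‖ : ℂ) * A (Sum.inr ()) (Sum.inr ()) = ‖x‖ * den A ζ := by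
    have : denLin A x = ‖x‖ * denLin A ζ := by
      conv_lhs => rw [hxζ, map_smul, smul_eq_mul]
    rw [this, den_eq_add, mul_add]
  have e2 : linPart A x + (‖x‖ : ℂ) • translPart A =
      (‖x‖ : ℂ) • (linPart A ζ + translPart A) := by
    have : linPart A x = (‖x‖ : ℂ) • linPart A ζ := by
      conv_lhs => rw [hxζ, map_smul]
    rw [this, smul_add]
  rw [e1, e2]
  refine ⟨mul_ne_zero hr (h.2 ζ).1, ?_⟩
  rw [radialExt, dif_neg hx, ← hζ, h.apply_eq ζ, mul_inv, smul_smul, mul_right_comm,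
    inv_mul_cancel₀ hr, one_mul]

lemma IsLinFrac.differentiableAt_radialExt {A : BlockMat n} {τ : Sph n → Sph n}
    (h : IsLinFrac A τ) {x : CSpace n} (hx : x ≠ 0) :
    DifferentiableAt ℝ (radialExt τ) x := by
  have hN : DifferentiableAt ℝ (fun y : CSpace n => ‖y‖) x :=
    (differentiableAt_id (𝕜 := ℝ)).norm ℝ hx
  have hN' : DifferentiableAt ℝ (fun y : CSpace n => (‖y‖ : ℂ)) x :=
    Complex.ofRealCLM.differentiableAt.comp x hN
  have hl : DifferentiableAt ℝ (fun y => linPart A y) x :=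
    ((linPart A).restrictScalars ℝ).differentiableAt
  have hd : DifferentiableAt ℝ (fun y => denLin A y) x :=
    ((denLin A).restrictScalars ℝ).differentiableAt
  have : DifferentiableAt ℝ (fun x : CSpace n => ‖x‖ •
      ((denLin A x + (‖x‖ : ℂ) * A (Sum.inr ()) (Sum.inr ()))⁻¹ •
      (linPart A x + (‖x‖ : ℂ) • translPart A))) x :=
    hN.smul (((hd.add (hN'.mul_const _)).inv (h.radialExt_eq hx).1).smul
      (hl.add (hN'.smul_const _)))
  refine this.congr_of_eventuallyEq ?_
  filter_upwards [isOpen_ne.mem_nhds hx] with y hy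
  exact (h.radialExt_eq hy).2

/-- The complex linear part of the differential of a conformal transformation. -/
def confDeriv (A : BlockMat n) (η : CSpace n) : CSpace n →L[ℂ] CSpace n :=
  linPart A - (denLin A).smulRight η

lemma hasFDerivAt_norm_sphere (ζ : Sph n) :
    ∃ D : CSpace n →L[ℝ] ℝ, HasFDerivAt (fun x : CSpace n => ‖x‖) D (ζ : CSpace n) ∧
      ∀ v, D v = (inner ℂ (ζ : CSpace n) v).re := by
  have h1 := (hasStrictFDerivAt_norm_sq (ζ : CSpace n)).hasFDerivAt.sqrt
    (by simp)
  simp only [Real.sqrt_sq (norm_nonneg _)] at h1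
  refine ⟨_, h1, fun v => ?_⟩
  have e : inner ℝ (ζ : CSpace n) v = (inner ℂ (ζ : CSpace n) v).re := by
    rw [PiLp.inner_apply, PiLp.inner_apply, Complex.re_sum]
    rfl
  simp [e]

/-- The derivative is a complex linear map plus a real rank-one term. The latter comes from
differentiating |x|, and is simplified with the values of aζ + b and cζ + d. -/
lemma IsLinFrac.hasFDerivAt_radialExt {A : BlockMat n} {τ : Sph n → Sph n}
    (h : IsLinFrac A τ) (ζ : Sph n) :
    ∃ D : CSpace n →L[ℝ] CSpace n, HasFDerivAt (radialExt τ) D (ζ : CSpace n) ∧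
      ∀ v, D v = (inner ℂ (ζ : CSpace n) v).re •
        ((τ ζ : CSpace n) - (den A ζ)⁻¹ • confDeriv A (τ ζ : CSpace n) (ζ : CSpace n)) +
        (den A ζ)⁻¹ • confDeriv A (τ ζ : CSpace n) v := by
  have hx : (ζ : CSpace n) ≠ 0 := ne_zero_of_mem_unit_sphere ζ
  obtain ⟨DN, hN, hDN⟩ := hasFDerivAt_norm_sphere ζ
  have hN' : HasFDerivAt (fun y : CSpace n => (‖y‖ : ℂ)) (Complex.ofRealCLM ∘L DN)
      (ζ : CSpace n) := Complex.ofRealCLM.hasFDerivAt.comp _ hN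
  have hl : HasFDerivAt (fun y => linPart A y) ((linPart A).restrictScalars ℝ) (ζ : CSpace n) :=
    ((linPart A).restrictScalars ℝ).hasFDerivAt
  have hd : HasFDerivAt (fun y => denLin A y) ((denLin A).restrictScalars ℝ) (ζ : CSpace n) :=
    ((denLin A).restrictScalars ℝ).hasFDerivAt
  have hi := (hasDerivAt_inv (h.radialExt_eq hx).1).hasFDerivAt.restrictScalars ℝ
  have hi' := hi.comp (ζ : CSpace n) (hd.add (hN'.mul_const (A (Sum.inr ()) (Sum.inr ()))))
  have hT := hN.smul (hi'.smul (hl.add (hN'.smul_const (translPart A))))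
  refine ⟨_, hT.congr_of_eventuallyEq ?_, fun v => ?_⟩
  · filter_upwards [isOpen_ne.mem_nhds hx] with y hy
    exact (h.radialExt_eq hy).2
  · have hz := (h.2 ζ).1
    have e0 : ‖(ζ : CSpace n)‖ = 1 := norm_eq_of_mem_sphere ζ
    have e1 : denLin A (ζ : CSpace n) = den A ζ - A (Sum.inr ()) (Sum.inr ()) := by
      rw [den_eq_add]; ring
    have e2 : linPart A (ζ : CSpace n) = den A ζ • (τ ζ : CSpace n) - translPart A := by
      rw [h.smul_apply]; abel
    ext i
    simp [e0, hDN, e1, e2, confDeriv]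
    field_simp
    ring

/-- Invariance of the form for the pair (ζ, 1), (v, 0). It expresses the functional Re⟨ζ, ·⟩ through
the complex linear part of the differential, as the rank-one determinant formula requires. -/
lemma IsLinFrac.inner_confDeriv {A : BlockMat n} {τ : Sph n → Sph n} (h : IsLinFrac A τ)
    (ζ : Sph n) (v : CSpace n) :
    starRingEnd ℂ (den A ζ) * inner ℂ (τ ζ : CSpace n) (confDeriv A (τ ζ : CSpace n) v) =
      inner ℂ (ζ : CSpace n) v := by
  have h1 := hForm_mulVec h.1 (vec (ζ : CSpace n)) (Sum.elim (fun i => v i) (fun _ => 0))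
  rw [(h.2 ζ).2, hForm_smul_left] at h1
  have e1 : A.mulVec (Sum.elim (fun i => v i) (fun _ => 0)) =
      Sum.elim (fun i => linPart A v i) (fun _ => denLin A v) := by
    funext k
    rcases k with i | i
    · rw [mulVec_elim_inl, zero_mul, add_zero, Sum.elim_inl]
    · rw [mulVec_elim_inr, zero_mul, add_zero, Sum.elim_inr]
  have e2 : ∀ (x y : CSpace n) (c : ℂ),
      hForm (vec x) (Sum.elim (fun i => y i) (fun _ => c)) = inner ℂ x y - c := by
    intro x y c
    rw [hForm_eq, PiLp.inner_apply]
    simp [vec, mul_comm]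
  rw [e1, e2, e2, sub_zero] at h1
  rw [← h1, confDeriv, sub_apply, ContinuousLinearMap.smulRight_apply,
    inner_sub_right, inner_smul_right, inner_self_eq_norm_sq_to_K, norm_eq_of_mem_sphere]
  simp

/-- Unipotent row and column operations, built from τ(ζ) and ζ, bring A to block triangular form
with the matrix of `confDeriv` and the denominator on the diagonal; and det A = 1. -/
lemma IsLinFrac.det_confDeriv {A : BlockMat n} {τ : Sph n → Sph n} (h : IsLinFrac A τ)
    (ζ : Sph n) :
    LinearMap.det (confDeriv A (τ ζ : CSpace n) : CSpace n →ₗ[ℂ] CSpace n) * den A ζ = 1 := by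
  set t : Matrix (Fin (n + 1)) Unit ℂ := Matrix.of fun i _ => (τ ζ : CSpace n) i with ht
  set z : Matrix (Fin (n + 1)) Unit ℂ := Matrix.of fun i _ => (ζ : CSpace n) i with hz
  set X : Matrix (Fin (n + 1)) (Fin (n + 1)) ℂ := A.toBlocks₁₁ - t * A.toBlocks₂₁ with hX
  have e1 : (confDeriv A (τ ζ : CSpace n) : CSpace n →ₗ[ℂ] CSpace n) = Matrix.toLpLin 2 2 X := by
    ext v i
    have : (Matrix.toLpLin 2 2 X v) i = ∑ j, X i j * v j := rfl
    change confDeriv A (τ ζ : CSpace n) v i = _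
    rw [this]
    simp [confDeriv, linPart_apply, denLin_apply, hX, ht, Matrix.mul_apply, Matrix.toBlocks₁₁,
      Matrix.toBlocks₂₁, sub_mul, Finset.sum_sub_distrib, Finset.sum_mul]
    exact Finset.sum_congr rfl fun j _ => by ring
  have e2 : LinearMap.det (Matrix.toLpLin 2 2 X) = X.det := by
    rw [Matrix.toLpLin_eq_toLin, LinearMap.det_toLin]
  have hA : A = Matrix.fromBlocks A.toBlocks₁₁ A.toBlocks₁₂ A.toBlocks₂₁ A.toBlocks₂₂ :=
    (Matrix.fromBlocks_toBlocks A).symm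
  have hw : A.toBlocks₂₁ * z + A.toBlocks₂₂ = den A ζ • 1 := by
    ext i j
    rw [den_eq_add]
    simp [Matrix.mul_apply, hz, Matrix.toBlocks₂₁, Matrix.toBlocks₂₂, denLin_apply]
  have hv : A.toBlocks₁₁ * z + A.toBlocks₁₂ = den A ζ • t := by
    ext i j
    have := congrArg (fun y : CSpace n => y i) (h.smul_apply ζ)
    simp only [PiLp.smul_apply, PiLp.add_apply, linPart_apply, translPart, smul_eq_mul] at this
    simp [Matrix.mul_apply, hz, Matrix.toBlocks₁₁, Matrix.toBlocks₁₂, ht, this]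
  have key : Matrix.fromBlocks 1 (-t) 0 1 * A * Matrix.fromBlocks 1 z 0 1 =
      Matrix.fromBlocks X 0 A.toBlocks₂₁ (den A ζ • 1) := by
    conv_lhs => rw [hA]
    rw [Matrix.fromBlocks_multiply, Matrix.fromBlocks_multiply]
    congr 1
    · simp [hX, sub_eq_add_neg]
    · simp only [Matrix.one_mul, Matrix.mul_one, Matrix.neg_mul, Matrix.add_mul, Matrix.mul_assoc]
      have : A.toBlocks₁₁ * z + -(t * (A.toBlocks₂₁ * z)) + (A.toBlocks₁₂ + -(t * A.toBlocks₂₂)) =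
          (A.toBlocks₁₁ * z + A.toBlocks₁₂) - t * (A.toBlocks₂₁ * z + A.toBlocks₂₂) := by
        rw [Matrix.mul_add]; abel
      rw [this, hv, hw]
      simp
    · simp
    · simpa using hw
  have hd := congrArg Matrix.det key
  rw [Matrix.det_mul, Matrix.det_mul, Matrix.det_fromBlocks_zero₂₁, Matrix.det_fromBlocks_zero₂₁,
    Matrix.det_fromBlocks_zero₁₂, h.1.2] at hd
  simp at hd
  rw [e1, e2, ← hd]

/-- The Jacobian of a conformal transformation. -/
lemma IsLinFrac.jac_eq {A : BlockMat n} {τ : Sph n → Sph n} (h : IsLinFrac A τ) (ζ : Sph n) :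
    jac τ ζ = (‖den A ζ‖ ^ (2 * n + 2))⁻¹ := by
  obtain ⟨D, hD, hDv⟩ := h.hasFDerivAt_radialExt ζ
  have hw := (h.2 ζ).1
  set w := den A ζ with hwdef
  have hw' : 0 < ‖w‖ := norm_pos_iff.mpr hw
  set H : CSpace n →ₗ[ℂ] CSpace n :=
    w⁻¹ • (confDeriv A (τ ζ : CSpace n) : CSpace n →ₗ[ℂ] CSpace n) with hH
  have hHv : ∀ v, H v = w⁻¹ • confDeriv A (τ ζ : CSpace n) v := fun v => rfl
  set f : Module.Dual ℝ (CSpace n) :=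
    Complex.reLm ∘ₗ ((innerSL ℂ (τ ζ : CSpace n) : CSpace n →ₗ[ℂ] ℂ).restrictScalars ℝ) with hf
  have hfv : ∀ v, f v = (inner ℂ (τ ζ : CSpace n) v).re := fun v => rfl
  have hfH : ∀ v, ‖w‖ ^ 2 * f (H v) = (inner ℂ (ζ : CSpace n) v).re := by
    intro v
    have h1 := h.inner_confDeriv ζ v
    rw [hfv, hHv, inner_smul_right, ← h1, ← hwdef, ← Complex.re_ofReal_mul]
    congr 1
    rw [← mul_assoc]
    congr 1
    push_cast
    rw [← Complex.conj_mul', mul_assoc, mul_inv_cancel₀ hw, mul_one]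
  -- The differential is the complex map H followed by a real transvection along u. The transvection
  -- has determinant |w|² and H has real determinant |det H|² = |w|^{-2(n+2)}, so the product is
  -- |w|^{-(2n+2)}.
  set u : CSpace n := ‖w‖ ^ 2 • ((τ ζ : CSpace n) - H ζ) with hu
  have hDeq : (D : CSpace n →ₗ[ℝ] CSpace n) =
      LinearMap.transvection f u ∘ₗ H.restrictScalars ℝ := by
    ext1 v
    change D v = H v + f (H v) • u
    rw [hDv, hu, ← hfH v, hHv, hHv, smul_smul]
    rw [mul_comm (‖w‖ ^ 2), add_comm]
  have hfu : 1 + f u = ‖w‖ ^ 2 := by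
    have h1 := hfH ζ
    rw [inner_self_eq_norm_sq_to_K, norm_eq_of_mem_sphere] at h1
    have h2 : f (τ ζ : CSpace n) = 1 := by
      rw [hfv, inner_self_eq_norm_sq_to_K, norm_eq_of_mem_sphere]; simp
    rw [hu, map_smul, map_sub, h2, smul_eq_mul, mul_sub, h1]
    simp
  have hdetH : ‖LinearMap.det H‖ = (‖w‖ ^ (n + 2))⁻¹ := by
    have h1 := congrArg norm (h.det_confDeriv ζ)
    rw [norm_mul, norm_one, ← hwdef] at h1
    rw [hH, LinearMap.det_smul, norm_mul, finrank_euclideanSpace, Fintype.card_fin, norm_pow,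
      norm_inv, eq_inv_of_mul_eq_one_left h1]
    rw [← inv_pow, ← pow_succ]
  have hdet : D.det = ‖w‖ ^ 2 * ‖LinearMap.det H‖ ^ 2 := by
    change LinearMap.det (D : CSpace n →ₗ[ℝ] CSpace n) = _
    rw [hDeq, LinearMap.det_comp, LinearMap.transvection.det, hfu, LinearMap.det_restrictScalars,
      Algebra.norm_complex_apply, Complex.normSq_eq_norm_sq]
  rw [jac, hD.fderiv, hdet, hdetH, abs_of_nonneg (by positivity)]
  field_simp
  ring

lemma IsLinFrac.jac_pos {A : BlockMat n} {τ : Sph n → Sph n} (h : IsLinFrac A τ) (ζ : Sph n) :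
    0 < jac τ ζ := by
  rw [h.jac_eq]
  have := norm_pos_iff.mpr (h.2 ζ).1
  positivity

lemma IsLinFrac.continuous_jac {A : BlockMat n} {τ : Sph n → Sph n} (h : IsLinFrac A τ) :
    Continuous (jac τ) := by
  rw [funext h.jac_eq]
  refine Continuous.inv₀ ?_ fun ζ => pow_ne_zero _ (norm_ne_zero_iff.mpr (h.2 ζ).1)
  simp only [den_eq_add]
  fun_prop

lemma radialExt_smul (τ : Sph n → Sph n) {r : ℝ} (hr : 0 < r) (x : CSpace n) :
    radialExt τ (r • x) = r • radialExt τ x := by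
  by_cases hx : x = 0
  · simp [hx, radialExt]
  · have hrx : r • x ≠ 0 := smul_ne_zero hr.ne' hx
    rw [radialExt, radialExt, dif_neg hx, dif_neg hrx]
    have e : (⟨‖r • x‖⁻¹ • r • x, by
        rw [mem_sphere_zero_iff_norm, norm_smul, norm_inv, norm_norm,
          inv_mul_cancel₀ (norm_ne_zero_iff.mpr hrx)]⟩ : Sph n) =
        ⟨‖x‖⁻¹ • x, by simp [norm_smul, hx]⟩ := by
      apply Subtype.ext
      simp only [norm_smul, Real.norm_of_nonneg hr.le, smul_smul, mul_inv]
      congr 1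
      field_simp
    rw [e, norm_smul, Real.norm_of_nonneg hr.le, smul_smul]

lemma radialExt_coe (τ : Sph n → Sph n) (ζ : Sph n) : radialExt τ (ζ : CSpace n) = τ ζ := by
  have hx : (ζ : CSpace n) ≠ 0 := ne_zero_of_mem_unit_sphere ζ
  have h1 : ‖(ζ : CSpace n)‖ = 1 := norm_eq_of_mem_sphere ζ
  rw [radialExt, dif_neg hx]
  have e : (⟨‖(ζ : CSpace n)‖⁻¹ • (ζ : CSpace n), by simp⟩ : Sph n) = ζ := by
    apply Subtype.ext
    simp
  rw [e, h1, one_smul]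

/-- The radial extension is homogeneous of degree one, so its derivative is constant along rays. -/
lemma IsLinFrac.det_fderiv {A : BlockMat n} {τ : Sph n → Sph n} (h : IsLinFrac A τ)
    {r : ℝ} (hr : 0 < r) (ζ : Sph n) :
    |(fderiv ℝ (radialExt τ) (r • (ζ : CSpace n))).det| = jac τ ζ := by
  have hx : r • (ζ : CSpace n) ≠ 0 := smul_ne_zero hr.ne' (ne_zero_of_mem_unit_sphere ζ)
  have h1 := (h.differentiableAt_radialExt hx).hasFDerivAt
  have h2 : HasFDerivAt (fun y : CSpace n => r • y) (r • ContinuousLinearMap.id ℝ (CSpace n))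
      (ζ : CSpace n) := (hasFDerivAt_id _).const_smul r
  have h3 := (h1.comp (ζ : CSpace n) h2).const_smul r⁻¹
  have e : r⁻¹ • (radialExt τ ∘ fun y : CSpace n => r • y) = radialExt τ := by
    funext y
    simp [radialExt_smul τ hr, smul_smul, inv_mul_cancel₀ hr.ne']
  have h4 : HasFDerivAt (radialExt τ) _ (ζ : CSpace n) := e ▸ h3
  rw [jac, h4.fderiv]
  congr 2
  ext v
  simp [smul_smul, inv_mul_cancel₀ hr.ne']

/-! ### Change of variables -/

open scoped ENNReal

/-- Integration in polar coordinates of a product of an angular and a radial function. -/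
lemma lintegral_polar (f : CSpace n → ℝ≥0∞) {g : Sph n → ℝ≥0∞} (hg : Measurable g) {φ : ℝ → ℝ≥0∞}
    (hφ : Measurable φ) (h : ∀ (r : ℝ), 0 < r → ∀ ζ : Sph n, f (r • (ζ : CSpace n)) = g ζ * φ r) :
    ∫⁻ x in {0}ᶜ, f x = (∫⁻ ζ, g ζ ∂(surf n)) *
      ∫⁻ r : Set.Ioi (0 : ℝ), φ r ∂(Measure.volumeIoiPow (2 * n + 1)) := by
  have hd : Module.finrank ℝ (CSpace n) - 1 = 2 * n + 1 := by rw [finrank_CSpace]; omega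
  calc ∫⁻ x in {0}ᶜ, f x = ∫⁻ x : ({(0)}ᶜ : Set (CSpace n)), f x
          ∂((volume : Measure (CSpace n)).comap Subtype.val) := by
        rw [lintegral_subtype_comap (measurableSet_singleton _).compl f]
    _ = ∫⁻ x : Sph n × Set.Ioi (0 : ℝ), g x.1 * φ x.2
          ∂((volume : Measure (CSpace n)).toSphere.prod
            (.volumeIoiPow (Module.finrank ℝ (CSpace n) - 1))) := by
        rw [← (volume : Measure (CSpace n)).measurePreserving_homeomorphUnitSphereProd.lintegral_comp_emb
          (Homeomorph.measurableEmbedding _)]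
        refine lintegral_congr_ae (Filter.Eventually.of_forall fun x => ?_)
        have hx : (x : CSpace n) ≠ 0 := x.2
        have hx' : 0 < ‖(x : CSpace n)‖ := norm_pos_iff.mpr hx
        simp only
        rw [homeomorphUnitSphereProd_apply_snd_coe, ← h _ hx', homeomorphUnitSphereProd_apply_fst_coe,
          smul_smul, mul_inv_cancel₀ hx'.ne', one_smul]
    _ = _ := by
        rw [hd, lintegral_prod_mul (μ := (volume : Measure (CSpace n)).toSphere)
          (ν := .volumeIoiPow (2 * n + 1)) (f := g) (g := fun r : Set.Ioi (0 : ℝ) => φ r)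
          hg.aemeasurable (hφ.comp measurable_subtype_coe).aemeasurable]
        rfl

lemma exists_smul_sphere {x : CSpace n} (hx : x ≠ 0) :
    ∃ ζ : Sph n, x = ‖x‖ • (ζ : CSpace n) :=
  ⟨⟨‖x‖⁻¹ • x, by simp [norm_smul, hx]⟩, by
    simp [smul_smul, mul_inv_cancel₀ (norm_ne_zero_iff.mpr hx)]⟩

lemma radialExt_smul_coe (τ : Sph n → Sph n) {r : ℝ} (hr : 0 < r) (ζ : Sph n) :
    radialExt τ (r • (ζ : CSpace n)) = r • (τ ζ : CSpace n) := by
  rw [radialExt_smul τ hr, radialExt_coe]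

lemma radialExt_leftInverse {τ σ : Sph n → Sph n} (h : Function.LeftInverse σ τ) :
    Function.LeftInverse (radialExt σ) (radialExt τ) := by
  intro x
  by_cases hx : x = 0
  · simp [hx, radialExt]
  · obtain ⟨ζ, hζ⟩ := exists_smul_sphere hx
    rw [hζ, radialExt_smul_coe τ (norm_pos_iff.mpr hx), radialExt_smul_coe σ (norm_pos_iff.mpr hx),
      h ζ]

lemma radialExt_eq_zero_iff (τ : Sph n → Sph n) (x : CSpace n) : radialExt τ x = 0 ↔ x = 0 := by
  constructor
  · intro h
    by_contra hx
    obtain ⟨ζ, hζ⟩ := exists_smul_sphere hx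
    rw [hζ, radialExt_smul_coe τ (norm_pos_iff.mpr hx)] at h
    exact smul_ne_zero (norm_ne_zero_iff.mpr hx) (ne_zero_of_mem_unit_sphere (τ ζ)) h
  · rintro rfl
    simp [radialExt]

/-- Change of variables on the sphere. -/
lemma IsLinFrac.lintegral_comp_mul_jac {A : BlockMat n} {τ : Sph n → Sph n} (h : IsLinFrac A τ)
    {g : Sph n → ℝ≥0∞} (hg : Measurable g) :
    ∫⁻ ζ, ENNReal.ofReal (jac τ ζ) * g (τ ζ) ∂(surf n) = ∫⁻ ζ, g ζ ∂(surf n) := by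
  classical
  obtain ⟨σ, -, hl, hr⟩ := h.exists_inverse
  -- The cutoff to the unit ball makes the radial integral positive and finite, so that it cancels
  -- from the Euclidean change of variables for the radial extension.
  set φ : ℝ → ℝ≥0∞ := Set.indicator (Set.Iio 1) 1 with hφ
  have hφm : Measurable φ := measurable_one.indicator measurableSet_Iio
  set G : CSpace n → ℝ≥0∞ := fun x =>
    if hx : x = 0 then 0 else g ⟨‖x‖⁻¹ • x, by simp [norm_smul, hx]⟩ * φ ‖x‖ with hG
  have hGs : ∀ r : ℝ, 0 < r → ∀ ζ : Sph n, G (r • (ζ : CSpace n)) = g ζ * φ r := by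
    intro r hr ζ
    have hx : r • (ζ : CSpace n) ≠ 0 := smul_ne_zero hr.ne' (ne_zero_of_mem_unit_sphere ζ)
    have e1 : ‖r • (ζ : CSpace n)‖ = r := by
      rw [norm_smul, norm_eq_of_mem_sphere, mul_one, Real.norm_of_nonneg hr.le]
    rw [hG]
    simp only [hx, dite_false, e1]
    congr 2
    apply Subtype.ext
    simp [smul_smul, inv_mul_cancel₀ hr.ne']
  have himg : radialExt τ '' {0}ᶜ = {0}ᶜ := by
    ext x
    constructor
    · rintro ⟨y, hy, rfl⟩
      exact fun h0 => hy ((radialExt_eq_zero_iff τ y).mp h0)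
    · intro hx
      exact ⟨radialExt σ x, fun h0 => hx ((radialExt_eq_zero_iff σ x).mp h0),
        radialExt_leftInverse hr x⟩
  have key := lintegral_image_eq_lintegral_abs_det_fderiv_mul (volume : Measure (CSpace n))
    (measurableSet_singleton (0 : CSpace n)).compl
    (fun x hx => (h.differentiableAt_radialExt hx).hasFDerivAt.hasFDerivWithinAt)
    (radialExt_leftInverse hl).injective.injOn G
  have hjac : Measurable fun ζ : Sph n => ENNReal.ofReal (jac τ ζ) * g (τ ζ) :=
    h.continuous_jac.measurable.ennreal_ofReal.mul (hg.comp h.continuous.measurable)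
  rw [himg, lintegral_polar G hg hφm hGs, lintegral_polar _ hjac hφm] at key
  · have hc : ∫⁻ r : Set.Ioi (0 : ℝ), φ r ∂(Measure.volumeIoiPow (2 * n + 1)) =
        ENNReal.ofReal (1 / (2 * n + 2)) := by
      have : (fun r : Set.Ioi (0 : ℝ) => φ r) =
          Set.indicator (Set.Iio (⟨1, Set.mem_Ioi.mpr one_pos⟩ : Set.Ioi (0 : ℝ))) 1 := by
        funext r
        rfl
      rw [this, lintegral_indicator_one measurableSet_Iio, Measure.volumeIoiPow_apply_Iio]
      congr 1
      push_cast
      ring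
    rw [hc] at key
    exact ((ENNReal.mul_left_inj (by simp; positivity) ENNReal.ofReal_ne_top).mp key).symm
  · intro r hr ζ
    rw [h.det_fderiv hr, radialExt_smul_coe τ hr, hGs r hr, mul_assoc]

lemma IsLinFrac.map_withDensity {A : BlockMat n} {τ : Sph n → Sph n} (h : IsLinFrac A τ) :
    Measure.map τ ((surf n).withDensity fun ζ => ENNReal.ofReal (jac τ ζ)) = surf n := by
  ext s hs
  have hm := h.continuous.measurable
  rw [Measure.map_apply hm hs, withDensity_apply _ (hm hs), ← lintegral_indicator_one hs,
    ← h.lintegral_comp_mul_jac (measurable_one.indicator hs), ← lintegral_indicator (hm hs)]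
  congr 1
  funext ζ
  by_cases hζ : τ ζ ∈ s <;> simp [hζ]

/-- Conformal transformations distort the surface measure by a bounded factor. -/
lemma IsLinFrac.exists_map_le {A : BlockMat n} {τ : Sph n → Sph n} (h : IsLinFrac A τ) :
    ∃ C : NNReal, Measure.map τ (surf n) ≤ C • surf n := by
  have : Nonempty (Sph n) :=
    ((NormedSpace.sphere_nonempty (x := (0 : CSpace n))).mpr zero_le_one).to_subtype
  obtain ⟨ζ₀, -, hζ₀⟩ := isCompact_univ.exists_isMinOn Set.univ_nonempty
    h.continuous_jac.continuousOn
  have hc : 0 < jac τ ζ₀ := h.jac_pos ζ₀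
  refine ⟨(Real.toNNReal (jac τ ζ₀))⁻¹, Measure.le_iff.mpr fun s hs => ?_⟩
  have hm := h.continuous.measurable
  have h1 : ENNReal.ofReal (jac τ ζ₀) * surf n (τ ⁻¹' s) ≤ surf n s := by
    conv_rhs => rw [← h.map_withDensity, Measure.map_apply hm hs, withDensity_apply _ (hm hs)]
    rw [← setLIntegral_const]
    exact setLIntegral_mono h.continuous_jac.measurable.ennreal_ofReal
      fun ζ _ => ENNReal.ofReal_le_ofReal (hζ₀ (Set.mem_univ ζ))
  rw [Measure.map_apply hm hs, Measure.smul_apply, ENNReal.smul_def, smul_eq_mul, ENNReal.coe_inv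
    (by simpa using hc), ← ENNReal.div_eq_inv_mul]
  rw [ENNReal.le_div_iff_mul_le (Or.inl (by simpa using hc)) (Or.inl ENNReal.coe_ne_top), mul_comm]
  exact h1

section CompL2

variable {A : BlockMat n} {τ : Sph n → Sph n}

lemma IsLinFrac.quasiMeasurePreserving (h : IsLinFrac A τ) :
    Measure.QuasiMeasurePreserving τ (surf n) (surf n) := by
  obtain ⟨C, hC⟩ := h.exists_map_le
  exact ⟨h.continuous.measurable, Measure.absolutelyContinuous_of_le_smul (c := C) hC⟩

lemma IsLinFrac.exists_eLpNorm_comp_le (h : IsLinFrac A τ) : ∃ C : NNReal, ∀ F : L2 n,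
    eLpNorm (F ∘ τ) 2 (surf n) ≤ C * eLpNorm F 2 (surf n) := by
  obtain ⟨C, hC⟩ := h.exists_map_le
  refine ⟨C ^ (1 / 2 : ℝ), fun F => ?_⟩
  have hF : AEStronglyMeasurable F (Measure.map τ (surf n)) :=
    (Lp.aestronglyMeasurable F).mono_ac h.quasiMeasurePreserving.absolutelyContinuous
  rw [← eLpNorm_map_measure hF h.continuous.measurable.aemeasurable]
  refine (eLpNorm_mono_measure _ hC).trans ?_
  rw [eLpNorm_smul_measure_of_ne_top' (by simp)]
  simp [ENNReal.smul_def]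

lemma IsLinFrac.memLp_comp (h : IsLinFrac A τ) (F : L2 n) : MemLp (F ∘ τ) 2 (surf n) := by
  obtain ⟨C, hC⟩ := h.exists_eLpNorm_comp_le
  refine ⟨(Lp.aestronglyMeasurable F).comp_quasiMeasurePreserving h.quasiMeasurePreserving,
    (hC F).trans_lt ?_⟩
  exact ENNReal.mul_lt_top ENNReal.coe_lt_top (Lp.memLp F).2

/-- Composition with a conformal transformation, as a bounded operator of `L²`. -/
def compL2 (h : IsLinFrac A τ) : L2 n →L[ℂ] L2 n :=
  LinearMap.mkContinuousOfExistsBound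
    { toFun := fun F => (h.memLp_comp F).toLp
      map_add' := fun F G => by
        apply Lp.ext
        filter_upwards [(h.memLp_comp (F + G)).coeFn_toLp, (h.memLp_comp F).coeFn_toLp,
          (h.memLp_comp G).coeFn_toLp, Lp.coeFn_add (h.memLp_comp F).toLp (h.memLp_comp G).toLp,
          h.quasiMeasurePreserving.ae (Lp.coeFn_add F G)] with ζ h1 h2 h3 h4 h5
        rw [h1, h4, Pi.add_apply, h2, h3]
        exact h5
      map_smul' := fun c F => by
        apply Lp.ext
        filter_upwards [(h.memLp_comp (c • F)).coeFn_toLp, (h.memLp_comp F).coeFn_toLp,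
          Lp.coeFn_smul c (h.memLp_comp F).toLp,
          h.quasiMeasurePreserving.ae (Lp.coeFn_smul c F)] with ζ h1 h2 h4 h5
        rw [h1, RingHom.id_apply, h4, Pi.smul_apply, h2]
        exact h5 }
    (by
      obtain ⟨C, hC⟩ := h.exists_eLpNorm_comp_le
      refine ⟨C, fun F => ?_⟩
      change ‖(h.memLp_comp F).toLp‖ ≤ _
      rw [Lp.norm_toLp, Lp.norm_def]
      refine (ENNReal.toReal_mono ?_ (hC F)).trans_eq ?_
      · exact (ENNReal.mul_lt_top ENNReal.coe_lt_top (Lp.memLp F).2).ne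
      · rw [ENNReal.toReal_mul, ENNReal.coe_toReal])

lemma coeFn_compL2 (h : IsLinFrac A τ) (F : L2 n) : compL2 h F =ᵐ[surf n] fun ζ => F (τ ζ) :=
  (h.memLp_comp F).coeFn_toLp

lemma compL2_contL2 (h : IsLinFrac A τ) (f : C(Sph n, ℂ)) :
    compL2 h (contL2 n f) = contL2 n (f.comp ⟨τ, h.continuous⟩) := by
  apply Lp.ext
  filter_upwards [coeFn_compL2 h (contL2 n f), coeFn_contL2 (f.comp ⟨τ, h.continuous⟩),
    h.quasiMeasurePreserving.ae (coeFn_contL2 f)] with ζ h1 h2 h3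
  rw [h1, h2, h3]
  rfl

lemma compL2_comp (h : IsLinFrac A τ) {B : BlockMat n} {σ : Sph n → Sph n} (h' : IsLinFrac B σ)
    (hl : Function.RightInverse σ τ) (F : L2 n) : compL2 h' (compL2 h F) = F := by
  apply Lp.ext
  filter_upwards [coeFn_compL2 h' (compL2 h F),
    h'.quasiMeasurePreserving.ae (coeFn_compL2 h F)] with ζ h1 h2
  rw [h1, h2, hl ζ]

lemma integrable_comp_mul_jac (h : IsLinFrac A τ) {f : Sph n → ℝ} (hf : Integrable f (surf n)) :
    Integrable (fun ζ => f (τ ζ) * jac τ ζ) (surf n) ∧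
      ∫ ζ, f (τ ζ) * jac τ ζ ∂(surf n) = ∫ ζ, f ζ ∂(surf n) := by
  have hm := h.continuous.measurable
  have hj := h.continuous_jac.measurable
  have h1 : Integrable f (Measure.map τ ((surf n).withDensity
      fun ζ => ((Real.toNNReal (jac τ ζ) : NNReal) : ℝ≥0∞))) := by
    have := h.map_withDensity
    simp only [ENNReal.ofReal] at this
    rwa [this]
  have e : ∀ ζ, Real.toNNReal (jac τ ζ) • f (τ ζ) = f (τ ζ) * jac τ ζ := by
    intro ζ
    rw [NNReal.smul_def, Real.coe_toNNReal _ (h.jac_pos ζ).le, smul_eq_mul, mul_comm]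
  constructor
  · have h2 := (integrable_map_measure h1.aestronglyMeasurable hm.aemeasurable).mp h1
    rw [integrable_withDensity_iff_integrable_smul₀ hj.real_toNNReal.aemeasurable] at h2
    refine h2.congr (Filter.Eventually.of_forall fun ζ => ?_)
    exact e ζ
  · have h3 := integral_map hm.aemeasurable h1.aestronglyMeasurable
    rw [integral_withDensity_eq_integral_smul hj.real_toNNReal] at h3
    simp only [e] at h3
    rw [← h3]
    have := h.map_withDensity
    simp only [ENNReal.ofReal] at this
    rw [this]

end CompL2

/-! ### The logarithm of the Jacobian, and pullbacks of the kernels -/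

section Pullback

variable {A : BlockMat n} {τ : Sph n → Sph n}

/-- The logarithm of the Jacobian as a continuous function. -/
def logJac (h : IsLinFrac A τ) : C(Sph n, ℂ) where
  toFun ζ := (Real.log (jac τ ζ) : ℂ)
  continuous_toFun := Complex.continuous_ofReal.comp
    (h.continuous_jac.log fun ζ => (h.jac_pos ζ).ne')

/-- The class of `log |J_τ|` in `L²`. -/
def logJacL2 (h : IsLinFrac A τ) : L2 n := contL2 n (logJac h)

lemma memLp_confAct (h : IsLinFrac A τ) (F : L2 n) : MemLp (confAct τ F) 2 (surf n) := by
  refine (h.memLp_comp F).add (g := logJac h) ?_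
  exact (Lp.memLp (contL2 n (logJac h))).ae_eq (coeFn_contL2 (logJac h))

lemma toLp_confAct (h : IsLinFrac A τ) (F : L2 n) (h' : MemLp (confAct τ F) 2 (surf n)) :
    h'.toLp (confAct τ F) = compL2 h F + logJacL2 h := by
  apply Lp.ext
  filter_upwards [h'.coeFn_toLp, Lp.coeFn_add (compL2 h F) (logJacL2 h), coeFn_compL2 h F,
    coeFn_contL2 (logJac h)] with ζ h1 h2 h3 h4
  rw [h1, h2, Pi.add_apply, h3, logJacL2, h4]
  rfl

variable {p q q₀ : CSpace n} {s s₀ : ℂ}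

lemma IsSU.norm_sq_mul (h : IsSU A) (hp : vec p = s • A.mulVec (vec q)) :
    1 - ‖p‖ ^ 2 = ‖s‖ ^ 2 * (1 - ‖q‖ ^ 2) := by
  have h1 := h.one_sub_inner hp hp
  rw [inner_self_eq_norm_sq_to_K, inner_self_eq_norm_sq_to_K, Complex.conj_mul'] at h1
  exact Complex.ofReal_injective (by push_cast; exact h1)

lemma one_sub_norm_sq_pos (hp : ‖p‖ < 1) : 0 < 1 - ‖p‖ ^ 2 := by nlinarith [norm_nonneg p]

lemma IsSU.log_norm (h : IsSU A) (hs : s ≠ 0) (hq : ‖q‖ < 1)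
    (hp : vec p = s • A.mulVec (vec q)) :
    1 / 2 * Real.log (1 - ‖p‖ ^ 2) = Real.log ‖s‖ + 1 / 2 * Real.log (1 - ‖q‖ ^ 2) := by
  rw [h.norm_sq_mul hp, Real.log_mul (by simpa using hs) (one_sub_norm_sq_pos hq).ne',
    Real.log_pow]
  push_cast
  ring

lemma IsSU.log_norm_zero (h : IsSU A) (hs : s₀ ≠ 0) (hq : ‖q₀‖ < 1)
    (hp : vec (0 : CSpace n) = s₀ • A.mulVec (vec q₀)) :
    Real.log ‖s₀‖ = - (1 / 2 * Real.log (1 - ‖q₀‖ ^ 2)) := by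
  have := h.log_norm hs hq hp
  rw [norm_zero, zero_pow two_ne_zero, sub_zero, Real.log_one, mul_zero] at this
  linarith

/-- The function underlying `normKer`. -/
def normKerFun (p : CSpace n) (hp : ‖p‖ < 1) : C(Sph n, ℂ) where
  toFun ζ := ((-Real.log ‖1 - inner ℂ p (ζ : CSpace n)‖ + 1 / 2 * Real.log (1 - ‖p‖ ^ 2) : ℝ) : ℂ)
  continuous_toFun := by
    refine Complex.continuous_ofReal.comp ((Continuous.neg (Continuous.log (by fun_prop) ?_)).add
      continuous_const)
    exact fun ζ => norm_ne_zero_iff.mpr (one_sub_inner_ne_zero hp ζ)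

lemma normKer_eq_contL2 (p : CSpace n) (hp : ‖p‖ < 1) :
    normKer p hp = contL2 n (normKerFun p hp) := by
  apply Lp.ext
  filter_upwards [coeFn_contL2 (normKerFun p hp), coeFn_contL2 (logKer p hp), coeFn_oneL2 (n := n),
    Lp.coeFn_smul (1 / 2 * Real.log (1 - ‖p‖ ^ 2)) (oneL2 n),
    Lp.coeFn_add (kerL2 p hp) ((1 / 2 * Real.log (1 - ‖p‖ ^ 2)) • oneL2 n)] with ζ h1 h2 h3 h4 h5
  rw [h1, normKer, h5, Pi.add_apply, h4, Pi.smul_apply, h3, kerL2, h2]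
  change ((-Real.log ‖1 - inner ℂ p (ζ : CSpace n)‖ : ℝ) : ℂ) + _ = ((_ : ℝ) : ℂ)
  rw [Complex.real_smul]
  push_cast
  ring

/-- J_τ is |den|^{-(2n+2)}, the denominator is a multiple of 1 - ⟨q₀, ζ⟩, and the modulus of the
multiple is (1 - |q₀|²)^{-1/2}, which is the normalization of the kernel. -/
lemma logJacL2_eq (h : IsLinFrac A τ) (hs : s₀ ≠ 0) (hq : ‖q₀‖ < 1)
    (hp : vec (0 : CSpace n) = s₀ • A.mulVec (vec q₀)) :
    logJacL2 h = (2 * (n + 1) : ℝ) • normKer q₀ hq := by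
  rw [normKer_eq_contL2, ← ofReal_smul_eq, ← map_smul, logJacL2]
  congr 1
  ext ζ
  change (Real.log (jac τ ζ) : ℂ) = ((2 * (n + 1) : ℝ) : ℂ) *
    ((-Real.log ‖1 - inner ℂ q₀ (ζ : CSpace n)‖ + 1 / 2 * Real.log (1 - ‖q₀‖ ^ 2) : ℝ) : ℂ)
  rw [← Complex.ofReal_mul]
  congr 1
  rw [h.jac_eq, h.den_eq hp, Real.log_inv, Real.log_pow, norm_mul,
    Real.log_mul (by simpa using hs) (norm_ne_zero_iff.mpr (one_sub_inner_ne_zero hq ζ)),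
    RCLike.norm_conj, h.1.log_norm_zero hs hq hp]
  push_cast
  ring

/-- The logarithm of `IsLinFrac.den_mul`. The terms ½ log(1 - |p|²) in the kernels absorb the
factors of automorphy, so no constant is left over. -/
lemma compL2_normKer (h : IsLinFrac A τ) (hs₀ : s₀ ≠ 0) (hq₀ : ‖q₀‖ < 1)
    (hp₀ : vec (0 : CSpace n) = s₀ • A.mulVec (vec q₀)) (hp : ‖p‖ < 1) (hs : s ≠ 0) (hq : ‖q‖ < 1)
    (hpq : vec p = s • A.mulVec (vec q)) :
    compL2 h (normKer p hp) = normKer q hq - normKer q₀ hq₀ := by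
  rw [normKer_eq_contL2, normKer_eq_contL2, normKer_eq_contL2, compL2_contL2, ← map_sub]
  congr 1
  ext ζ
  change ((-Real.log ‖1 - inner ℂ p (τ ζ : CSpace n)‖ + 1 / 2 * Real.log (1 - ‖p‖ ^ 2) : ℝ) : ℂ) =
    ((-Real.log ‖1 - inner ℂ q (ζ : CSpace n)‖ + 1 / 2 * Real.log (1 - ‖q‖ ^ 2) : ℝ) : ℂ) -
    ((-Real.log ‖1 - inner ℂ q₀ (ζ : CSpace n)‖ + 1 / 2 * Real.log (1 - ‖q₀‖ ^ 2) : ℝ) : ℂ)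
  rw [← Complex.ofReal_sub]
  congr 1
  have h1 := congrArg norm (h.den_mul hpq ζ)
  rw [h.den_eq hp₀] at h1
  simp only [norm_mul, RCLike.norm_conj] at h1
  have h2 := congrArg Real.log h1
  have e1 := norm_ne_zero_iff.mpr (one_sub_inner_ne_zero hp (τ ζ))
  have e2 := norm_ne_zero_iff.mpr (one_sub_inner_ne_zero hq ζ)
  have e3 := norm_ne_zero_iff.mpr (one_sub_inner_ne_zero hq₀ ζ)
  have e4 := norm_ne_zero_iff.mpr hs
  have e5 := norm_ne_zero_iff.mpr hs₀
  rw [Real.log_mul (mul_ne_zero e5 e3) e1, Real.log_mul e5 e3, Real.log_mul e4 e2] at h2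
  rw [h.1.log_norm hs hq hpq]
  rw [h.1.log_norm_zero hs₀ hq₀ hp₀] at h2
  linarith

end Pullback

/-! ### The conditional intertwinor on the kernels -/

/-- The integral over the sphere of the real part. -/
def meanL2 (n : ℕ) : L2 n →L[ℝ] ℝ :=
  Complex.reCLM ∘L ((innerSL ℂ (oneL2 n)).restrictScalars ℝ)

lemma meanL2_eq_integral (F : L2 n) : meanL2 n F = ∫ ζ, (F ζ).re ∂(surf n) := by
  change (inner ℂ (oneL2 n) F).re = _
  rw [L2.inner_def]
  have hi := L2.integrable_inner (𝕜 := ℂ) (oneL2 n) F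
  have := integral_re hi
  refine this.symm.trans (integral_congr_ae ?_)
  filter_upwards [coeFn_oneL2 (n := n)] with ζ h
  rw [h]
  simp

lemma comp_oneL2 {m : ℤ} (hm : m ≠ 0) : comp m (oneL2 n) = 0 := comp_eq_zero hm oneL2_mem

lemma comp_reL2_powL2 (j k : ℕ) (hj : j ≠ 0) (p : CSpace n) :
    comp (j : ℤ) (reL2 n (powL2 k p)) = if j = k then (1 / 2 : ℂ) • powL2 j p else 0 := by
  have h2 : comp (j : ℤ) (conjL2 n (powL2 k p)) = 0 :=
    comp_eq_zero (by omega) (conjL2_mem_harmZ (powL2_mem_harmZ k p))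
  rw [reL2_eq, map_smul, map_add, h2, add_zero]
  split_ifs with h
  · subst h
    rw [comp_eq_self (powL2_mem_harmZ j p)]
  · rw [comp_eq_zero (by exact_mod_cast h) (powL2_mem_harmZ k p), smul_zero]

lemma comp_normKer (j : ℕ) (hj : j ≠ 0) (p : CSpace n) (hp : ‖p‖ < 1) :
    comp (j : ℤ) (normKer p hp) = (1 / (2 * j) : ℂ) • powL2 j p := by
  have h1 := (hasSum_kerL2 p hp).mapL (comp (j : ℤ))
  simp only [map_smul, comp_reL2_powL2 j _ hj] at h1
  have h2 := hasSum_single (f := fun k : ℕ => ((1 / k : ℝ) : ℂ) •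
    (if j = k then (1 / 2 : ℂ) • powL2 j p else 0)) j fun k hk => by
      rw [if_neg (Ne.symm hk), smul_zero]
  rw [normKer, ← ofReal_smul_eq, map_add, map_smul, comp_oneL2 (by exact_mod_cast hj), smul_zero,
    add_zero, h1.unique h2, if_pos rfl, smul_smul]
  congr 1
  push_cast
  field_simp

lemma conjL2_normKer (p : CSpace n) (hp : ‖p‖ < 1) : conjL2 n (normKer p hp) = normKer p hp := by
  rw [normKer, ← ofReal_smul_eq, map_add, conjL2_kerL2, map_smulₛₗ, conjL2_oneL2,
    Complex.conj_ofReal]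

lemma meanL2_oneL2 : meanL2 n (oneL2 n) = surfTotal n := by
  rw [meanL2_eq_integral]
  have : ∫ ζ, (oneL2 n ζ).re ∂(surf n) = ∫ ζ, (1 : ℝ) ∂(surf n) := by
    refine integral_congr_ae ?_
    filter_upwards [coeFn_oneL2 (n := n)] with ζ h
    rw [h, Complex.one_re]
  rw [this, integral_const, smul_eq_mul, mul_one, surfTotal]

lemma meanL2_kerL2 (p : CSpace n) (hp : ‖p‖ < 1) : meanL2 n (kerL2 p hp) = 0 := by
  have h1 := (hasSum_kerL2_real p hp).mapL (meanL2 n)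
  have h2 : ∀ k : ℕ, meanL2 n ((1 / k : ℝ) • reL2 n (powL2 k p)) = 0 := by
    intro k
    rcases eq_or_ne k 0 with rfl | hk
    · simp
    · have e1 : inner ℂ (oneL2 n) (powL2 k p) = 0 :=
        inner_harmZ (by exact_mod_cast hk.symm) oneL2_mem (powL2_mem_harmZ k p)
      have e2 : inner ℂ (oneL2 n) (conjL2 n (powL2 k p)) = 0 :=
        inner_harmZ (by omega) oneL2_mem (conjL2_mem_harmZ (powL2_mem_harmZ k p))
      rw [map_smul]
      change (1 / k : ℝ) • (inner ℂ (oneL2 n) (reL2 n (powL2 k p))).re = 0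
      rw [reL2_eq, inner_smul_right, inner_add_right, e1, e2]
      simp
  simp only [h2] at h1
  exact h1.unique hasSum_zero

lemma meanL2_normKer (p : CSpace n) (hp : ‖p‖ < 1) :
    meanL2 n (normKer p hp) = surfTotal n * (1 / 2 * Real.log (1 - ‖p‖ ^ 2)) := by
  rw [normKer, map_add, meanL2_kerL2, map_smul, meanL2_oneL2, zero_add, smul_eq_mul, mul_comm]

/-- The eigenvalue is (j + n)! / (j - 1)!, which cancels the factorials of the reproducing constant
up to the factor j. This is why the form of A'_Q has a logarithmic kernel. -/
lemma lamWeight_mul_reproConst (j : ℕ) (hj : j ≠ 0) :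
    (lamWeight n (j : ℤ) : ℝ) * reproConst n j = j * (surfTotal n * n.factorial) := by
  obtain ⟨k, rfl⟩ := Nat.exists_eq_succ_of_ne_zero hj
  have h1 : (lamWeight n ((k + 1 : ℕ) : ℤ) : ℝ) * k.factorial = (n + (k + 1)).factorial := by
    have h2 := Nat.factorial_mul_ascFactorial k (n + 1)
    rw [coe_lamWeight, eigenvalueQ, Int.natAbs_natCast, show n + (k + 1) = k + (n + 1) by ring, ← h2,
      Nat.ascFactorial_eq_prod_range]
    push_cast
    rw [mul_comm]
  rw [reproConst, Nat.factorial_succ k]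
  have h0 : ((n + (k + 1)).factorial : ℝ) ≠ 0 := Nat.cast_ne_zero.mpr (Nat.factorial_ne_zero _)
  have h3 : (k.factorial : ℝ) ≠ 0 := Nat.cast_ne_zero.mpr (Nat.factorial_ne_zero _)
  rw [← mul_div_assoc, div_eq_iff h0, ← h1]
  push_cast
  ring

/-- The values of the bilinear form of the conditional intertwinor on the kernels. -/
lemma inner_lamMap_normKer {p q : CSpace n} (hp : ‖p‖ < 1) (hq : ‖q‖ < 1)
    (h1 : normKer p hp ∈ lamDom n) (h2 : normKer q hq ∈ lamDom n) :
    (inner ℂ (lamMap n ⟨normKer p hp, h1⟩) (lamMap n ⟨normKer q hq, h2⟩)).re =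
      surfTotal n * n.factorial / 2 * -Real.log ‖1 - inner ℂ p q‖ := by
  have hs := (hasSum_inner_wMap (P := comp) (w := lamWeight n) ⟨normKer p hp, h1⟩
    ⟨normKer q hq, h2⟩).mapL Complex.reCLM
  have hs' := hs.nat_add_neg
  simp only [lamWeight_zero, NNReal.coe_zero, Complex.ofReal_zero, zero_mul, map_zero,
    add_zero] at hs'
  have hlt : ‖inner ℂ q p‖ < 1 := by
    refine (norm_inner_le_norm _ _).trans_lt ?_
    nlinarith [norm_nonneg p, norm_nonneg q]
  have ht := ((Complex.hasSum_taylorSeries_neg_log hlt).mapL Complex.reCLM).mul_left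
    (surfTotal n * n.factorial / 2)
  refine (hs'.congr_fun (g := fun j : ℕ => surfTotal n * n.factorial / 2 *
    Complex.reCLM ((inner ℂ q p) ^ j / (j : ℂ))) fun j => ?_).unique (ht.congr_fun fun _ => rfl) |>.trans ?_
  · rcases eq_or_ne j 0 with rfl | hj
    · simp [lamWeight_zero]
    · have e1 : comp (-(j : ℤ)) (normKer p hp) = conjL2 n (comp (j : ℤ) (normKer p hp)) := by
        rw [← conjL2_normKer p hp, comp_conjL2, neg_neg, conjL2_normKer]
      have e2 : comp (-(j : ℤ)) (normKer q hq) = conjL2 n (comp (j : ℤ) (normKer q hq)) := by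
        rw [← conjL2_normKer q hq, comp_conjL2, neg_neg, conjL2_normKer]
      have e3 : inner ℂ (comp (j : ℤ) (normKer p hp)) (comp (j : ℤ) (normKer q hq)) =
          ((1 / (4 * j ^ 2) * reproConst n j : ℝ) : ℂ) * (inner ℂ q p) ^ j := by
        rw [comp_normKer j hj, comp_normKer j hj, inner_smul_left, inner_smul_right, inner_powL2]
        simp [map_ofNat (starRingEnd ℂ) 2]
        ring
      have hj' : (j : ℝ) ≠ 0 := Nat.cast_ne_zero.mpr hj
      simp only [Complex.reCLM_apply]
      rw [e1, e2, inner_conjL2, lamWeight_neg, e3]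
      simp only [Complex.re_ofReal_mul, Complex.conj_re, Complex.div_natCast_re]
      have := lamWeight_mul_reproConst (n := n) j hj
      symm
      -- The components j and -j contribute equally, and the coefficient becomes ω n! / (2j), a
      -- multiple of the Taylor coefficient 1/j of -log(1 - z).
      calc _ = (2 * (lamWeight n (j : ℤ) * reproConst n j) / (4 * j ^ 2)) *
            ((inner ℂ q p) ^ j).re := by ring
        _ = _ := by rw [this]; field_simp; ring
  · change _ * (-Complex.log (1 - inner ℂ q p)).re = _
    rw [Complex.neg_re, Complex.log_re, ← inner_conj_symm q p, ← RCLike.norm_conj (1 - inner ℂ p q)]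
    simp

/-! ### Linear combinations with equal Gram matrices -/

lemma norm_linearCombination_sq {κ E : Type*} [NormedAddCommGroup E] [InnerProductSpace ℂ E]
    [NormedSpace ℝ E] [IsScalarTower ℝ ℂ E] (f : κ → E) (c : κ →₀ ℝ) :
    ‖Finsupp.linearCombination ℝ f c‖ ^ 2 =
      ∑ x ∈ c.support, ∑ y ∈ c.support, c x * c y * (inner ℂ (f x) (f y)).re := by
  have hr : ∀ (r : ℝ) (x : E), r • x = (r : ℂ) • x := fun r x => (algebraMap_smul ℂ r x).symm
  rw [Finsupp.linearCombination_apply, Finsupp.sum, norm_sq_eq_re_inner (𝕜 := ℂ), sum_inner,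
    map_sum]
  refine Finset.sum_congr rfl fun x _ => ?_
  rw [inner_sum, map_sum]
  refine Finset.sum_congr rfl fun y _ => ?_
  rw [hr, hr, inner_smul_left, inner_smul_right, Complex.conj_ofReal]
  change (((c x : ℝ) : ℂ) * (((c y : ℝ) : ℂ) * inner ℂ (f x) (f y))).re = _
  rw [Complex.re_ofReal_mul, Complex.re_ofReal_mul, mul_assoc]

/-- This passes the isometry property from the kernels to their combinations without any linear
independence. -/
lemma norm_linearCombination_eq {κ E : Type*} [NormedAddCommGroup E] [InnerProductSpace ℂ E]
    [NormedSpace ℝ E] [IsScalarTower ℝ ℂ E] (f g : κ → E)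
    (h : ∀ x y, (inner ℂ (f x) (f y)).re = (inner ℂ (g x) (g y)).re) (c : κ →₀ ℝ) :
    ‖Finsupp.linearCombination ℝ f c‖ = ‖Finsupp.linearCombination ℝ g c‖ := by
  have h1 : ‖Finsupp.linearCombination ℝ f c‖ ^ 2 = ‖Finsupp.linearCombination ℝ g c‖ ^ 2 := by
    rw [norm_linearCombination_sq, norm_linearCombination_sq]
    simp only [h]
  exact (sq_eq_sq₀ (norm_nonneg _) (norm_nonneg _)).mp h1

lemma mem_wDom_of_tendsto_real {E ι : Type*} [NormedAddCommGroup E] [InnerProductSpace ℂ E]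
    [NormedSpace ℝ E] [IsScalarTower ℝ ℂ E] {P : ι → E →L[ℂ] E} {w : ι → NNReal}
    {S : Submodule ℝ E} {hS : ∀ F ∈ S, F ∈ wDom P w} {u : ℕ → S} {F : E} {a : ℕ → ℝ} {b : ℝ}
    (h : Filter.Tendsto (fun m => (u m : E)) Filter.atTop (nhds F))
    (ha : ∀ m, ‖wMapReal P w S hS (u m)‖ = a m) (hb : Filter.Tendsto a Filter.atTop (nhds b)) :
    ∃ hF : F ∈ wDom P w, ‖wMap P w ⟨F, hF⟩‖ ≤ b := by
  obtain ⟨hL, hle⟩ := mem_wDom_of_tendsto (P := P) (w := w) (u := fun m => ⟨u m, hS _ (u m).2⟩)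
    (C := fun m => a m ^ 2) h (fun m => (congrArg (· ^ 2) (ha m)).le) (hb.pow 2)
  have hb0 : 0 ≤ b := ge_of_tendsto' hb fun m => ha m ▸ norm_nonneg _
  exact ⟨hL, (abs_le_of_sq_le_sq' hle hb0).2⟩

/-! ### Invariance of the pluriharmonic functions -/

lemma mem_lamDom_of_mem_sobolev (hn : 1 ≤ n) {F : L2 n} (hF : F ∈ sobolevRealPluriharmonic n) :
    F ∈ lamDom n :=
  (mem_lamDom_of_mem_sobDom hn (mem_sobolevRealPluriharmonic.mp hF).2).1

/-- The map `lamMap` on `W^{Q/2,2} ∩ RP`. -/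
def realLamMap (hn : 1 ≤ n) : sobolevRealPluriharmonic n →ₗ[ℝ] lp (fun _ : ℤ => L2 n) 2 :=
  wMapReal comp (lamWeight n) (sobolevRealPluriharmonic n) fun _ hF =>
    mem_lamDom_of_mem_sobolev hn hF

lemma norm_realLamMap_le (hn : 1 ≤ n) (F : sobolevRealPluriharmonic n) :
    ‖realLamMap hn F‖ ≤ 2 ^ (n + 1) * ‖realSobMap n F‖ := by
  have h : ‖realLamMap hn F‖ ^ 2 ≤ 4 ^ (n + 1) * ‖realSobMap n F‖ ^ 2 :=
    (mem_lamDom_of_mem_sobDom hn (mem_sobolevRealPluriharmonic.mp F.2).2).2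
  refine (abs_le_of_sq_le_sq' ?_ (by positivity)).2
  rw [mul_pow, ← pow_mul, mul_comm (n + 1), pow_mul]
  norm_num only at h ⊢
  exact h

lemma condForm_eq_realLamMap (hn : 1 ≤ n) (F : sobolevRealPluriharmonic n) :
    condForm (F : L2 n) = ‖realLamMap hn F‖ ^ 2 :=
  condForm_eq (mem_lamDom_of_mem_sobolev hn F.2)

/-- The kernel `normKer p` as an element of `W^{Q/2,2} ∩ RP`. -/
def kerSob (p : Metric.ball (0 : CSpace n) 1) : sobolevRealPluriharmonic n :=
  ⟨normKer (p : CSpace n) (mem_ball_zero_iff.mp p.2),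
    add_mem (kerL2_mem_sobolev _ _) (Submodule.smul_mem _ _ (oneSob n).2)⟩

lemma inner_realLamMap_kerSob (hn : 1 ≤ n) (p q : Metric.ball (0 : CSpace n) 1) :
    (inner ℂ (realLamMap hn (kerSob p)) (realLamMap hn (kerSob q))).re =
      surfTotal n * n.factorial / 2 * -Real.log ‖1 - inner ℂ (p : CSpace n) (q : CSpace n)‖ :=
  inner_lamMap_normKer _ _ _ _

/-- A subspace of `W^{Q/2,2} ∩ RP` that is closed in the Sobolev norm and contains the kernels is
everything. -/
lemma mem_of_kerSob_mem (M : Submodule ℝ (sobolevRealPluriharmonic n))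
    (hcl : ∀ F, (∀ ε : ℝ, 0 < ε → ∃ G ∈ M, ‖realSobMap n (F - G)‖ < ε) → F ∈ M)
    (hker : ∀ p, kerSob p ∈ M) (F : sobolevRealPluriharmonic n) : F ∈ M := by
  have h := sobolevRealPluriharmonic_le (M.map (sobolevRealPluriharmonic n).subtype)
    (fun F hF h => ⟨⟨F, hF⟩, hcl ⟨F, hF⟩ fun ε hε => ?_, rfl⟩)
    (fun p hp => ⟨kerSob ⟨p, mem_ball_zero_iff.mpr hp⟩, hker _, rfl⟩) F.2
  · obtain ⟨G, hG, hGF⟩ := h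
    rwa [← Subtype.ext (a1 := G) (a2 := F) hGF]
  · obtain ⟨_, ⟨G, hG, rfl⟩, hGF⟩ := h ε hε
    refine ⟨G, hG, ?_⟩
    rw [← norm_realSobMap]
    exact hGF

/-- The combinations of the kernels are dense in `W^{Q/2,2} ∩ RP`. -/
lemma exists_linearCombination_kerSob (F : sobolevRealPluriharmonic n) {ε : ℝ} (hε : 0 < ε) :
    ∃ c, ‖realSobMap n (F - Finsupp.linearCombination ℝ kerSob c)‖ < ε := by
  set S0 := Submodule.span ℝ (Set.range (kerSob (n := n))) with hS0
  set V := (S0.map (realSobMap n)).topologicalClosure with hV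
  have hF : F ∈ V.comap (realSobMap n) := by
    refine mem_of_kerSob_mem _ (fun F h => ?_) (fun p => ?_) F
    · change realSobMap n F ∈ V
      have hc : IsClosed (V : Set (lp (fun _ : ℤ => L2 n) 2)) :=
        Submodule.isClosed_topologicalClosure _
      rw [← SetLike.mem_coe, ← hc.closure_eq, Metric.mem_closure_iff]
      intro ε hε
      obtain ⟨G, hG, hGF⟩ := h ε hε
      exact ⟨realSobMap n G, hG, by rwa [dist_eq_norm, ← map_sub]⟩
    · exact Submodule.le_topologicalClosure _ ⟨kerSob p, Submodule.subset_span ⟨p, rfl⟩, rfl⟩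
  obtain ⟨_, ⟨G, hG, rfl⟩, hFG⟩ := Metric.mem_closure_iff.mp hF ε hε
  obtain ⟨c, rfl⟩ := (Finsupp.mem_span_range_iff_exists_finsupp).mp hG
  refine ⟨c, ?_⟩
  rw [dist_eq_norm, ← map_sub] at hFG
  exact hFG

section Invariance

variable {A : BlockMat n} {τ : Sph n → Sph n}

lemma exists_ball_data (hA : IsSU A) (p : Metric.ball (0 : CSpace n) 1) :
    ∃ (q : Metric.ball (0 : CSpace n) 1) (s : ℂ), s ≠ 0 ∧
      vec (p : CSpace n) = s • A.mulVec (vec (q : CSpace n)) := by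
  obtain ⟨s, q, hs, hq, h⟩ := exists_vec_eq_of_hForm_neg hA (mem_ball_zero_iff.mp p.2)
  exact ⟨⟨q, mem_ball_zero_iff.mpr hq⟩, s, hs, h⟩

/-- The action of the matrix `A⁻¹` on the ball. -/
def ballInv (hA : IsSU A) (p : Metric.ball (0 : CSpace n) 1) : Metric.ball (0 : CSpace n) 1 :=
  (exists_ball_data hA p).choose

/-- The factor of automorphy of `A⁻¹` on the ball. -/
def ballFactor (hA : IsSU A) (p : Metric.ball (0 : CSpace n) 1) : ℂ :=
  (exists_ball_data hA p).choose_spec.choose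

lemma ballFactor_ne_zero (hA : IsSU A) (p : Metric.ball (0 : CSpace n) 1) : ballFactor hA p ≠ 0 :=
  (exists_ball_data hA p).choose_spec.choose_spec.1

lemma vec_eq_ballInv (hA : IsSU A) (p : Metric.ball (0 : CSpace n) 1) :
    vec (p : CSpace n) = ballFactor hA p • A.mulVec (vec (ballInv hA p : CSpace n)) :=
  (exists_ball_data hA p).choose_spec.choose_spec.2

/-- The center of the ball. -/
def ballZero (n : ℕ) : Metric.ball (0 : CSpace n) 1 := ⟨0, Metric.mem_ball_self one_pos⟩

lemma logJacL2_eq_kerSob (h : IsLinFrac A τ) :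
    logJacL2 h = (2 * (n + 1) : ℝ) • (kerSob (ballInv h.1 (ballZero n)) : L2 n) :=
  logJacL2_eq h (ballFactor_ne_zero h.1 _) _ (vec_eq_ballInv h.1 (ballZero n))

/-- The pullbacks of the kernels. -/
def kerPull (hA : IsSU A) (p : Metric.ball (0 : CSpace n) 1) : sobolevRealPluriharmonic n :=
  kerSob (ballInv hA p) - kerSob (ballInv hA (ballZero n))

lemma compL2_kerSob (h : IsLinFrac A τ) (p : Metric.ball (0 : CSpace n) 1) :
    compL2 h (kerSob p : L2 n) = kerPull h.1 p :=
  compL2_normKer h (ballFactor_ne_zero h.1 _) _ (vec_eq_ballInv h.1 (ballZero n)) _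
    (ballFactor_ne_zero h.1 _) _ (vec_eq_ballInv h.1 p)

lemma IsSU.log_norm_one_sub_inner (hA : IsSU A) (p p' : Metric.ball (0 : CSpace n) 1) :
    Real.log ‖1 - inner ℂ (p : CSpace n) (p' : CSpace n)‖ =
      Real.log ‖ballFactor hA p‖ + Real.log ‖ballFactor hA p'‖ +
        Real.log ‖1 - inner ℂ (ballInv hA p : CSpace n) (ballInv hA p' : CSpace n)‖ := by
  have h1 := hA.one_sub_inner (vec_eq_ballInv hA p) (vec_eq_ballInv hA p')
  have hne : 1 - inner ℂ (ballInv hA p : CSpace n) (ballInv hA p' : CSpace n) ≠ 0 := by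
    intro h0
    have h2 := norm_inner_le_norm (𝕜 := ℂ) (ballInv hA p : CSpace n) (ballInv hA p' : CSpace n)
    rw [← sub_eq_zero.mp h0, norm_one] at h2
    have h3 := mem_ball_zero_iff.mp (ballInv hA p).2
    have h4 := mem_ball_zero_iff.mp (ballInv hA p').2
    nlinarith [norm_nonneg (ballInv hA p : CSpace n), norm_nonneg (ballInv hA p' : CSpace n)]
  rw [h1, norm_mul, norm_mul, RCLike.norm_conj, Real.log_mul, Real.log_mul]
  · exact norm_ne_zero_iff.mpr (ballFactor_ne_zero hA p)
  · exact norm_ne_zero_iff.mpr (ballFactor_ne_zero hA p')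
  · exact mul_ne_zero (norm_ne_zero_iff.mpr (ballFactor_ne_zero hA p))
      (norm_ne_zero_iff.mpr (ballFactor_ne_zero hA p'))
  · exact norm_ne_zero_iff.mpr hne

/-- The ball action changes log|1 - ⟨p, p'⟩| by a function of p plus the same function of p'.
Subtracting the kernel at the image of the center removes both, since log|1 - ⟨p, p'⟩| vanishes when
either point is the center. -/
lemma inner_realLamMap_kerPull (hn : 1 ≤ n) (hA : IsSU A) (p p' : Metric.ball (0 : CSpace n) 1) :
    (inner ℂ (realLamMap hn (kerPull hA p)) (realLamMap hn (kerPull hA p'))).re =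
      (inner ℂ (realLamMap hn (kerSob p)) (realLamMap hn (kerSob p'))).re := by
  have h1 := hA.log_norm_one_sub_inner p p'
  have h2 := hA.log_norm_one_sub_inner p (ballZero n)
  have h3 := hA.log_norm_one_sub_inner (ballZero n) p'
  have h4 := hA.log_norm_one_sub_inner (ballZero n) (ballZero n)
  have e1 : ∀ q : CSpace n, Real.log ‖1 - inner ℂ q (ballZero n : CSpace n)‖ = 0 := by
    intro q; simp [ballZero]
  have e2 : ∀ q : CSpace n, Real.log ‖1 - inner ℂ (ballZero n : CSpace n) q‖ = 0 := by
    intro q; simp [ballZero]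
  rw [e1] at h2 h4
  rw [e2] at h3
  rw [kerPull, kerPull, map_sub, map_sub, inner_sub_left, inner_sub_right, inner_sub_right]
  simp only [Complex.sub_re, inner_realLamMap_kerSob]
  rw [h1]
  linear_combination (surfTotal n * n.factorial / 2) * (h4 - h2 - h3)

/-- The functions whose pullback lies in RP form a closed subspace that contains the kernels, so the
minimality theorem already implies invariance. -/
lemma realPluriharmonic_comp (hn : 1 ≤ n) (h : IsLinFrac A τ) {F : L2 n}
    (hF : F ∈ realPluriharmonic n) : compL2 h F ∈ realPluriharmonic n := by
  set M : Submodule ℝ (L2 n) :=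
    (realPluriharmonic n).comap ((compL2 h).restrictScalars ℝ).toLinearMap with hM
  refine realPluriharmonic_le hn M ?_ (fun p hp => ?_) hF
  · exact isClosed_realPluriharmonic.preimage (compL2 h).continuous
  · change compL2 h (normKer p hp) ∈ realPluriharmonic n
    exact (compL2_kerSob h ⟨p, mem_ball_zero_iff.mpr hp⟩) ▸ (kerPull h.1 _).2.2

lemma coe_linearCombination_kerPull (h : IsLinFrac A τ)
    (c : Metric.ball (0 : CSpace n) 1 →₀ ℝ) :
    compL2 h (Finsupp.linearCombination ℝ kerSob c : sobolevRealPluriharmonic n) =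
      (Finsupp.linearCombination ℝ (kerPull h.1) c : sobolevRealPluriharmonic n) := by
  have h1 := Finsupp.apply_linearCombination ℝ
    (((compL2 h).restrictScalars ℝ).toLinearMap ∘ₗ (sobolevRealPluriharmonic n).subtype) kerSob c
  have h2 := Finsupp.apply_linearCombination ℝ (sobolevRealPluriharmonic n).subtype
    (kerPull h.1) c
  refine h1.trans (Eq.trans ?_ h2.symm)
  congr 2
  funext p
  exact compL2_kerSob h p

/-- Approximate F by combinations of kernels in the Sobolev norm. Their pullbacks have the same form
norms and are known to converge only in L²; lower semicontinuity then bounds the form of the limit.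
Equality is obtained later from the inverse of τ. -/
lemma exists_comp_mem_sobolev (hn : 1 ≤ n) (h : IsLinFrac A τ) (F : sobolevRealPluriharmonic n) :
    ∃ hF : compL2 h (F : L2 n) ∈ sobolevRealPluriharmonic n,
      ‖realLamMap hn ⟨compL2 h (F : L2 n), hF⟩‖ ≤ ‖realLamMap hn F‖ := by
  have hR := realPluriharmonic_comp hn h F.2.2
  choose c hc using fun k : ℕ => exists_linearCombination_kerSob F
    (ε := 1 / ((k : ℝ) + 1)) (by positivity)
  set G : ℕ → sobolevRealPluriharmonic n := fun k => Finsupp.linearCombination ℝ kerSob (c k) with hG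
  set G' : ℕ → sobolevRealPluriharmonic n :=
    fun k => Finsupp.linearCombination ℝ (kerPull h.1) (c k) with hG'
  have hnorm : ∀ k, ‖realLamMap hn (G' k)‖ = ‖realLamMap hn (G k)‖ := by
    intro k
    rw [hG, hG']
    simp only [Finsupp.apply_linearCombination]
    exact norm_linearCombination_eq _ _ (fun p p' => inner_realLamMap_kerPull hn h.1 p p') (c k)
  have h0 : Filter.Tendsto (fun k => ‖realSobMap n (F - G k)‖) Filter.atTop (nhds 0) :=
    squeeze_zero (fun _ => norm_nonneg _) (fun k => (hc k).le) tendsto_one_div_add_atTop_nhds_zero_nat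
  have hGF : Filter.Tendsto (fun k => (G k : L2 n)) Filter.atTop (nhds (F : L2 n)) := by
    rw [tendsto_iff_norm_sub_tendsto_zero]
    refine squeeze_zero (fun _ => norm_nonneg _) (fun k => ?_)
      (by have := h0.const_mul (2 ^ (n + 1)); rwa [mul_zero] at this)
    rw [norm_sub_rev]
    exact norm_le_realSobMap hn (F - G k)
  have hG'F : Filter.Tendsto (fun k => (G' k : L2 n)) Filter.atTop (nhds (compL2 h (F : L2 n))) := by
    have := ((compL2 h).continuous.tendsto (F : L2 n)).comp hGF
    refine this.congr fun k => ?_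
    exact coe_linearCombination_kerPull h (c k)
  have hLam : Filter.Tendsto (fun k => ‖realLamMap hn (G k)‖) Filter.atTop
      (nhds ‖realLamMap hn F‖) := by
    have h1 : Filter.Tendsto (fun k => realLamMap hn (G k)) Filter.atTop (nhds (realLamMap hn F)) := by
      rw [tendsto_iff_norm_sub_tendsto_zero]
      refine squeeze_zero (fun _ => norm_nonneg _) (fun k => ?_)
        (by have := h0.const_mul (2 ^ (n + 1)); rwa [mul_zero] at this)
      rw [norm_sub_rev, ← map_sub]
      exact norm_realLamMap_le hn (F - G k)
    exact h1.norm
  obtain ⟨hL, hle⟩ := mem_wDom_of_tendsto_real (u := G') hG'F hnorm hLam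
  exact ⟨mem_sobolevRealPluriharmonic.mpr ⟨hR, (mem_sobDom_of_mem_lamDom hR.1 hL).1⟩, hle⟩

/-- Composition with a conformal transformation on `W^{Q/2,2} ∩ RP`. -/
def compSob (hn : 1 ≤ n) (h : IsLinFrac A τ) :
    sobolevRealPluriharmonic n →ₗ[ℝ] sobolevRealPluriharmonic n :=
  (((compL2 h).restrictScalars ℝ).toLinearMap ∘ₗ (sobolevRealPluriharmonic n).subtype).codRestrict
    (sobolevRealPluriharmonic n) fun F => (exists_comp_mem_sobolev hn h F).1

/-- The quadratic form of the conditional intertwinor is conformally invariant. -/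
lemma norm_realLamMap_compSob (hn : 1 ≤ n) (h : IsLinFrac A τ) (F : sobolevRealPluriharmonic n) :
    ‖realLamMap hn (compSob hn h F)‖ = ‖realLamMap hn F‖ := by
  obtain ⟨σ, hσ, hl, hr⟩ := h.exists_inverse
  refine le_antisymm (exists_comp_mem_sobolev hn h F).2 ?_
  have h1 : compSob hn hσ (compSob hn h F) = F := Subtype.ext (compL2_comp h hσ hr F)
  have h2 : ‖realLamMap hn (compSob hn hσ (compSob hn h F))‖ ≤ ‖realLamMap hn (compSob hn h F)‖ :=
    (exists_comp_mem_sobolev hn hσ (compSob hn h F)).2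
  rwa [h1] at h2

end Invariance

/-! ### Real-linear functionals and the expansion of the quadratic form -/

/-- The real part of the inner product with a fixed vector. -/
def reInner {E : Type*} [NormedAddCommGroup E] [InnerProductSpace ℂ E]
    [NormedSpace ℝ E] [IsScalarTower ℝ ℂ E] (v : E) : E →ₗ[ℝ] ℝ where
  toFun x := (inner ℂ v x).re
  map_add' x y := by rw [inner_add_right, Complex.add_re]
  map_smul' r x := by
    have hr : r • x = (r : ℂ) • x := (algebraMap_smul ℂ r x).symm
    rw [hr, inner_smul_right, Complex.re_ofReal_mul, RingHom.id_apply, smul_eq_mul]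

lemma reInner_apply {E : Type*} [NormedAddCommGroup E] [InnerProductSpace ℂ E]
    [NormedSpace ℝ E] [IsScalarTower ℝ ℂ E] (v x : E) : reInner v x = (inner ℂ v x).re := rfl

lemma abs_reInner_le {E : Type*} [NormedAddCommGroup E] [InnerProductSpace ℂ E]
    [NormedSpace ℝ E] [IsScalarTower ℝ ℂ E] (v x : E) : |reInner v x| ≤ ‖v‖ * ‖x‖ :=
  (Complex.abs_re_le_norm _).trans (norm_inner_le_norm _ _)

lemma norm_add_smul_sq {E : Type*} [NormedAddCommGroup E] [InnerProductSpace ℂ E]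
    [NormedSpace ℝ E] [IsScalarTower ℝ ℂ E] (x v : E) (r : ℝ) :
    ‖x + r • v‖ ^ 2 = ‖x‖ ^ 2 + 2 * r * reInner v x + r ^ 2 * reInner v v := by
  have hr : r • v = (r : ℂ) • v := (algebraMap_smul ℂ r v).symm
  have h1 := norm_add_sq (𝕜 := ℂ) x (r • v)
  have h2 : RCLike.re (inner ℂ x (r • v)) = r * reInner v x := by
    rw [inner_re_symm, reInner_apply, hr, inner_smul_left, Complex.conj_ofReal]
    exact Complex.re_ofReal_mul _ _
  have h3 : reInner v v = ‖v‖ ^ 2 := (norm_sq_eq_re_inner (𝕜 := ℂ) v).symm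
  rw [h1, h2, h3, norm_smul, Real.norm_eq_abs, mul_pow, sq_abs]
  ring

/-! ### The mean value of a pullback -/

lemma meanL2_kerSob (p : Metric.ball (0 : CSpace n) 1) :
    meanL2 n (kerSob p : L2 n) = surfTotal n * (1 / 2 * Real.log (1 - ‖(p : CSpace n)‖ ^ 2)) :=
  meanL2_normKer _ _

/-- A linear functional that is bounded in the Sobolev norm and vanishes on the kernels is zero. -/
lemma eq_zero_of_kerSob (Φ : sobolevRealPluriharmonic n →ₗ[ℝ] ℝ) {K : ℝ} (hK : 0 ≤ K)
    (hΦ : ∀ F, |Φ F| ≤ K * ‖realSobMap n F‖) (h : ∀ p, Φ (kerSob p) = 0)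
    (F : sobolevRealPluriharmonic n) : Φ F = 0 := by
  refine mem_of_kerSob_mem (LinearMap.ker Φ) (fun F hF => ?_) h F
  rw [LinearMap.mem_ker, ← abs_eq_zero]
  refine le_antisymm (le_of_forall_pos_lt_add fun ε hε => ?_) (abs_nonneg _)
  obtain ⟨G, hG, hFG⟩ := hF (ε / (K + 1)) (by positivity)
  have h1 := hΦ (F - G)
  rw [map_sub Φ, LinearMap.mem_ker.mp hG, sub_zero] at h1
  rw [lt_div_iff₀ (by positivity)] at hFG
  nlinarith [norm_nonneg (realSobMap n (F - G))]

section Invariance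

variable {A : BlockMat n} {τ : Sph n → Sph n}

lemma compSob_kerSob (hn : 1 ≤ n) (h : IsLinFrac A τ) (p : Metric.ball (0 : CSpace n) 1) :
    compSob hn h (kerSob p) = kerPull h.1 p := Subtype.ext (compL2_kerSob h p)

lemma reInner_kerSob (hn : 1 ≤ n) (p q : Metric.ball (0 : CSpace n) 1) :
    reInner (realLamMap hn (kerSob p)) (realLamMap hn (kerSob q)) =
      surfTotal n * n.factorial / 2 * -Real.log ‖1 - inner ℂ (p : CSpace n) (q : CSpace n)‖ :=
  inner_realLamMap_kerSob hn p q

lemma log_ballFactor_zero (hA : IsSU A) : Real.log ‖ballFactor hA (ballZero n)‖ =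
    -(1 / 2 * Real.log (1 - ‖(ballInv hA (ballZero n) : CSpace n)‖ ^ 2)) :=
  hA.log_norm_zero (ballFactor_ne_zero hA _) (mem_ball_zero_iff.mp (ballInv hA (ballZero n)).2)
    (vec_eq_ballInv hA (ballZero n))

lemma log_inner_ballZero (p : CSpace n) :
    Real.log ‖1 - inner ℂ (ballZero n : CSpace n) p‖ = 0 := by simp [ballZero]

/-- The conformal behaviour of the mean value. -/
lemma meanL2_compSob (hn : 1 ≤ n) (h : IsLinFrac A τ) (F : sobolevRealPluriharmonic n) :
    surfTotal n * reInner (realLamMap hn (kerSob (ballInv h.1 (ballZero n))))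
        (realLamMap hn (compSob hn h F)) +
      surfTotal n * n.factorial / 2 * meanL2 n (compSob hn h F : L2 n) =
      surfTotal n * n.factorial / 2 * meanL2 n (F : L2 n) := by
  set v := realLamMap hn (kerSob (ballInv h.1 (ballZero n))) with hv
  set m : sobolevRealPluriharmonic n →ₗ[ℝ] ℝ :=
    (meanL2 n).toLinearMap ∘ₗ (sobolevRealPluriharmonic n).subtype with hm
  have hmv : ∀ F, m F = meanL2 n (F : L2 n) := fun F => rfl
  set c := surfTotal n * n.factorial / 2 with hc
  have hω := surfTotal_pos (n := n)
  have hc0 : 0 ≤ c := by positivity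
  -- The difference of the two sides is linear and bounded in the Sobolev norm, so it suffices to
  -- check kernels, where c is the constant of the Gram matrix and the claim is a relation between
  -- logarithms of factors of automorphy.
  set Φ : sobolevRealPluriharmonic n →ₗ[ℝ] ℝ :=
    surfTotal n • (reInner v ∘ₗ realLamMap hn ∘ₗ compSob hn h) + c • (m ∘ₗ compSob hn h) - c • m
    with hΦ
  have hΦF : ∀ F, Φ F = surfTotal n * reInner v (realLamMap hn (compSob hn h F)) +
      c * meanL2 n (compSob hn h F : L2 n) - c * meanL2 n (F : L2 n) := fun F => rfl
  have hbound : ∀ F, |Φ F| ≤ (surfTotal n * (‖v‖ * 2 ^ (n + 1)) +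
      c * (‖meanL2 n‖ * (‖compL2 h‖ * 2 ^ (n + 1))) + c * (‖meanL2 n‖ * 2 ^ (n + 1))) *
      ‖realSobMap n F‖ := by
    intro F
    have b1 : |surfTotal n * reInner v (realLamMap hn (compSob hn h F))| ≤
        surfTotal n * (‖v‖ * (2 ^ (n + 1) * ‖realSobMap n F‖)) := by
      rw [abs_mul, abs_of_pos hω]
      refine mul_le_mul_of_nonneg_left ((abs_reInner_le _ _).trans ?_) hω.le
      rw [norm_realLamMap_compSob]
      exact mul_le_mul_of_nonneg_left (norm_realLamMap_le hn F) (norm_nonneg _)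
    have b3 : ‖(F : L2 n)‖ ≤ 2 ^ (n + 1) * ‖realSobMap n F‖ := norm_le_realSobMap hn F
    have b2 : |c * meanL2 n (compSob hn h F : L2 n)| ≤
        c * (‖meanL2 n‖ * (‖compL2 h‖ * (2 ^ (n + 1) * ‖realSobMap n F‖))) := by
      rw [abs_mul, abs_of_nonneg hc0]
      refine mul_le_mul_of_nonneg_left (((meanL2 n).le_opNorm _).trans ?_) hc0
      refine mul_le_mul_of_nonneg_left (((compL2 h).le_opNorm _).trans ?_) (norm_nonneg _)
      exact mul_le_mul_of_nonneg_left b3 (norm_nonneg _)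
    have b4 : |c * meanL2 n (F : L2 n)| ≤ c * (‖meanL2 n‖ * (2 ^ (n + 1) * ‖realSobMap n F‖)) := by
      rw [abs_mul, abs_of_nonneg hc0]
      refine mul_le_mul_of_nonneg_left (((meanL2 n).le_opNorm _).trans ?_) hc0
      exact mul_le_mul_of_nonneg_left b3 (norm_nonneg _)
    rw [hΦF]
    refine (abs_sub _ _).trans ((add_le_add (abs_add_le _ _) le_rfl).trans
      ((add_le_add (add_le_add b1 b2) b4).trans_eq ?_))
    ring
  have hker : ∀ p, Φ (kerSob p) = 0 := by
    intro p
    rw [hΦF, compSob_kerSob, kerPull, map_sub, map_sub, hv, reInner_kerSob, reInner_kerSob,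
      Submodule.coe_sub, map_sub, meanL2_kerSob, meanL2_kerSob, meanL2_kerSob]
    have h2 := h.1.log_norm_one_sub_inner (ballZero n) p
    have h4 := h.1.log_norm_one_sub_inner (ballZero n) (ballZero n)
    have h5 := h.1.log_norm (ballFactor_ne_zero h.1 p) (mem_ball_zero_iff.mp (ballInv h.1 p).2)
      (vec_eq_ballInv h.1 p)
    have h6 := log_ballFactor_zero h.1
    rw [log_inner_ballZero] at h2 h4
    linear_combination (c * surfTotal n) * (h2 - h4 - h5 - h6)
  have := eq_zero_of_kerSob Φ (by positivity) hbound hker F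
  rw [hΦF] at this
  linarith

/-! ### Invariant subspaces -/

lemma realPluriharmonic_isInvariant (hn : 1 ≤ n) : IsInvariant (realPluriharmonic n) := by
  intro τ hτ F hF
  obtain ⟨A, h⟩ := isConformal_iff.mp hτ
  refine ⟨memLp_confAct h F, ?_⟩
  rw [toLp_confAct h, logJacL2_eq_kerSob h]
  exact add_mem (realPluriharmonic_comp hn h hF) (Submodule.smul_mem _ _ (kerSob _).2.2)

/-- The conformal action on `W^{Q/2,2} ∩ RP`. -/
lemma toLp_confAct_eq_coe (hn : 1 ≤ n) (h : IsLinFrac A τ) (F : sobolevRealPluriharmonic n)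
    (h' : MemLp (confAct τ (F : L2 n)) 2 (surf n)) :
    h'.toLp (confAct τ (F : L2 n)) = ((compSob hn h F +
      (2 * (n + 1) : ℝ) • kerSob (ballInv h.1 (ballZero n)) : sobolevRealPluriharmonic n) : L2 n) := by
  rw [toLp_confAct h, logJacL2_eq_kerSob h]
  rfl

lemma sobolevRealPluriharmonic_isInvariant (hn : 1 ≤ n) :
    IsInvariant (sobolevRealPluriharmonic n) := by
  intro τ hτ F hF
  obtain ⟨A, h⟩ := isConformal_iff.mp hτ
  refine ⟨memLp_confAct h F, ?_⟩
  rw [toLp_confAct_eq_coe hn h ⟨F, hF⟩]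
  exact Subtype.coe_prop _

/-- A linear subspace contains 0, hence by invariance every log|J_τ|; for the boost that moves p to
the center this is a nonzero multiple of `normKer p`. -/
lemma normKer_mem_of_isInvariant {M : Submodule ℝ (L2 n)} (hM : IsInvariant M) (p : CSpace n)
    (hp : ‖p‖ < 1) : normKer p hp ∈ M := by
  obtain ⟨A, s, hA, hs⟩ := exists_boost p hp
  obtain ⟨τ, h⟩ := exists_isLinFrac hA
  obtain ⟨h', hmem⟩ := hM τ (isConformal_iff.mpr ⟨A, h⟩) 0 (zero_mem M)
  have hs0 : s ≠ 0 := by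
    rintro rfl
    have := congrFun hs (Sum.inr ())
    simp [vec] at this
  rw [toLp_confAct h, map_zero, zero_add, logJacL2_eq h hs0 hp hs] at hmem
  have h2 := M.smul_mem (2 * (n + 1) : ℝ)⁻¹ hmem
  rwa [smul_smul, inv_mul_cancel₀ (by positivity), one_smul] at h2

theorem isLeast_realPluriharmonic (hn : 1 ≤ n) :
    IsLeast {M : Submodule ℝ (L2 n) | IsClosed (M : Set (L2 n)) ∧ IsInvariant M}
      (realPluriharmonic n) :=
  ⟨⟨isClosed_realPluriharmonic, realPluriharmonic_isInvariant hn⟩, fun M hM =>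
    realPluriharmonic_le hn M hM.1 fun p hp => normKer_mem_of_isInvariant hM.2 p hp⟩

theorem isLeast_sobolevRealPluriharmonic (hn : 1 ≤ n) :
    IsLeast {M : Submodule ℝ (L2 n) | IsClosedInSobolev (halfQ n) M ∧ IsInvariant M}
      (sobolevRealPluriharmonic n) :=
  ⟨⟨isClosedInSobolev_sobolevRealPluriharmonic hn, sobolevRealPluriharmonic_isInvariant hn⟩,
    fun M hM => sobolevRealPluriharmonic_le M (fun F hF => hM.1.2 F hF.1)
      fun p hp => normKer_mem_of_isInvariant hM.2 p hp⟩

/-! ### Invariance of the Beckner-Onofri functional -/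

lemma average_re (F : L2 n) : ⨍ ζ, (F ζ).re ∂(surf n) = (surfTotal n)⁻¹ * meanL2 n F := by
  rw [average_eq, meanL2_eq_integral, smul_eq_mul, surfTotal]

lemma average_exp_confAct (h : IsLinFrac A τ) (F : L2 n)
    (hF : Integrable (fun ζ => Real.exp (F ζ).re) (surf n))
    (h' : MemLp (confAct τ F) 2 (surf n)) :
    ⨍ ζ, Real.exp (h'.toLp (confAct τ F) ζ).re ∂(surf n) = ⨍ ζ, Real.exp (F ζ).re ∂(surf n) := by
  rw [average_eq, average_eq, ← (integrable_comp_mul_jac h hF).2]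
  congr 1
  refine integral_congr_ae ?_
  filter_upwards [h'.coeFn_toLp] with ζ hζ
  rw [hζ, confAct, Complex.add_re, Complex.ofReal_re, Real.exp_add, Real.exp_log (h.jac_pos ζ)]

/-- Write log|J_τ| = 2(n+1) k with k a kernel, and expand the form at F ∘ τ + 2(n+1) k. With the
constant 1 / (2(n+1)!), the cross term compensates the difference between the means of F and F ∘ τ,
and the diagonal term compensates the mean of log|J_τ|. -/
theorem becknerOnofri_confAct (hn : 1 ≤ n) (h : IsLinFrac A τ) (F : sobolevRealPluriharmonic n)
    (hF : Integrable (fun ζ => Real.exp ((F : L2 n) ζ).re) (surf n))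
    (h' : MemLp (confAct τ (F : L2 n)) 2 (surf n)) :
    becknerOnofri (h'.toLp (confAct τ (F : L2 n))) = becknerOnofri (F : L2 n) := by
  rw [becknerOnofri, becknerOnofri, average_exp_confAct h _ hF, toLp_confAct_eq_coe hn h]
  congr 1
  rw [average_re, average_re, condForm_eq_realLamMap hn, condForm_eq_realLamMap hn, map_add,
    map_smul, norm_add_smul_sq, norm_realLamMap_compSob, Submodule.coe_add, Submodule.coe_smul,
    map_add, map_smul, meanL2_kerSob, smul_eq_mul]
  have h1 := meanL2_compSob hn h F
  rw [reInner_kerSob]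
  have h4 := h.1.log_norm_one_sub_inner (ballZero n) (ballZero n)
  have h6 := log_ballFactor_zero h.1
  rw [log_inner_ballZero] at h4
  have hω := surfTotal_pos (n := n)
  have hf : (0 : ℝ) < n.factorial := Nat.cast_pos.mpr (Nat.factorial_pos n)
  change _ * ((surfTotal n)⁻¹ * _) + _ = _ * ((surfTotal n)⁻¹ * _) + _
  rw [Nat.factorial_succ]
  push_cast
  generalize reInner (realLamMap hn (kerSob (ballInv h.1 (ballZero n))))
        (realLamMap hn (compSob hn h F)) = X at *
  generalize meanL2 n (compSob hn h F : L2 n) = Y at *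
  generalize meanL2 n (F : L2 n) = Z at *
  generalize ‖realLamMap hn F‖ ^ 2 = B at *
  generalize Real.log ‖ballFactor h.1 (ballZero n)‖ = l at *
  have e1 : Real.log ‖1 - inner ℂ (ballInv h.1 (ballZero n) : CSpace n)
    (ballInv h.1 (ballZero n) : CSpace n)‖ = -2 * l := by linarith
  have e2 : 1 / 2 * Real.log (1 - ‖(ballInv h.1 (ballZero n) : CSpace n)‖ ^ 2) = - l := by linarith
  rw [e1, e2]
  -- `meanL2_compSob` solved for the mean of the pullback.
  have e3 : Y = Z - 2 * X / n.factorial := by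
    field_simp
    have := mul_left_cancel₀ hω.ne' (show surfTotal n * (2 * X + n.factorial * Y) =
      surfTotal n * (n.factorial * Z) by linear_combination 2 * h1)
    linarith
  rw [e3]
  field_simp
  ring

end Invariance

/-! ### Exponential integrability -/

/-- Slice by unit levels: the level k contributes at most e^{t+k+1} B 4^{-k}, which is summable
because e < 4. -/
lemma lintegral_exp_lt_top {α : Type*} [MeasurableSpace α] {μ : Measure α} [IsFiniteMeasure μ]
    {g : α → ℝ} (hg : Measurable g) {t B : ℝ} (hB : 0 ≤ B)
    (h : ∀ k : ℕ, μ {x | t + k ≤ g x} ≤ ENNReal.ofReal (B * (1 / 4) ^ k)) :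
    ∫⁻ x, ENNReal.ofReal (Real.exp (g x)) ∂μ < ⊤ := by
  have hs : ∀ k : ℕ, MeasurableSet {x | t + k ≤ g x} := fun k => measurableSet_le measurable_const hg
  have hpt : ∀ x, ENNReal.ofReal (Real.exp (g x)) ≤ ENNReal.ofReal (Real.exp t) +
      ∑' k : ℕ, Set.indicator {x | t + k ≤ g x}
        (fun _ => ENNReal.ofReal (Real.exp (t + k + 1))) x := by
    intro x
    rcases le_or_gt t (g x) with hx | hx
    · have h1 : t + (⌊g x - t⌋₊ : ℝ) ≤ g x := by linarith [Nat.floor_le (sub_nonneg.mpr hx)]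
      have h2 : g x ≤ t + (⌊g x - t⌋₊ : ℝ) + 1 := by linarith [(Nat.lt_floor_add_one (g x - t)).le]
      refine le_trans ?_ le_add_self
      refine le_trans ?_ (ENNReal.le_tsum ⌊g x - t⌋₊)
      rw [Set.indicator_of_mem (by exact h1)]
      exact ENNReal.ofReal_le_ofReal (Real.exp_le_exp.mpr h2)
    · exact (ENNReal.ofReal_le_ofReal (Real.exp_le_exp.mpr hx.le)).trans le_self_add
  have he : Real.exp 1 * (1 / 4) < 1 := by
    have := Real.exp_one_lt_d9
    linarith
  have hsum : Summable fun k : ℕ => Real.exp (t + 1) * B * (Real.exp 1 * (1 / 4)) ^ k :=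
    (summable_geometric_of_lt_one (by positivity) he).mul_left _
  calc ∫⁻ x, ENNReal.ofReal (Real.exp (g x)) ∂μ
      ≤ ∫⁻ x, (ENNReal.ofReal (Real.exp t) + ∑' k : ℕ, Set.indicator {x | t + k ≤ g x}
        (fun _ => ENNReal.ofReal (Real.exp (t + k + 1))) x) ∂μ := lintegral_mono hpt
    _ = ENNReal.ofReal (Real.exp t) * μ Set.univ + ∑' k : ℕ,
        ENNReal.ofReal (Real.exp (t + k + 1)) * μ {x | t + k ≤ g x} := by
        rw [lintegral_add_left measurable_const, lintegral_const,
          lintegral_tsum fun k => (measurable_const.indicator (hs k)).aemeasurable]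
        congr 1
        exact tsum_congr fun k => lintegral_indicator_const (hs k) _
    _ ≤ ENNReal.ofReal (Real.exp t) * μ Set.univ + ∑' k : ℕ,
        ENNReal.ofReal (Real.exp (t + 1) * B * (Real.exp 1 * (1 / 4)) ^ k) := by
        refine add_le_add le_rfl (ENNReal.tsum_le_tsum fun k => ?_)
        refine (mul_le_mul_right (h k) _).trans_eq ?_
        rw [← ENNReal.ofReal_mul (Real.exp_pos _).le]
        congr 1
        rw [mul_pow, ← Real.exp_nat_mul, mul_one, show t + k + 1 = (t + 1) + k by ring, Real.exp_add]
        ring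
    _ < ⊤ := by
        refine ENNReal.add_lt_top.mpr ⟨ENNReal.mul_lt_top ENNReal.ofReal_lt_top (measure_lt_top _ _), ?_⟩
        rw [← ENNReal.ofReal_tsum_of_nonneg (fun k => by positivity) hsum]
        exact ENNReal.ofReal_lt_top

/-- Each dyadic block adds at most 1, and the term j = 0 is zero by convention. There is no additive
constant. -/
lemma sum_range_two_pow_inv_le (k : ℕ) : ∑ j ∈ Finset.range (2 ^ k), (1 / j : ℝ) ≤ k := by
  induction k with
  | zero => simp
  | succ k ih =>
    rw [pow_succ, mul_two, Finset.sum_range_add]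
    have h : ∑ x ∈ Finset.range (2 ^ k), (1 / ((2 ^ k + x : ℕ) : ℝ)) ≤
        ∑ x ∈ Finset.range (2 ^ k), (1 / (2 ^ k : ℝ)) := by
      refine Finset.sum_le_sum fun x _ => one_div_le_one_div_of_le (by positivity) ?_
      push_cast
      linarith [(Nat.cast_nonneg x : (0 : ℝ) ≤ x)]
    rw [Finset.sum_const, Finset.card_range, nsmul_eq_mul] at h
    push_cast at h ⊢
    rw [mul_one_div_cancel (by positivity)] at h
    linarith

/-- The integers of absolute value less than `N`. -/
def absLt (N : ℕ) : Finset ℤ :=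
  (Finset.range N).image (fun j : ℕ => (j : ℤ)) ∪ (Finset.range N).image (fun j : ℕ => -(j : ℤ))

lemma mem_absLt {N : ℕ} {m : ℤ} : m ∈ absLt N ↔ m.natAbs < N := by
  simp only [absLt, Finset.mem_union, Finset.mem_image, Finset.mem_range]
  constructor
  · rintro (⟨j, hj, rfl⟩ | ⟨j, hj, rfl⟩) <;> simpa using hj
  · intro h
    obtain ⟨j, rfl | rfl⟩ := m.eq_nat_or_neg
    · exact Or.inl ⟨j, by simpa using h, rfl⟩
    · exact Or.inr ⟨j, by simpa using h, rfl⟩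

lemma sum_absLt_inv_le (k : ℕ) : ∑ m ∈ absLt (2 ^ k), (1 / m.natAbs : ℝ) ≤ 2 * k := by
  have h1 := Finset.sum_union_inter (s₁ := (Finset.range (2 ^ k)).image (fun j : ℕ => (j : ℤ)))
    (s₂ := (Finset.range (2 ^ k)).image (fun j : ℕ => -(j : ℤ)))
    (f := fun m : ℤ => (1 / m.natAbs : ℝ))
  rw [Finset.sum_image (fun a _ b _ h => by simpa using h),
    Finset.sum_image (fun a _ b _ h => by simpa using h)] at h1
  simp only [Int.natAbs_neg, Int.natAbs_natCast] at h1
  have h2 := sum_range_two_pow_inv_le k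
  have h3 : 0 ≤ ∑ m ∈ (Finset.range (2 ^ k)).image (fun j : ℕ => (j : ℤ)) ∩
      (Finset.range (2 ^ k)).image (fun j : ℕ => -(j : ℤ)), (1 / m.natAbs : ℝ) :=
    Finset.sum_nonneg fun _ _ => by positivity
  rw [absLt]
  linarith

lemma exists_bound_of_mem_harmZ {m : ℤ} {F : L2 n} (hF : F ∈ harmZ n m) :
    ∀ᵐ ζ ∂(surf n), reproConst n m.natAbs * ‖F ζ‖ ^ 2 ≤ ‖F‖ ^ 2 := by
  obtain ⟨j, rfl | rfl⟩ := m.eq_nat_or_neg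
  · rw [harmZ_natCast] at hF
    simpa using exists_bound_of_mem_harm_left hF
  · have h1 := conjL2_mem_harmZ hF
    rw [neg_neg, harmZ_natCast] at h1
    filter_upwards [exists_bound_of_mem_harm_left h1, coeFn_conjL2 F] with ζ h2 h3
    rw [h3, norm_conjL2, RCLike.norm_conj] at h2
    simpa using h2

lemma comp_sub_sum (N : ℕ) (m : ℤ) (F : L2 n) :
    comp m (F - ∑ i ∈ absLt N, comp i F) = if m.natAbs < N then 0 else comp m F := by
  have h1 : ∀ i, comp m (comp i F) = if i = m then comp m F else 0 := by
    intro i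
    split_ifs with h
    · rw [h, comp_eq_self (comp_mem m F)]
    · exact comp_eq_zero (Ne.symm h) (comp_mem i F)
  rw [map_sub, map_sum]
  simp only [h1, Finset.sum_ite_eq', mem_absLt]
  split_ifs <;> simp

lemma natAbs_pow_le_lamWeight (m : ℤ) : (m.natAbs : ℝ) ^ (n + 1) ≤ lamWeight n m := by
  rw [coe_lamWeight, eigenvalueQ, ← Finset.card_range (n + 1), ← Finset.prod_const,
    Finset.card_range]
  exact Finset.prod_le_prod (fun _ _ => by positivity) fun l _ => by
    linarith [(Nat.cast_nonneg l : (0 : ℝ) ≤ l)]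

/-- For |m| ≥ 2^k the eigenvalue is at least |m|^{n+1} ≥ 4^k, because n + 1 ≥ 2. -/
lemma norm_sub_sum_comp_sq_le (hn : 1 ≤ n) {F : L2 n} (hP : F ∈ pluriharmonic n)
    (hF : F ∈ lamDom n) (k : ℕ) :
    ‖F - ∑ i ∈ absLt (2 ^ k), comp i F‖ ^ 2 ≤ ‖lamMap n ⟨F, hF⟩‖ ^ 2 * (1 / 4) ^ k := by
  have hP' : F - ∑ i ∈ absLt (2 ^ k), comp i F ∈ pluriharmonic n :=
    sub_mem hP (Submodule.sum_mem _ fun i _ => harmZ_le_pluriharmonic i (comp_mem i F))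
  refine hasSum_le (fun m => ?_) (hasSum_norm_comp_sq hP')
    ((hasSum_norm_wMap_sq (P := comp) (w := lamWeight n) ⟨F, hF⟩).mul_right _)
  rw [comp_sub_sum]
  split_ifs with h
  · rw [norm_zero, zero_pow two_ne_zero]
    positivity
  · have h1 : (2 : ℝ) ^ k ≤ m.natAbs := by exact_mod_cast not_lt.mp h
    have h2 : (4 : ℝ) ^ k ≤ lamWeight n m := by
      refine le_trans ?_ (natAbs_pow_le_lamWeight m)
      refine le_trans ?_ (pow_le_pow_left₀ (by positivity) h1 (n + 1))
      rw [← pow_mul, show (4 : ℝ) = 2 ^ 2 by norm_num, ← pow_mul]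
      refine pow_le_pow_right₀ (by norm_num) ?_
      nlinarith
    have h3 : 1 ≤ (lamWeight n m : ℝ) * (1 / 4) ^ k := by
      rw [one_div, inv_pow, ← div_eq_mul_inv, le_div_iff₀ (by positivity), one_mul]
      exact h2
    change _ ≤ (lamWeight n m : ℝ) * ‖comp m F‖ ^ 2 * (1 / 4) ^ k
    nlinarith [mul_le_mul_of_nonneg_right h3 (sq_nonneg ‖comp m F‖)]

/-- Point evaluation and `lamWeight_mul_reproConst` bound |m| |F_m(ζ)|² by the m-th term of the
form, up to a constant. By a ≤ ½ (|m| a² + 1/|m|), the first parts sum to a constant T and the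
second to at most ½ · 2k. The slope 1 in k is what lets e < 4 suffice later. -/
lemma norm_sum_comp_le_add (F : L2 n) (hF : F ∈ lamDom n) : ∃ T : ℝ, ∀ k : ℕ, ∀ᵐ ζ ∂(surf n),
    ‖(∑ i ∈ absLt (2 ^ k), comp i F : L2 n) ζ‖ ≤ T + k := by
  have hω := surfTotal_pos (n := n)
  have hf : (0 : ℝ) < n.factorial := Nat.cast_pos.mpr (Nat.factorial_pos n)
  set κ := surfTotal n * n.factorial with hκ
  have hκ0 : 0 < κ := by positivity
  -- The form does not control m = 0; that component is bounded separately, through x ≤ 1 + x².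
  set D := 1 + ‖comp 0 F‖ ^ 2 / reproConst n 0 with hD
  have hD0 : 0 ≤ D := by have := reproConst_pos (n := n) 0; positivity
  refine ⟨‖lamMap n ⟨F, hF⟩‖ ^ 2 / (2 * κ) + D, fun k => ?_⟩
  have hall : ∀ᵐ ζ ∂(surf n), ∀ m : ℤ,
      reproConst n m.natAbs * ‖comp m F ζ‖ ^ 2 ≤ ‖comp m F‖ ^ 2 :=
    ae_all_iff.mpr fun m => exists_bound_of_mem_harmZ (comp_mem m F)
  filter_upwards [hall, Lp.coeFn_finsetSum (absLt (2 ^ k)) (fun i => comp i F)] with ζ h1 h2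
  rw [h2]
  have hterm : ∀ m : ℤ, ‖comp m F ζ‖ ≤ (lamWeight n m : ℝ) * ‖comp m F‖ ^ 2 / (2 * κ) +
      1 / 2 * (1 / m.natAbs) + if m = 0 then D else 0 := by
    intro m
    split_ifs with hm
    · subst hm
      have h3 := h1 0
      rw [lamWeight_zero]
      simp only [Int.natAbs_zero, NNReal.coe_zero, Nat.cast_zero] at h3 ⊢
      have h4 : ‖comp 0 F ζ‖ ^ 2 ≤ ‖comp 0 F‖ ^ 2 / reproConst n 0 := by
        rw [le_div_iff₀ (reproConst_pos 0)]
        linarith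
      have h5 : ‖comp 0 F ζ‖ ≤ D := by
        nlinarith [sq_nonneg (‖comp 0 F ζ‖ - 1), norm_nonneg (comp 0 F ζ)]
      simpa using h5
    · have hj : m.natAbs ≠ 0 := Int.natAbs_ne_zero.mpr hm
      have hj' : (0 : ℝ) < m.natAbs := Nat.cast_pos.mpr (Nat.pos_of_ne_zero hj)
      have h3 := lamWeight_mul_reproConst (n := n) m.natAbs hj
      have h4 : lamWeight n (m.natAbs : ℤ) = lamWeight n m := by
        rw [lamWeight, lamWeight, Int.natAbs_natCast]
      rw [h4] at h3
      have h5 := mul_le_mul_of_nonneg_left (h1 m) (NNReal.coe_nonneg (lamWeight n m))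
      rw [← mul_assoc, h3] at h5
      have h6 : m.natAbs * ‖comp m F ζ‖ ^ 2 ≤ (lamWeight n m : ℝ) * ‖comp m F‖ ^ 2 / κ := by
        rw [le_div_iff₀ hκ0]
        linarith
      have h7 : ‖comp m F ζ‖ ≤ 1 / 2 * (m.natAbs * ‖comp m F ζ‖ ^ 2) + 1 / 2 * (1 / m.natAbs) := by
        have e : 1 / 2 * (m.natAbs * ‖comp m F ζ‖ ^ 2) + 1 / 2 * (1 / m.natAbs) - ‖comp m F ζ‖ =
            1 / 2 * (1 / m.natAbs) * (m.natAbs * ‖comp m F ζ‖ - 1) ^ 2 := by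
          field_simp
          ring
        have : 0 ≤ 1 / 2 * (1 / (m.natAbs : ℝ)) * (m.natAbs * ‖comp m F ζ‖ - 1) ^ 2 := by positivity
        linarith
      have h8 : (lamWeight n m : ℝ) * ‖comp m F‖ ^ 2 / (2 * κ) =
          1 / 2 * ((lamWeight n m : ℝ) * ‖comp m F‖ ^ 2 / κ) := by
        field_simp
      rw [h8, add_zero]
      linarith
  have hsum : ∑ m ∈ absLt (2 ^ k), (lamWeight n m : ℝ) * ‖comp m F‖ ^ 2 ≤
      ‖lamMap n ⟨F, hF⟩‖ ^ 2 :=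
    sum_le_hasSum _ (fun i _ => by positivity)
      (hasSum_norm_wMap_sq (P := comp) (w := lamWeight n) ⟨F, hF⟩)
  have hite : ∑ m ∈ absLt (2 ^ k), (if m = 0 then D else 0) ≤ D := by
    rw [Finset.sum_ite_eq']
    split_ifs <;> linarith
  have hinv := sum_absLt_inv_le k
  calc ‖(∑ i ∈ absLt (2 ^ k), ⇑(comp i F)) ζ‖ = ‖∑ i ∈ absLt (2 ^ k), comp i F ζ‖ := by
        rw [Finset.sum_apply]
    _ ≤ ∑ m ∈ absLt (2 ^ k), ‖comp m F ζ‖ := norm_sum_le _ _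
    _ ≤ ∑ m ∈ absLt (2 ^ k), ((lamWeight n m : ℝ) * ‖comp m F‖ ^ 2 / (2 * κ) +
      1 / 2 * (1 / m.natAbs) + if m = 0 then D else 0) := Finset.sum_le_sum fun m _ => hterm m
    _ = (∑ m ∈ absLt (2 ^ k), (lamWeight n m : ℝ) * ‖comp m F‖ ^ 2) / (2 * κ) +
      1 / 2 * ∑ m ∈ absLt (2 ^ k), (1 / m.natAbs : ℝ) +
        ∑ m ∈ absLt (2 ^ k), (if m = 0 then D else 0) := by
        rw [Finset.sum_add_distrib, Finset.sum_add_distrib, Finset.sum_div, Finset.mul_sum]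
    _ ≤ _ := by
        have := div_le_div_of_nonneg_right hsum (by positivity : 0 ≤ 2 * κ)
        linarith

lemma measure_one_le_norm_le (G : L2 n) :
    surf n {ζ | 1 ≤ ‖G ζ‖} ≤ ENNReal.ofReal (‖G‖ ^ 2) := by
  have h := mul_meas_ge_le_pow_eLpNorm' (surf n) (p := 2) two_ne_zero ENNReal.ofNat_ne_top
    (Lp.aestronglyMeasurable G) 1
  simp only [ENNReal.toReal_ofNat, ENNReal.rpow_ofNat, one_pow, one_mul] at h
  rw [← Lp.enorm_def, ← ofReal_norm, ← ENNReal.ofReal_pow (norm_nonneg _)] at h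
  refine (measure_mono fun ζ hζ => ?_).trans h
  rw [Set.mem_ofPred_eq] at hζ ⊢
  rw [← ofReal_norm, ← ENNReal.ofReal_one]
  exact ENNReal.ofReal_le_ofReal hζ

/-- Functions in `W^{Q/2,2} ∩ RP` are exponentially integrable. -/
theorem integrable_exp (hn : 1 ≤ n) {F : L2 n} (hF : F ∈ sobolevRealPluriharmonic n) :
    Integrable (fun ζ => Real.exp (F ζ).re) (surf n) := by
  have hL := mem_lamDom_of_mem_sobolev hn hF
  obtain ⟨T, hT⟩ := norm_sum_comp_le_add F hL
  have hm : Measurable fun ζ => (F ζ).re :=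
    Complex.measurable_re.comp (Lp.stronglyMeasurable F).measurable
  refine ⟨(Real.measurable_exp.comp hm).aestronglyMeasurable, ?_⟩
  rw [hasFiniteIntegral_iff_ofReal (Filter.Eventually.of_forall fun ζ => (Real.exp_pos _).le)]
  refine lintegral_exp_lt_top hm (t := T + 1) (sq_nonneg ‖lamMap n ⟨F, hL⟩‖) fun k => ?_
  -- Where F ≥ T + 1 + k, the low components account for at most T + k, so the tail G has modulus at
  -- least 1 and Chebyshev's inequality applies.
  set G := F - ∑ i ∈ absLt (2 ^ k), comp i F with hG
  refine le_trans ?_ ((measure_one_le_norm_le G).trans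
    (ENNReal.ofReal_le_ofReal (norm_sub_sum_comp_sq_le hn hF.2.1 hL k)))
  refine measure_mono_ae ?_
  filter_upwards [hT k, Lp.coeFn_sub F (∑ i ∈ absLt (2 ^ k), comp i F)] with ζ h1 h2 h3
  change 1 ≤ ‖G ζ‖
  change T + 1 + k ≤ (F ζ).re at h3
  rw [hG, h2, Pi.sub_apply]
  have h4 := norm_sub_norm_le (F ζ) ((∑ i ∈ absLt (2 ^ k), comp i F : L2 n) ζ)
  have h5 := Complex.re_le_norm (F ζ)
  linarith

end CRSphere

end

theorem proposition3p2 (n : ℕ) (hn : 1 ≤ n) :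
    IsLeast {M : Submodule ℝ (CRSphere.L2 n) |
        IsClosed (M : Set (CRSphere.L2 n)) ∧ CRSphere.IsInvariant M}
      (CRSphere.realPluriharmonic n) ∧
    IsLeast {M : Submodule ℝ (CRSphere.L2 n) |
        CRSphere.IsClosedInSobolev (CRSphere.halfQ n) M ∧ CRSphere.IsInvariant M}
      (CRSphere.sobolevRealPluriharmonic n) ∧
    ∀ F ∈ CRSphere.sobolevRealPluriharmonic n,
      MeasureTheory.Integrable (fun ζ => Real.exp (F ζ).re) (CRSphere.surf n) ∧
      ∀ τ : CRSphere.Sph n → CRSphere.Sph n, CRSphere.IsConformal τ →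
        ∃ h : MeasureTheory.MemLp (CRSphere.confAct τ F) 2 (CRSphere.surf n),
          CRSphere.becknerOnofri (h.toLp (CRSphere.confAct τ F)) = CRSphere.becknerOnofri F := by
  refine ⟨CRSphere.isLeast_realPluriharmonic hn, CRSphere.isLeast_sobolevRealPluriharmonic hn,
    fun F hF => ⟨CRSphere.integrable_exp hn hF, fun τ hτ => ?_⟩⟩
  obtain ⟨A, h⟩ := CRSphere.isConformal_iff.mp hτ
  exact ⟨CRSphere.memLp_confAct h F, CRSphere.becknerOnofri_confAct hn h ⟨F, hF⟩
    (CRSphere.integrable_exp hn hF) _⟩
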